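/- Theorem 2.1. Let $n\ge 3$, $a<b$, and let $\gamma\in C^3([a,b],\mathbb{R}^n)$ be injective with $\gamma'(t)\neq 0$ for all $t\in[a,b]$. For $\varepsilon>0$ let $$T^\gamma_\varepsilon=\bigcup_{t\in(a,b)}\{\gamma(t)+\xi:\ \xi\in\mathbb{R}^n,\ \xi\cdot\gamma'(t)=0,\ |\xi|<\varepsilon\}.$$ Let $f:\mathbb{R}\to\mathbb{R}$ be continuous and suppose that for some $p>\frac{2n}{n-2}$ $$t f(t)\ \ge\ p\int_0^t f(\tau)\,d\tau\ \ge\ 0\qquad\text{for all } t\in\mathbb{R}.$$ Then there exists $\bar\varepsilon>0$ such that for every $\varepsilon\in(0,\bar\varepsilon)$ the Dirichlet problem $$\Delta u+f(u)=0\ \text{ in } T^\gamma_\varepsilon,\qquad u=0\ \text{ on }\partial T^\gamma_\varepsilon$$ has $u\equiv 0$ as its only solution. This holds both for classical solutions, $u\in C^2(T^\gamma_\varepsilon)\cap C(\overline{T^\gamma_\varepsilon})$ satisfying the equation and the boundary condition pointwise, and for bounded weak solutions, $u\in H^1_0(T^\gamma_\varepsilon)\cap L^\infty(T^\gamma_\varepsilon)$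 with $\int_{T^\gamma_\varepsilon} \nabla u\cdot\nabla\varphi\,dx=\int_{T^\gamma_\varepsilon} f(u)\varphi\,dx$ for all $\varphi\in C_c^\infty(T^\gamma_\varepsilon)$ (where $u\equiv0$ means $u=0$ almost everywhere). -/

import Mathlib

open MeasureTheory Set Filter Topology

/-- The open tube of thickness `ε` around the curve `γ : [a, b] → ℝⁿ`: the union over `t ∈ (a, b)`
of the open normal discs `γ(t) + {ξ : ξ · γ'(t) = 0, |ξ| < ε}`. It has flat ends at `t = a` and
`t = b`. (On `(a, b)` the derivative within `[a, b]` is the usual derivative.) -/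
def tube {n : ℕ} (γ : ℝ → EuclideanSpace ℝ (Fin n)) (a b ε : ℝ) :
    Set (EuclideanSpace ℝ (Fin n)) :=
  {x | ∃ t ∈ Ioo a b, ∃ ξ : EuclideanSpace ℝ (Fin n),
    inner ℝ ξ (derivWithin γ (Icc a b) t) = 0 ∧ ‖ξ‖ < ε ∧ x = γ t + ξ}

/-- `φ` is a test function in `Ω`: smooth, with compact support contained in `Ω`. -/
structure IsTestFunction {n : ℕ} (Ω : Set (EuclideanSpace ℝ (Fin n)))
    (φ : EuclideanSpace ℝ (Fin n) → ℝ) : Prop where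
  smooth : ContDiff ℝ (⊤ : ℕ∞) φ
  compact : HasCompactSupport φ
  support : tsupport φ ⊆ Ω

/-- `u` belongs to `H¹₀(Ω)`, the closure of the test functions in `H¹(Ω)`, and `G` is its weak
gradient: some sequence of test functions converges to `u` in `L²(Ω)` while the sequence of
gradients converges to `G` in `L²(Ω)`. -/
structure IsH10WithGradient {n : ℕ} (Ω : Set (EuclideanSpace ℝ (Fin n)))
    (u : EuclideanSpace ℝ (Fin n) → ℝ)
    (G : EuclideanSpace ℝ (Fin n) → EuclideanSpace ℝ (Fin n)) : Prop where
  memLp : MemLp u 2 (volume.restrict Ω)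
  memLp_gradient : MemLp G 2 (volume.restrict Ω)
  approx : ∃ φ : ℕ → EuclideanSpace ℝ (Fin n) → ℝ,
    (∀ k, IsTestFunction Ω (φ k)) ∧
    Tendsto (fun k => eLpNorm (fun x => φ k x - u x) 2 (volume.restrict Ω)) atTop (𝓝 0) ∧
    Tendsto (fun k => eLpNorm (fun x => gradient (φ k) x - G x) 2 (volume.restrict Ω))
      atTop (𝓝 0)

/-- Bounded weak solutions `u ∈ H¹₀(Ω) ∩ L^∞(Ω)` of `Δu + f(u) = 0` in `Ω`, `u = 0` on `∂Ω`:
`∫_Ω ∇u · ∇φ = ∫_Ω f(u) φ` for all test functions `φ`. -/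
def IsBoundedWeakSolution {n : ℕ} (f : ℝ → ℝ) (Ω : Set (EuclideanSpace ℝ (Fin n)))
    (u : EuclideanSpace ℝ (Fin n) → ℝ) : Prop :=
  MemLp u ⊤ (volume.restrict Ω) ∧
  ∃ G : EuclideanSpace ℝ (Fin n) → EuclideanSpace ℝ (Fin n), IsH10WithGradient Ω u G ∧
    ∀ φ : EuclideanSpace ℝ (Fin n) → ℝ, IsTestFunction Ω φ →
      ∫ x in Ω, inner ℝ (G x) (gradient φ x) = ∫ x in Ω, f (u x) * φ x

/-- Classical solutions `u ∈ C²(Ω) ∩ C(closure Ω)` of `Δu + f(u) = 0` in `Ω`, `u = 0` on `∂Ω`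
(for open `Ω`). -/
structure IsClassicalSolution {n : ℕ} (f : ℝ → ℝ) (Ω : Set (EuclideanSpace ℝ (Fin n)))
    (u : EuclideanSpace ℝ (Fin n) → ℝ) : Prop where
  contDiffOn : ContDiffOn ℝ 2 u Ω
  continuousOn : ContinuousOn u (closure Ω)
  equation : ∀ x ∈ Ω, Laplacian.laplacian u x + f (u x) = 0
  boundary : ∀ x ∈ frontier Ω, u x = 0

set_option linter.unusedSectionVars false

/-! The proof is a Pohozaev argument for a vector field adapted to the curve. In Fermi-type
coordinates `X` the tube is the image of a straight tube `Q`, centred at the origin and hence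
star-shaped; the field is the image of the radial field `z`. In these coordinates the Dirichlet
energy is `∫ J ‖B ∇w‖²` with `J = |det dX|` and `B` the inverse transpose of `dX`. On the axis `dX`
is an isometry, so the metric there is Euclidean, and since rays from the origin through axis points
stay in the axis, its radial derivative vanishes there. By compactness, in a thin tube both the
energy form and `J` change under `z ↦ l⁻¹ • z` at a relative rate at most `η`, with `η` as small as
desired (`exists_dilationControl`).

With `A` the energy, `F` the primitive of `f` and `n` the dimension, dilation then yields `-(n + η)
∫ F(w) ≤ (2 - n + η) / 2 * A`, while testing the equation with `w` and using the growth condition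
yields `p ∫ F(w) ≤ A`. Together, `((n - 2 - η) / 2 - (n + η) / p) * A ≤ 0`. The bracket is positive
for small `η` exactly because `p > 2n / (n - 2)`, so `A = 0`, and Poincaré's inequality gives `w =
0` (`DilationControl.ae_eq_zero`).

A weak solution is too irregular at the boundary for the classical identity, so the inequality is
derived by comparison. If `ω` is a test function on a star-shaped domain, so is `z ↦ ω (l • z)` for
`l ≥ 1`. Testing the equation with the increment `ω (l • z) - ω z` and using Young's inequality
compares energies before and after dilation; letting `ω` tend to the solution and then `l` to `1`
gives the inequality (`DilationControl.radial_le`). The boundary term of the classical identity,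
which has a favourable sign, never appears.

Classical solutions are not assumed to have finite energy. `exists_weak_of_classical` obtains it by
truncating `u` near the value zero, which produces compactly supported test functions with uniformly
bounded gradients in `L²`. -/

/-- `φ` is continuously differentiable with compact support contained in `Ω`. -/
structure IsC1Test {E : Type*} [NormedAddCommGroup E] [NormedSpace ℝ E] (Ω : Set E)
    (φ : E → ℝ) : Prop where
  contDiff : ContDiff ℝ 1 φ
  compact : HasCompactSupport φ
  support : tsupport φ ⊆ Ω

/-! ### Passage to the limit in `L²`. -/

section L2

variable {α F : Type*} [MeasurableSpace α] {μ : Measure α} [NormedAddCommGroup F]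
  [InnerProductSpace ℝ F]

lemma integral_inner_toLp {a b : α → F} (ha : MemLp a 2 μ) (hb : MemLp b 2 μ) :
    inner ℝ (ha.toLp a) (hb.toLp b) = ∫ x, inner ℝ (a x) (b x) ∂μ := by
  rw [L2.inner_def]
  apply integral_congr_ae
  filter_upwards [ha.coeFn_toLp, hb.coeFn_toLp] with x h1 h2
  rw [h1, h2]

lemma tendsto_integral_inner_of_tendsto_eLpNorm {a b : ℕ → α → F} {a₀ b₀ : α → F}
    (ha : ∀ k, MemLp (a k) 2 μ) (hb : ∀ k, MemLp (b k) 2 μ) (ha₀ : MemLp a₀ 2 μ)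
    (hb₀ : MemLp b₀ 2 μ)
    (hla : Tendsto (fun k => eLpNorm (fun x => a k x - a₀ x) 2 μ) atTop (𝓝 0))
    (hlb : Tendsto (fun k => eLpNorm (fun x => b k x - b₀ x) 2 μ) atTop (𝓝 0)) :
    Tendsto (fun k => ∫ x, inner ℝ (a k x) (b k x) ∂μ) atTop
      (𝓝 (∫ x, inner ℝ (a₀ x) (b₀ x) ∂μ)) := by
  have h1 := (Lp.tendsto_Lp_iff_tendsto_eLpNorm'' a ha a₀ ha₀).2 hla
  have h2 := (Lp.tendsto_Lp_iff_tendsto_eLpNorm'' b hb b₀ hb₀).2 hlb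
  have h3 := h1.inner (𝕜 := ℝ) h2
  simpa only [integral_inner_toLp] using h3

lemma tendsto_integral_mul_of_tendsto_eLpNorm {a b : ℕ → α → ℝ} {a₀ b₀ : α → ℝ}
    (ha : ∀ k, MemLp (a k) 2 μ) (hb : ∀ k, MemLp (b k) 2 μ) (ha₀ : MemLp a₀ 2 μ)
    (hb₀ : MemLp b₀ 2 μ)
    (hla : Tendsto (fun k => eLpNorm (fun x => a k x - a₀ x) 2 μ) atTop (𝓝 0))
    (hlb : Tendsto (fun k => eLpNorm (fun x => b k x - b₀ x) 2 μ) atTop (𝓝 0)) :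
    Tendsto (fun k => ∫ x, a k x * b k x ∂μ) atTop (𝓝 (∫ x, a₀ x * b₀ x ∂μ)) := by
  simpa [mul_comm] using tendsto_integral_inner_of_tendsto_eLpNorm ha hb ha₀ hb₀ hla hlb

lemma tendsto_eLpNorm_const_zero {G : Type*} [NormedAddCommGroup G] (a : α → G) :
    Tendsto (fun _ : ℕ => eLpNorm (fun x => a x - a x) 2 μ) atTop (𝓝 0) := by
  simp

/-- Dominated convergence applied to `‖a k - a₀‖²`. The difference, rather than `a k`, is dominated,
which suits the truncated gradients of a classical solution. -/
lemma tendsto_eLpNorm_two_of_dominated {G : Type*} [NormedAddCommGroup G]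
    {a : ℕ → α → G} {a₀ : α → G} {g : α → ℝ} (hg : MemLp g 2 μ)
    (ha : ∀ k, AEStronglyMeasurable (a k) μ) (hb : ∀ k, ∀ᵐ x ∂μ, ‖a k x - a₀ x‖ ≤ g x)
    (hlim : ∀ᵐ x ∂μ, Tendsto (fun k => a k x) atTop (𝓝 (a₀ x))) :
    Tendsto (fun k => eLpNorm (fun x => a k x - a₀ x) 2 μ) atTop (𝓝 0) := by
  have ha₀ : AEStronglyMeasurable a₀ μ := aestronglyMeasurable_of_tendsto_ae _ ha hlim
  have key : Tendsto (fun k => ∫⁻ x, ‖a k x - a₀ x‖ₑ ^ (2 : ℝ) ∂μ) atTop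
      (𝓝 (∫⁻ _, 0 ∂μ)) := by
    apply tendsto_lintegral_of_dominated_convergence' (fun x => ‖g x‖ₑ ^ (2 : ℝ))
    · intro k
      exact (((ha k).sub ha₀).enorm).pow_const _
    · intro k
      filter_upwards [hb k] with x h1
      gcongr
      rw [enorm_le_iff_norm_le]
      exact h1.trans (le_abs_self _)
    · have := (eLpNorm_lt_top_iff_lintegral_rpow_enorm_lt_top (p := 2) (by norm_num)
        (by norm_num)).1 hg.2
      simpa using this.ne
    · filter_upwards [hlim] with x hx
      have : Tendsto (fun k => a k x - a₀ x) atTop (𝓝 0) := by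
        simpa using hx.sub_const (a₀ x)
      have h2 := this.enorm
      simp only [enorm_zero] at h2
      have h3 := (ENNReal.continuous_rpow_const (y := 2)).tendsto 0 |>.comp h2
      simpa [Function.comp_def] using h3
  rw [lintegral_zero] at key
  simp_rw [eLpNorm_eq_lintegral_rpow_enorm_toReal (p := 2) (by norm_num) (by norm_num)]
  have h4 := (ENNReal.continuous_rpow_const (y := 1 / 2)).tendsto 0 |>.comp key
  simpa [Function.comp_def] using h4

lemma tendsto_eLpNorm_two_of_bounded_ae [IsFiniteMeasure μ] {G : Type*} [NormedAddCommGroup G]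
    {a : ℕ → α → G} {a₀ : α → G} {C : ℝ}
    (ha : ∀ k, AEStronglyMeasurable (a k) μ) (hb : ∀ k, ∀ᵐ x ∂μ, ‖a k x‖ ≤ C)
    (hlim : ∀ᵐ x ∂μ, Tendsto (fun k => a k x) atTop (𝓝 (a₀ x))) :
    Tendsto (fun k => eLpNorm (fun x => a k x - a₀ x) 2 μ) atTop (𝓝 0) := by
  have hb₀ : ∀ᵐ x ∂μ, ‖a₀ x‖ ≤ C := by
    filter_upwards [hlim, ae_all_iff.2 hb] with x h1 h2
    exact le_of_tendsto h1.norm (Eventually.of_forall h2)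
  refine tendsto_eLpNorm_two_of_dominated (memLp_const (2 * C)) ha (fun k => ?_) hlim
  filter_upwards [hb k, hb₀] with x h1 h2
  linarith [norm_sub_le (a k x) (a₀ x)]

lemma tendsto_eLpNorm_two_of_unif [IsFiniteMeasure μ] {G : Type*} [NormedAddCommGroup G]
    {a : ℕ → α → G} {a₀ : α → G} (ha : ∀ k, MemLp (a k) 2 μ) (ha₀ : MemLp a₀ 2 μ)
    (hb : ∀ k x, ‖a k x - a₀ x‖ ≤ 1 / ((k : ℝ) + 1)) :
    Tendsto (fun k => eLpNorm (fun x => a k x - a₀ x) 2 μ) atTop (𝓝 0) := by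
  have hl0 : Tendsto (fun k : ℕ => (1 : ℝ) / ((k : ℝ) + 1)) atTop (𝓝 0) :=
    tendsto_one_div_add_atTop_nhds_zero_nat
  have hle1 : ∀ k : ℕ, (1 : ℝ) / ((k : ℝ) + 1) ≤ 1 := fun k => by
    rw [div_le_one (by positivity)]; linarith [(Nat.cast_nonneg k : (0 : ℝ) ≤ k)]
  have := tendsto_eLpNorm_two_of_bounded_ae (μ := μ) (a := fun k x => a k x - a₀ x)
    (a₀ := fun _ => 0) (C := 1) (fun k => ((ha k).sub ha₀).1)
    (fun k => Eventually.of_forall fun x => (hb k x).trans (hle1 k))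
    (Eventually.of_forall fun x => squeeze_zero_norm (fun k => hb k x) hl0)
  simpa using this

end L2

/-! ### Test functions of class `C¹`: smooth approximation and Poincaré's inequality. -/

section C1

variable {E : Type*} [NormedAddCommGroup E] [InnerProductSpace ℝ E] [FiniteDimensional ℝ E]
  {Ω : Set E} {φ ψ : E → ℝ}

lemma ContDiff.continuous_gradient (h : ContDiff ℝ 1 φ) : Continuous (gradient φ) :=
  (InnerProductSpace.toDual ℝ E).symm.continuous.comp (h.continuous_fderiv (by norm_num))

lemma norm_gradient (x : E) : ‖gradient φ x‖ = ‖fderiv ℝ φ x‖ := by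
  simp [gradient]

lemma tsupport_gradient_subset : tsupport (gradient φ) ⊆ tsupport φ := by
  refine subset_trans (closure_mono ?_) (tsupport_fderiv_subset ℝ)
  intro x hx h
  apply hx
  simp [gradient, h]

lemma IsC1Test.hasCompactSupport_gradient (h : IsC1Test Ω φ) :
    HasCompactSupport (gradient φ) :=
  h.compact.isCompact.of_isClosed_subset isClosed_closure tsupport_gradient_subset

lemma IsC1Test.continuous_gradient (h : IsC1Test Ω φ) : Continuous (gradient φ) :=
  h.contDiff.continuous_gradient

lemma IsC1Test.differentiable (h : IsC1Test Ω φ) : Differentiable ℝ φ :=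
  h.contDiff.differentiable (by norm_num)

lemma IsC1Test.eq_zero (h : IsC1Test Ω φ) {x : E} (hx : x ∉ Ω) : φ x = 0 :=
  image_eq_zero_of_notMem_tsupport fun hx' => hx (h.support hx')

lemma IsC1Test.gradient_eq_zero (h : IsC1Test Ω φ) {x : E} (hx : x ∉ Ω) : gradient φ x = 0 :=
  image_eq_zero_of_notMem_tsupport fun hx' => hx (h.support (tsupport_gradient_subset hx'))

lemma gradient_sub' {x : E} (h : DifferentiableAt ℝ φ x) (h' : DifferentiableAt ℝ ψ x) :
    gradient (fun y => φ y - ψ y) x = gradient φ x - gradient ψ x := by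
  simp only [gradient]
  rw [fderiv_fun_sub h h', map_sub]

lemma IsC1Test.sub (h : IsC1Test Ω φ) (h' : IsC1Test Ω ψ) :
    IsC1Test Ω (fun x => φ x - ψ x) where
  contDiff := h.contDiff.sub h'.contDiff
  compact := h.compact.sub h'.compact
  support := (tsupport_sub φ ψ).trans (union_subset h.support h'.support)

variable [MeasurableSpace E] [BorelSpace E]

lemma IsC1Test.memLp (h : IsC1Test Ω φ) (p : ENNReal) (μ : Measure E)
    [IsFiniteMeasureOnCompacts μ] : MemLp φ p μ :=
  h.contDiff.continuous.memLp_of_hasCompactSupport h.compact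

lemma IsC1Test.memLp_gradient (h : IsC1Test Ω φ) (p : ENNReal) (μ : Measure E)
    [IsFiniteMeasureOnCompacts μ] : MemLp (gradient φ) p μ :=
  h.continuous_gradient.memLp_of_hasCompactSupport h.hasCompactSupport_gradient

/-- Approximation of `C¹` functions of compact support by smooth ones, uniformly with the
first derivatives. -/
lemma IsC1Test.exists_smooth_approx (h : IsC1Test Ω φ) (hΩ : IsOpen Ω) {δ : ℝ} (hδ : 0 < δ) :
    ∃ ψ : E → ℝ, ContDiff ℝ (⊤ : ℕ∞) ψ ∧ HasCompactSupport ψ ∧ tsupport ψ ⊆ Ω ∧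
      (∀ x, |ψ x - φ x| ≤ δ) ∧ ∀ x, ‖gradient ψ x - gradient φ x‖ ≤ δ := by
  -- Mollification at a radius below three thresholds: one keeps the support in `Ω`, the other two
  -- are the moduli of uniform continuity of `φ` and of its derivative. Convolution commutes with
  -- the derivative, so one bump function serves for both estimates.
  obtain ⟨r₀, hr₀, hsub⟩ := h.compact.isCompact.exists_cthickening_subset_open hΩ h.support
  have hu1 : UniformContinuous φ :=
    h.compact.uniformContinuous_of_continuous h.contDiff.continuous
  have hcf : Continuous (fderiv ℝ φ) := h.contDiff.continuous_fderiv (by norm_num)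
  have hu2 : UniformContinuous (fderiv ℝ φ) :=
    (h.compact.fderiv ℝ).uniformContinuous_of_continuous hcf
  obtain ⟨r₁, hr₁, h1⟩ := Metric.uniformContinuous_iff.1 hu1 δ hδ
  obtain ⟨r₂, hr₂, h2⟩ := Metric.uniformContinuous_iff.1 hu2 δ hδ
  set r := min r₀ (min r₁ r₂) with hr
  have hrpos : 0 < r := by positivity
  let b : ContDiffBump (0 : E) := ⟨r / 2, r, by positivity, by linarith⟩
  have hbr : b.rOut = r := rfl
  let ψ : E → ℝ := convolution (b.normed volume) φ (ContinuousLinearMap.lsmul ℝ ℝ) volume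
  have hder : ∀ x, HasFDerivAt ψ (convolution (b.normed volume) (fderiv ℝ φ)
      (ContinuousLinearMap.lsmul ℝ ℝ) volume x) x := by
    intro x
    have := h.compact.hasFDerivAt_convolution_right (μ := (volume : Measure E))
      (ContinuousLinearMap.lsmul ℝ ℝ) (f := b.normed volume)
      (b.continuous_normed.locallyIntegrable) h.contDiff x
    have e : convolution (b.normed volume) (fderiv ℝ φ)
        (ContinuousLinearMap.precompR E (ContinuousLinearMap.lsmul ℝ ℝ)) volume x =
        convolution (b.normed volume) (fderiv ℝ φ) (ContinuousLinearMap.lsmul ℝ ℝ) volume x := by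
      simp only [convolution_def]
      congr 1
    rw [← e]
    exact this
  refine ⟨ψ, ?_, ?_, ?_, ?_, ?_⟩
  · exact b.hasCompactSupport_normed.contDiff_convolution_left _ b.contDiff_normed
      h.contDiff.continuous.locallyIntegrable
  · exact HasCompactSupport.convolution _ b.hasCompactSupport_normed h.compact
  · refine subset_trans ?_ hsub
    apply closure_minimal _ Metric.isClosed_cthickening
    refine (support_convolution_subset _).trans ?_
    rintro _ ⟨y, hy, x, hx, rfl⟩
    rw [b.support_normed_eq, hbr, mem_ball_zero_iff] at hy
    apply Metric.mem_cthickening_of_dist_le _ x _ _ (subset_tsupport _ hx)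
    simp only [dist_eq_norm, add_sub_cancel_right]
    exact hy.le.trans (min_le_left _ _)
  · intro x
    rw [← Real.dist_eq]
    apply b.dist_normed_convolution_le h.contDiff.continuous.aestronglyMeasurable
    intro y hy
    rw [hbr, Metric.mem_ball] at hy
    exact (h1 (hy.trans_le ((min_le_right _ _).trans (min_le_left _ _)))).le
  · intro x
    have : ‖gradient ψ x - gradient φ x‖ = dist (fderiv ℝ ψ x) (fderiv ℝ φ x) := by
      rw [dist_eq_norm, gradient, gradient, ← map_sub, LinearIsometryEquiv.norm_map]
    rw [this, (hder x).fderiv]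
    apply b.dist_normed_convolution_le hcf.aestronglyMeasurable
    intro y hy
    rw [hbr, Metric.mem_ball] at hy
    exact (h2 (hy.trans_le ((min_le_right _ _).trans (min_le_right _ _)))).le

/-- An integral identity valid for smooth test functions holds for `C¹` test functions. -/
lemma weak_identity_of_smooth (hΩ : IsOpen Ω) (hfin : volume Ω < ⊤) {G : E → E} {g : E → ℝ}
    (hG : MemLp G 2 (volume.restrict Ω)) (hg : MemLp g 2 (volume.restrict Ω))
    (hweak : ∀ ψ : E → ℝ, ContDiff ℝ (⊤ : ℕ∞) ψ → HasCompactSupport ψ → tsupport ψ ⊆ Ω →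
      ∫ x in Ω, inner ℝ (G x) (gradient ψ x) = ∫ x in Ω, g x * ψ x)
    (h : IsC1Test Ω φ) :
    ∫ x in Ω, inner ℝ (G x) (gradient φ x) = ∫ x in Ω, g x * φ x := by
  have : IsFiniteMeasure (volume.restrict Ω) := ⟨by simpa using hfin⟩
  have hδ : ∀ k : ℕ, (0 : ℝ) < 1 / ((k : ℝ) + 1) := fun k => by positivity
  choose ψ h1 h2 h3 h4 h5 using fun k => h.exists_smooth_approx hΩ (hδ k)
  have hψ : ∀ k, IsC1Test Ω (ψ k) := fun k => ⟨(h1 k).of_le ( by norm_cast), h2 k, h3 k⟩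
  have hA := tendsto_integral_inner_of_tendsto_eLpNorm (fun _ => hG)
    (fun k => (hψ k).memLp_gradient 2 _) hG (h.memLp_gradient 2 _)
    (tendsto_eLpNorm_const_zero G)
    (tendsto_eLpNorm_two_of_unif (fun k => (hψ k).memLp_gradient 2 _) (h.memLp_gradient 2 _) h5)
  have hB := tendsto_integral_mul_of_tendsto_eLpNorm (fun _ => hg)
    (fun k => (hψ k).memLp 2 _) hg (h.memLp 2 _)
    (tendsto_eLpNorm_const_zero g)
    (tendsto_eLpNorm_two_of_unif (fun k => (hψ k).memLp 2 _) (h.memLp 2 _) h4)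
  simp_rw [fun k => hweak (ψ k) (h1 k) (h2 k) (h3 k)] at hA
  exact tendsto_nhds_unique hA hB

/-- Poincaré: a limit of test functions whose gradients tend to zero vanishes. -/
lemma ae_eq_zero_of_tendsto_gradient_zero (hn : 3 ≤ Module.finrank ℝ E)
    (hΩ : Bornology.IsBounded Ω) {u : E → ℝ} (hu : MemLp u 2 (volume.restrict Ω))
    {φ : ℕ → E → ℝ} (hφ : ∀ k, IsC1Test Ω (φ k))
    (h1 : Tendsto (fun k => eLpNorm (fun x => φ k x - u x) 2 (volume.restrict Ω)) atTop (𝓝 0))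
    (h2 : Tendsto (fun k => eLpNorm (gradient (φ k)) 2 (volume.restrict Ω)) atTop (𝓝 0)) :
    ∀ᵐ x ∂(volume.restrict Ω), u x = 0 := by
  -- Poincaré's inequality is the Gagliardo–Nirenberg–Sobolev inequality on a bounded set with both
  -- exponents equal to `2`. It needs `2` below the dimension, whence the assumption `3 ≤ finrank`.
  set C := eLpNormLESNormFDerivOfLeConst ℝ (volume : Measure E) Ω 2 2
  have hn' : (3 : ℝ) ≤ Module.finrank ℝ E := by exact_mod_cast hn
  have key : ∀ k, eLpNorm (φ k) 2 (volume.restrict Ω) ≤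
      C * eLpNorm (gradient (φ k)) 2 (volume.restrict Ω) := by
    intro k
    have hs : Function.support (φ k) ⊆ Ω := (subset_tsupport _).trans (hφ k).support
    have := eLpNorm_le_eLpNorm_fderiv_of_le (volume : Measure E) (hφ k).contDiff hs
      (p := 2) (q := 2) (by norm_num) (by
        have : (2 : NNReal) < (3 : ℕ) := by norm_num
        exact this.trans_le (by exact_mod_cast hn)) (by
        simp) hΩ
    refine (eLpNorm_mono_measure _ Measure.restrict_le_self).trans (this.trans ?_)
    gcongr
    have e1 : eLpNorm (gradient (φ k)) 2 volume = eLpNorm (fderiv ℝ (φ k)) 2 volume :=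
      eLpNorm_congr_norm_ae (Eventually.of_forall fun x => norm_gradient x)
    have e2 : eLpNorm (gradient (φ k)) 2 (volume.restrict Ω) = eLpNorm (gradient (φ k)) 2 volume := by
      apply eLpNorm_restrict_eq_of_support_subset
      intro x hx
      by_contra hx'
      exact hx ((hφ k).gradient_eq_zero hx')
    rw [e2, e1]
    rfl
  have h3 : Tendsto (fun k => eLpNorm (φ k) 2 (volume.restrict Ω)) atTop (𝓝 0) := by
    refine tendsto_of_tendsto_of_tendsto_of_le_of_le tendsto_const_nhds ?_ (fun k => zero_le) key
    simpa using ENNReal.Tendsto.const_mul h2 (Or.inr ENNReal.coe_ne_top)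
  have : IsFiniteMeasure (volume.restrict Ω) := ⟨by simpa using hΩ.measure_lt_top⟩
  have h4 : eLpNorm u 2 (volume.restrict Ω) = 0 := by
    have h34 := h3.add h1
    rw [add_zero] at h34
    refine le_antisymm (ge_of_tendsto h34 ?_) zero_le
    refine Eventually.of_forall fun k => ?_
    have e : u = fun x => φ k x - (φ k x - u x) := by ext x; ring
    calc eLpNorm u 2 (volume.restrict Ω) = eLpNorm (φ k - fun x => (φ k x - u x)) 2
          (volume.restrict Ω) := by congr 1
      _ ≤ _ := eLpNorm_sub_le ((hφ k).memLp 2 _).1 (((hφ k).memLp 2 _).sub hu).1 (by norm_num)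
  rw [eLpNorm_eq_zero_iff hu.1 (by norm_num)] at h4
  exact h4

end C1

/-! ### Star-shaped domains with coefficients almost invariant under dilations. -/

/-- A bounded open set `Q`, star-shaped about the origin, with a coefficient field `B` and a
density `J` which vary little under the dilations `z ↦ l⁻¹ • z`: the quadratic form
`J ‖B ·‖²` grows, and the density `J` decays, at most at the rate `η`. -/
structure DilationControl {E : Type*} [NormedAddCommGroup E] [NormedSpace ℝ E]
    [MeasurableSpace E] (Q : Set E) (B : E → E →L[ℝ] E) (J : E → ℝ) (η : ℝ) : Prop where
  isOpen : IsOpen Q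
  isBounded : Bornology.IsBounded Q
  star : ∀ z ∈ Q, ∀ l : ℝ, 1 ≤ l → l⁻¹ • z ∈ Q
  continuousOn_coeff : ContinuousOn B Q
  continuousOn_density : ContinuousOn J Q
  measurable_density : Measurable J
  density_lower : ∃ c : ℝ, 0 < c ∧ ∀ z ∈ Q, c ≤ J z
  density_upper : ∃ C : ℝ, ∀ z ∈ Q, J z ≤ C
  coeff_lower : ∃ c : ℝ, 0 < c ∧ ∀ z ∈ Q, ∀ v, c * ‖v‖ ≤ ‖B z v‖
  coeff_upper : ∃ C : ℝ, ∀ z ∈ Q, ‖B z‖ ≤ C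
  energy : ∀ z ∈ Q, ∀ l ∈ Ioc (1 : ℝ) 2, ∀ v,
    J (l⁻¹ • z) * ‖B (l⁻¹ • z) v‖ ^ 2 ≤ (1 + η * (l - 1)) * (J z * ‖B z v‖ ^ 2)
  mass : ∀ z ∈ Q, ∀ l ∈ Ioc (1 : ℝ) 2, (1 - η * (l - 1)) * J z ≤ J (l⁻¹ • z)

/-- The measure with density `J` on `Q`. -/
noncomputable def densityMeasure {E : Type*} [MeasureSpace E] (Q : Set E) (J : E → ℝ) :
    Measure E :=
  (volume.restrict Q).withDensity fun z => ENNReal.ofReal (J z)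

/-! ### Derivatives at `1` along a sequence of dilation factors. -/

section Sequences

/-- A sequence of dilation factors decreasing to `1`. -/
noncomputable def factor (j : ℕ) : ℝ := 1 + 1 / ((j : ℝ) + 1)

lemma factor_mem (j : ℕ) : factor j ∈ Ioc (1 : ℝ) 2 := by
  have h : (0 : ℝ) < 1 / ((j : ℝ) + 1) := by positivity
  have h' : (1 : ℝ) / ((j : ℝ) + 1) ≤ 1 := by
    rw [div_le_one (by positivity)]; linarith [(Nat.cast_nonneg j : (0 : ℝ) ≤ j)]
  constructor <;> unfold factor <;> linarith

lemma tendsto_factor : Tendsto factor atTop (𝓝[≠] 1) := by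
  apply tendsto_nhdsWithin_of_tendsto_nhds_of_eventually_within
  · have := tendsto_one_div_add_atTop_nhds_zero_nat (𝕜 := ℝ)
    change Tendsto (fun j : ℕ => 1 + 1 / ((j : ℝ) + 1)) atTop (𝓝 1)
    simpa using this.const_add 1
  · exact Eventually.of_forall fun j => (factor_mem j).1.ne'

lemma HasDerivAt.tendsto_factor {F : Type*} [NormedAddCommGroup F] [NormedSpace ℝ F]
    {θ : ℝ → F} {θ' : F} (h : HasDerivAt θ θ' 1) :
    Tendsto (fun j => (factor j - 1)⁻¹ • (θ (factor j) - θ 1)) atTop (𝓝 θ') := by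
  have := (hasDerivAt_iff_tendsto_slope.1 h).comp _root_.tendsto_factor
  simpa [Function.comp_def, slope_def_module] using this

end Sequences

/-! ### Dilations of test functions. -/

section Dilation

variable {E : Type*} [NormedAddCommGroup E] [InnerProductSpace ℝ E] [FiniteDimensional ℝ E]
  [MeasurableSpace E] [BorelSpace E]
  {Q : Set E} {B : E → E →L[ℝ] E} {J : E → ℝ} {η : ℝ} {ψ : E → ℝ}

lemma DilationControl.smul_notMem (h : DilationControl Q B J η) {z : E} (hz : z ∉ Q) {l : ℝ}
    (hl : 1 ≤ l) : l • z ∉ Q := by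
  intro hz'
  apply hz
  have := h.star _ hz' l hl
  rwa [inv_smul_smul₀ (by linarith)] at this

lemma DilationControl.density_pos (h : DilationControl Q B J η) {z : E} (hz : z ∈ Q) :
    0 < J z := by
  obtain ⟨c, hc, h'⟩ := h.density_lower
  exact hc.trans_le (h' z hz)

lemma DilationControl.measurableSet (h : DilationControl Q B J η) : MeasurableSet Q :=
  h.isOpen.measurableSet

lemma DilationControl.isFiniteMeasure_restrict (h : DilationControl Q B J η) :
    IsFiniteMeasure (volume.restrict Q : Measure E) :=
  ⟨by simpa using h.isBounded.measure_lt_top⟩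

lemma DilationControl.exists_norm_le (h : DilationControl Q B J η) :
    ∃ R : ℝ, 0 < R ∧ ∀ z ∈ Q, ‖z‖ ≤ R := by
  obtain ⟨R, hR, h'⟩ := h.isBounded.exists_pos_norm_le
  exact ⟨R, hR, h'⟩

lemma DilationControl.integral_densityMeasure (h : DilationControl Q B J η) (g : E → ℝ) :
    ∫ z, g z ∂(densityMeasure Q J) = ∫ z in Q, J z * g z := by
  rw [densityMeasure, integral_withDensity_eq_integral_toReal_smul
    h.measurable_density.ennreal_ofReal (by simp)]
  apply setIntegral_congr_fun h.measurableSet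
  intro z hz
  simp [ENNReal.toReal_ofReal (h.density_pos hz).le]

lemma DilationControl.integrableOn (h : DilationControl Q B J η) {g : E → ℝ}
    (hg : ContinuousOn g Q) {C : ℝ} (hC : ∀ z ∈ Q, |g z| ≤ C) : IntegrableOn g Q := by
  have := h.isFiniteMeasure_restrict
  refine Integrable.of_bound (hg.aestronglyMeasurable h.measurableSet) C ?_
  exact (ae_restrict_iff' h.measurableSet).2 (Eventually.of_forall hC)

lemma DilationControl.densityMeasure_le (h : DilationControl Q B J η) :
    ∃ C : ℝ, densityMeasure Q J ≤ ENNReal.ofReal C • (volume.restrict Q : Measure E) := by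
  obtain ⟨C, hC⟩ := h.density_upper
  refine ⟨C, ?_⟩
  rw [← withDensity_const]
  apply withDensity_mono
  exact (ae_restrict_iff' h.measurableSet).2 (Eventually.of_forall fun z hz =>
    ENNReal.ofReal_le_ofReal (hC z hz))

lemma DilationControl.isFiniteMeasure (h : DilationControl Q B J η) :
    IsFiniteMeasure (densityMeasure Q J) := by
  have := h.isFiniteMeasure_restrict
  obtain ⟨C, hC⟩ := h.densityMeasure_le
  constructor
  refine (hC univ).trans_lt ?_
  simp only [Measure.smul_apply, smul_eq_mul]
  exact ENNReal.mul_lt_top ENNReal.ofReal_lt_top (measure_lt_top _ _)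

lemma DilationControl.ae_mem (h : DilationControl Q B J η) :
    ∀ᵐ z ∂(densityMeasure Q J), z ∈ Q :=
  (withDensity_absolutelyContinuous _ _).ae_le (ae_restrict_mem h.measurableSet)

lemma DilationControl.aestronglyMeasurable (h : DilationControl Q B J η) {F : Type*}
    [NormedAddCommGroup F] [SecondCountableTopology F] {g : E → F}
    (hg : ContinuousOn g Q) : AEStronglyMeasurable g (densityMeasure Q J) :=
  (hg.aestronglyMeasurable h.measurableSet).mono_ac (withDensity_absolutelyContinuous _ _)

lemma DilationControl.integrable (h : DilationControl Q B J η) {g : E → ℝ}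
    (hg : IntegrableOn g Q) : Integrable g (densityMeasure Q J) := by
  obtain ⟨C, hC⟩ := h.densityMeasure_le
  exact (hg.smul_measure ENNReal.ofReal_ne_top).mono_measure hC

/-- Change of variables `z ↦ l • z` for integrands vanishing when `l • z` is outside `Q`. -/
lemma DilationControl.setIntegral_comp_smul (h : DilationControl Q B J η) (Φ : E → E → ℝ)
    (hΦ : ∀ z z', z' ∉ Q → Φ z z' = 0) {l : ℝ} (hl : 1 ≤ l) :
    ∫ z in Q, Φ z (l • z) =
      (l ^ Module.finrank ℝ E)⁻¹ * ∫ z in Q, Φ (l⁻¹ • z) z := by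
  have hl0 : l ≠ 0 := by linarith
  -- Star-shapedness sends a point outside `Q` to a point outside `Q`, so both integrals extend to
  -- the whole space, where the dilation has Jacobian `l ^ n`.
  rw [setIntegral_eq_integral_of_forall_compl_eq_zero
      (fun z hz => hΦ _ _ (h.smul_notMem hz hl)),
    setIntegral_eq_integral_of_forall_compl_eq_zero (fun z hz => hΦ _ _ hz)]
  have := Measure.integral_comp_smul (volume : Measure E) (fun z => Φ (l⁻¹ • z) z) l
  simp only [inv_smul_smul₀ hl0] at this
  rw [this, abs_of_nonneg (by positivity), smul_eq_mul]

/-- The support contracts to `l⁻¹ • tsupport ψ`, which star-shapedness keeps inside `Q`. This makes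
dilated functions admissible in the weak equation without any regularity of the boundary. -/
lemma IsC1Test.comp_smul (hψ : IsC1Test Q ψ) (h : DilationControl Q B J η) {l : ℝ}
    (hl : 1 ≤ l) : IsC1Test Q (fun z => ψ (l • z)) := by
  have hl0 : l ≠ 0 := by linarith
  have hts : tsupport (fun z => ψ (l • z)) = (fun z => l • z) ⁻¹' tsupport ψ :=
    tsupport_comp_eq_preimage ψ (Homeomorph.smulOfNeZero l hl0)
  refine ⟨hψ.contDiff.comp (contDiff_const_smul l), ?_, ?_⟩
  · exact hψ.compact.comp_homeomorph (Homeomorph.smulOfNeZero l hl0)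
  · rw [hts]
    intro z hz
    by_contra hz'
    exact h.smul_notMem hz' hl (hψ.support hz)

lemma gradient_comp_smul (l : ℝ) (z : E) (hψ : Differentiable ℝ ψ) :
    gradient (fun z => ψ (l • z)) z = l • gradient ψ (l • z) := by
  have : HasFDerivAt (fun z => ψ (l • z))
      ((fderiv ℝ ψ (l • z)).comp (l • ContinuousLinearMap.id ℝ E)) z :=
    (hψ (l • z)).hasFDerivAt.comp z ((hasFDerivAt_id z).const_smul l)
  rw [gradient, gradient, this.fderiv]
  rw [← map_smul]
  congr 1
  ext v
  simp

lemma IsC1Test.exists_gradient_le (hψ : IsC1Test Q ψ) : ∃ C : ℝ, ∀ z, ‖gradient ψ z‖ ≤ C :=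
  hψ.continuous_gradient.bounded_above_of_compact_support hψ.hasCompactSupport_gradient

lemma IsC1Test.continuousOn_coeff_gradient (hψ : IsC1Test Q ψ) (h : DilationControl Q B J η) :
    ContinuousOn (fun z => B z (gradient ψ z)) Q :=
  h.continuousOn_coeff.clm_apply hψ.continuous_gradient.continuousOn

lemma IsC1Test.exists_coeff_gradient_le (hψ : IsC1Test Q ψ) (h : DilationControl Q B J η) :
    ∃ C : ℝ, 0 ≤ C ∧ ∀ z ∈ Q, ‖B z (gradient ψ z)‖ ≤ C := by
  obtain ⟨C, hC⟩ := h.coeff_upper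
  obtain ⟨K, hK⟩ := hψ.exists_gradient_le
  refine ⟨|C| * |K|, by positivity, fun z hz => ?_⟩
  refine ((B z).le_opNorm _).trans ?_
  gcongr
  · exact (hC z hz).trans (le_abs_self _)
  · exact (hK z).trans (le_abs_self _)

lemma IsC1Test.memLp_coeff_gradient (hψ : IsC1Test Q ψ) (h : DilationControl Q B J η)
    (p : ENNReal) : MemLp (fun z => B z (gradient ψ z)) p (densityMeasure Q J) := by
  have := h.isFiniteMeasure
  obtain ⟨C, -, hC⟩ := hψ.exists_coeff_gradient_le h
  refine MemLp.of_bound (h.aestronglyMeasurable (hψ.continuousOn_coeff_gradient h)) C ?_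
  filter_upwards [h.ae_mem] with z hz using hC z hz

/-- The energy of a dilated test function. -/
lemma IsC1Test.energy_comp_smul_le (hψ : IsC1Test Q ψ) (h : DilationControl Q B J η) {l : ℝ}
    (hl : l ∈ Ioc (1 : ℝ) 2) :
    ∫ z, ‖B z (gradient (fun z => ψ (l • z)) z)‖ ^ 2 ∂(densityMeasure Q J) ≤
      (l ^ Module.finrank ℝ E)⁻¹ * (l ^ 2 * (1 + η * (l - 1))) *
        ∫ z, ‖B z (gradient ψ z)‖ ^ 2 ∂(densityMeasure Q J) := by
  have hl1 : 1 ≤ l := hl.1.le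
  rw [h.integral_densityMeasure, h.integral_densityMeasure]
  simp only [gradient_comp_smul l _ hψ.differentiable]
  -- Three sources for the factor: the Jacobian gives `l⁻ⁿ`, the chain rule gives `l ^ 2`, and the
  -- variation of the coefficients gives `1 + η (l - 1)`.
  rw [h.setIntegral_comp_smul (fun z z' => J z * ‖B z (l • gradient ψ z')‖ ^ 2)
    (fun z z' hz' => by simp [hψ.gradient_eq_zero hz']) hl1, mul_assoc]
  refine mul_le_mul_of_nonneg_left ?_ (by positivity)
  rw [← integral_const_mul]
  obtain ⟨K, hK0, hK⟩ := hψ.exists_coeff_gradient_le h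
  obtain ⟨C, hC⟩ := h.density_upper
  apply integral_mono_of_nonneg
  · exact (ae_restrict_iff' h.measurableSet).2 (Eventually.of_forall fun z hz =>
      mul_nonneg (h.density_pos (h.star z hz l hl1)).le (by positivity))
  · apply Integrable.const_mul
    refine h.integrableOn (C := C * K ^ 2) (h.continuousOn_density.mul
      ((hψ.continuousOn_coeff_gradient h).norm.pow 2)) fun z hz => ?_
    rw [abs_of_nonneg (mul_nonneg (h.density_pos hz).le (by positivity))]
    exact mul_le_mul (hC z hz) (pow_le_pow_left₀ (norm_nonneg _) (hK z hz) 2) (by positivity)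
      ((h.density_pos hz).le.trans (hC z hz))
  · refine (ae_restrict_iff' h.measurableSet).2 (Eventually.of_forall fun z hz => ?_)
    have := h.energy z hz l hl (gradient ψ z)
    simp only [map_smul, norm_smul, Real.norm_eq_abs, mul_pow, sq_abs]
    nlinarith [sq_nonneg l]

lemma IsC1Test.hasDerivAt_comp_smul (hψ : IsC1Test Q ψ) (z : E) (s : ℝ) :
    HasDerivAt (fun s : ℝ => ψ (s • z)) (fderiv ℝ ψ (s • z) z) s := by
  have h2 : HasDerivAt (fun s : ℝ => s • z) z s := by
    simpa using (hasDerivAt_id s).smul_const z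
  exact (hψ.differentiable (s • z)).hasFDerivAt.comp_hasDerivAt s h2

/-- The `L¹` bound for difference quotients along dilations. -/
lemma IsC1Test.integral_abs_comp_smul_sub_le (hψ : IsC1Test Q ψ) (h : DilationControl Q B J η)
    {R : ℝ} (hR : ∀ z ∈ Q, ‖z‖ ≤ R) {l : ℝ} (hl : 1 ≤ l) :
    ∫ z in Q, |ψ (l • z) - ψ z| ≤ (l - 1) * (R * ∫ z in Q, ‖gradient ψ z‖) := by
  have := h.isFiniteMeasure_restrict
  have hcg := hψ.continuous_gradient
  have hcont : Continuous (fun q : E × ℝ => ‖gradient ψ (q.2 • q.1)‖) := by fun_prop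
  obtain ⟨K, hK⟩ := hψ.exists_gradient_le
  have hint : Integrable (fun q : E × ℝ => ‖gradient ψ (q.2 • q.1)‖)
      ((volume.restrict Q).prod (volume.restrict (Ioc 1 l))) :=
    Integrable.of_bound hcont.aestronglyMeasurable K
      (Eventually.of_forall fun q => by simpa using hK _)
  by_cases hne : Q.Nonempty
  swap
  · simp [not_nonempty_iff_eq_empty.1 hne]
  have hR0 : 0 ≤ R := by
    obtain ⟨z, hz⟩ := hne
    exact (norm_nonneg z).trans (hR z hz)
  -- Integration along the ray from `z` to `l • z`, whose velocity `z` has norm at most `R`.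
  have step1 : ∀ z ∈ Q, |ψ (l • z) - ψ z| ≤ R * ∫ s in Ioc 1 l, ‖gradient ψ (s • z)‖ := by
    intro z hz
    have hcd : Continuous fun s : ℝ => fderiv ℝ ψ (s • z) z := by
      have := hψ.contDiff.continuous_fderiv (by norm_num)
      fun_prop
    have e1 : ψ (l • z) - ψ z = ∫ s in (1 : ℝ)..l, fderiv ℝ ψ (s • z) z := by
      rw [intervalIntegral.integral_eq_sub_of_hasDerivAt
        (fun s _ => hψ.hasDerivAt_comp_smul z s) (hcd.intervalIntegrable _ _)]
      simp
    rw [e1, ← intervalIntegral.integral_of_le hl, ← intervalIntegral.integral_const_mul,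
      ← Real.norm_eq_abs]
    have hcr : Continuous fun s : ℝ => R * ‖gradient ψ (s • z)‖ := by fun_prop
    refine intervalIntegral.norm_integral_le_of_norm_le hl (Eventually.of_forall fun s _ => ?_)
      (hcr.intervalIntegrable _ _)
    rw [norm_gradient, mul_comm]
    exact ((fderiv ℝ ψ (s • z)).le_opNorm z).trans (by gcongr; exact hR z hz)
  calc ∫ z in Q, |ψ (l • z) - ψ z|
      ≤ ∫ z in Q, R * ∫ s in Ioc 1 l, ‖gradient ψ (s • z)‖ := by
        apply integral_mono_of_nonneg (Eventually.of_forall fun z => abs_nonneg _)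
        · exact hint.integral_prod_left.const_mul R
        · exact (ae_restrict_iff' h.measurableSet).2 (Eventually.of_forall step1)
    _ = R * ∫ s in Ioc 1 l, ∫ z in Q, ‖gradient ψ (s • z)‖ := by
        rw [integral_const_mul, integral_integral_swap hint]
    _ ≤ R * ∫ s in Ioc 1 l, ∫ z in Q, ‖gradient ψ z‖ := by
        refine mul_le_mul_of_nonneg_left ?_ hR0
        refine setIntegral_mono_on hint.integral_prod_right (by simp) measurableSet_Ioc
          fun s hs => ?_
        -- After Fubini, the slice at `s` is `s⁻ⁿ ∫ ‖∇ψ‖`, and `s ≥ 1`. Thus the estimate needs only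
        -- the integral of the gradient, not its supremum.
        rw [h.setIntegral_comp_smul (fun _ z' => ‖gradient ψ z'‖)
          (fun _ z' hz' => by simp [hψ.gradient_eq_zero hz']) hs.1.le]
        apply mul_le_of_le_one_left (by positivity)
        exact inv_le_one_of_one_le₀ (one_le_pow₀ hs.1.le)
    _ = (l - 1) * (R * ∫ z in Q, ‖gradient ψ z‖) := by
        simp [hl]; ring

/-- Difference quotients along dilations converge to the radial derivative. -/
lemma IsC1Test.tendsto_integral_dilation (hψ : IsC1Test Q ψ) (h : DilationControl Q B J η)
    {g : E → ℝ} (hg : IntegrableOn g Q) :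
    Tendsto (fun j => (factor j - 1)⁻¹ * ∫ z in Q, g z * (ψ (factor j • z) - ψ z)) atTop
      (𝓝 (∫ z in Q, g z * fderiv ℝ ψ z z)) := by
  obtain ⟨R, hR0, hR⟩ := h.exists_norm_le
  obtain ⟨K, hK⟩ := hψ.contDiff.lipschitzWith_of_hasCompactSupport hψ.compact (by norm_num)
  simp_rw [← integral_const_mul]
  apply tendsto_integral_of_dominated_convergence (fun z => |g z| * (K * R))
  · intro j
    have : Continuous fun z => ψ (factor j • z) - ψ z := by
      have := hψ.contDiff.continuous
      fun_prop
    exact (hg.1.mul this.aestronglyMeasurable).const_mul _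
  · exact hg.abs.mul_const _
  · intro j
    refine (ae_restrict_iff' h.measurableSet).2 (Eventually.of_forall fun z hz => ?_)
    have hj := (factor_mem j).1
    have h1 : |ψ (factor j • z) - ψ z| ≤ K * ((factor j - 1) * R) := by
      have := hK.dist_le_mul (factor j • z) z
      rw [Real.dist_eq, dist_eq_norm] at this
      refine this.trans ?_
      gcongr
      have e : factor j • z - z = (factor j - 1) • z := by rw [sub_smul, one_smul]
      rw [e, norm_smul, Real.norm_eq_abs, abs_of_pos (by linarith)]
      have := hR z hz
      have : 0 ≤ factor j - 1 := by linarith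
      gcongr
    rw [norm_mul, norm_mul, Real.norm_eq_abs, Real.norm_eq_abs, Real.norm_eq_abs,
      abs_of_pos (inv_pos.2 (by linarith : 0 < factor j - 1))]
    calc (factor j - 1)⁻¹ * (|g z| * |ψ (factor j • z) - ψ z|)
        ≤ (factor j - 1)⁻¹ * (|g z| * (K * ((factor j - 1) * R))) := by
          have : 0 ≤ (factor j - 1)⁻¹ := inv_nonneg.2 (by linarith)
          gcongr
      _ = |g z| * (K * R) := by
          have : factor j - 1 ≠ 0 := by linarith
          field_simp
  · refine Eventually.of_forall fun z => ?_
    have := (hψ.hasDerivAt_comp_smul z 1).tendsto_factor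
    simp only [one_smul, smul_eq_mul] at this
    refine (this.const_mul (g z)).congr fun j => by ring

/-- The radial derivative of a nonnegative test function, integrated against the density. -/
lemma IsC1Test.integral_radial_ge (hψ : IsC1Test Q ψ) (h : DilationControl Q B J η)
    (h0 : ∀ z, 0 ≤ ψ z) :
    -((Module.finrank ℝ E : ℝ) + η) * ∫ z, ψ z ∂(densityMeasure Q J) ≤
      ∫ z, fderiv ℝ ψ z z ∂(densityMeasure Q J) := by
  set n := Module.finrank ℝ E with hn
  rw [h.integral_densityMeasure, h.integral_densityMeasure]
  obtain ⟨C, hC⟩ := h.density_upper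
  have hJint : IntegrableOn J Q := h.integrableOn h.continuousOn_density (C := C) fun z hz => by
    rw [abs_of_pos (h.density_pos hz)]; exact hC z hz
  have hmul : ∀ {φ : E → ℝ}, IsC1Test Q φ → IntegrableOn (fun z => J z * φ z) Q := by
    intro φ hφ
    obtain ⟨K, hK⟩ := hφ.contDiff.continuous.bounded_above_of_compact_support hφ.compact
    exact hJint.mul_bdd hφ.contDiff.continuous.aestronglyMeasurable (Eventually.of_forall hK)
  have hlim := hψ.tendsto_integral_dilation h hJint
  -- For `ψ ≥ 0` the dilated mass is at least this function of `l` times the original mass, with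
  -- equality at `l = 1`. Comparing difference quotients at `1` turns its derivative `-(n + η)` into
  -- the lower bound.
  have hθ : HasDerivAt (fun l : ℝ => (l ^ n)⁻¹ * (1 - η * (l - 1))) (-((n : ℝ) + η)) 1 := by
    have h1 : HasDerivAt (fun l : ℝ => (l ^ n)⁻¹) (-(n : ℝ)) 1 := by
      have := (hasDerivAt_pow n (1 : ℝ)).fun_inv (by simp)
      simpa using this
    have h2 : HasDerivAt (fun l : ℝ => 1 - η * (l - 1)) (-η) 1 := by
      simpa using (((hasDerivAt_id (1 : ℝ)).sub_const 1).const_mul η).const_sub 1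
    have e : -((n : ℝ) + η) = -(n : ℝ) * (1 - η * (1 - 1)) + ((1 : ℝ) ^ n)⁻¹ * -η := by
      simp; ring
    rw [e]
    exact h1.mul h2
  have hlim2 := hθ.tendsto_factor.mul_const (∫ z in Q, J z * ψ z)
  refine le_of_tendsto_of_tendsto hlim2 hlim (Eventually.of_forall fun j => ?_)
  obtain ⟨hj1, hj2⟩ := factor_mem j
  have hpos : 0 ≤ (factor j - 1)⁻¹ := inv_nonneg.2 (by linarith)
  simp only [smul_eq_mul, mul_assoc]
  refine mul_le_mul_of_nonneg_left ?_ hpos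
  have e : ∫ z in Q, J z * (ψ (factor j • z) - ψ z) =
      (∫ z in Q, J z * ψ (factor j • z)) - ∫ z in Q, J z * ψ z := by
    rw [← integral_sub (hmul (hψ.comp_smul h hj1.le)) (hmul hψ)]
    congr 1
    ext z
    ring
  rw [e, h.setIntegral_comp_smul (fun z z' => J z * ψ z')
    (fun z z' hz' => by simp [hψ.eq_zero hz']) hj1.le]
  have key : (1 - η * (factor j - 1)) * ∫ z in Q, J z * ψ z ≤
      ∫ z in Q, J ((factor j)⁻¹ • z) * ψ z := by
    rw [← integral_const_mul]
    refine setIntegral_mono_on ((hmul hψ).const_mul _) ?_ h.measurableSet fun z hz => ?_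
    · refine h.integrableOn (C := C * |hψ.contDiff.continuous.bounded_above_of_compact_support
        hψ.compact |>.choose|) ?_ fun z hz => ?_
      · refine ContinuousOn.mul ?_ hψ.contDiff.continuous.continuousOn
        exact h.continuousOn_density.comp (continuous_const_smul _).continuousOn
          fun z hz => h.star z hz _ hj1.le
      · have hs := h.star z hz _ hj1.le
        rw [abs_mul, abs_of_pos (h.density_pos hs)]
        refine mul_le_mul (hC _ hs) ?_ (abs_nonneg _) ((h.density_pos hs).le.trans (hC _ hs))
        exact ((hψ.contDiff.continuous.bounded_above_of_compact_support
          hψ.compact).choose_spec z).trans (le_abs_self _)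
    · rw [← mul_assoc]
      exact mul_le_mul_of_nonneg_right (h.mass z hz _ ⟨hj1, hj2⟩) (h0 z)
  have hp : 0 ≤ (factor j ^ n)⁻¹ := by
    have : 0 < factor j := by linarith
    positivity
  have := mul_le_mul_of_nonneg_left key hp
  simp only [one_pow, inv_one, sub_self, mul_zero, sub_zero, mul_one]
  linarith

end Dilation

/-! ### Truncation of the nonlinearity. -/

section Truncation

/-- Clamping the argument to `[-M, M]` leaves `f` unchanged at all values of a solution bounded by
`M`. The approximating test functions need not obey that bound, so a globally bounded `g` with
globally Lipschitz primitive `F` is wanted. The sign of `f` survives clamping, which keeps `F ≥ 0`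
on the whole line. -/
lemma exists_bounded_truncation {f : ℝ → ℝ} (hf : Continuous f) (hs : ∀ t, 0 ≤ t * f t)
    {M : ℝ} (hM : 0 ≤ M) :
    ∃ g F : ℝ → ℝ, Continuous g ∧ (∃ C : ℝ, 0 ≤ C ∧ ∀ t, |g t| ≤ C) ∧
      (∀ t, |t| ≤ M → g t = f t) ∧ (∀ t, HasDerivAt F (g t) t) ∧ F 0 = 0 ∧ (∀ t, 0 ≤ F t) ∧
      ∀ t, |t| ≤ M → F t = ∫ τ in (0 : ℝ)..t, f τ := by
  set g : ℝ → ℝ := fun t => f (max (-M) (min M t)) with hg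
  have hgc : Continuous g := by fun_prop
  have hgf : ∀ t, |t| ≤ M → g t = f t := by
    intro t ht
    obtain ⟨h1, h2⟩ := abs_le.1 ht
    simp only [hg, min_eq_right h2, max_eq_right h1]
  have hf0 : ∀ t, 0 < t → 0 ≤ f t := fun t ht => by
    have := hs t; exact nonneg_of_mul_nonneg_right this ht
  have hf1 : ∀ t, t < 0 → f t ≤ 0 := fun t ht => by
    have := hs t; nlinarith
  have hf00 : f 0 = 0 := by
    apply le_antisymm
    · have hl : Tendsto f (𝓝[<] 0) (𝓝 (f 0)) := hf.continuousAt.tendsto.mono_left inf_le_left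
      exact le_of_tendsto hl (eventually_nhdsWithin_of_forall fun t ht => hf1 t ht)
    · have hl : Tendsto f (𝓝[>] 0) (𝓝 (f 0)) := hf.continuousAt.tendsto.mono_left inf_le_left
      exact ge_of_tendsto hl (eventually_nhdsWithin_of_forall fun t ht => hf0 t ht)
  have hg0 : ∀ t, 0 ≤ t → 0 ≤ g t := by
    intro t ht
    have h : 0 ≤ max (-M) (min M t) := le_max_of_le_right (le_min hM ht)
    rcases h.eq_or_lt with h | h
    · simp only [hg, ← h, hf00, le_refl]
    · exact hf0 _ h
  have hg1 : ∀ t, t ≤ 0 → g t ≤ 0 := by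
    intro t ht
    have h : max (-M) (min M t) ≤ 0 := max_le (by linarith) ((min_le_right _ _).trans ht)
    rcases h.eq_or_lt with h | h
    · simp only [hg, h, hf00, le_refl]
    · exact hf1 _ h
  refine ⟨g, fun t => ∫ τ in (0 : ℝ)..t, g τ, hgc, ?_, hgf, ?_, by simp, ?_, ?_⟩
  · obtain ⟨C, hC⟩ := (isCompact_Icc (a := -M) (b := M)).exists_bound_of_continuousOn
      hf.continuousOn
    have hm : ∀ t, max (-M) (min M t) ∈ Icc (-M) M := fun t =>
      ⟨le_max_left _ _, max_le (by linarith) (min_le_left _ _)⟩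
    exact ⟨C, (norm_nonneg _).trans (hC _ (hm 0)), fun t => hC _ (hm t)⟩
  · intro t
    exact intervalIntegral.integral_hasDerivAt_right (hgc.intervalIntegrable _ _)
      (hgc.stronglyMeasurableAtFilter _ _) hgc.continuousAt
  · intro t
    rcases le_total 0 t with h | h
    · exact intervalIntegral.integral_nonneg h fun s hs => hg0 s hs.1
    · change 0 ≤ ∫ τ in (0 : ℝ)..t, g τ
      rw [intervalIntegral.integral_symm, ← intervalIntegral.integral_neg]
      exact intervalIntegral.integral_nonneg h fun s hs => by linarith [hg1 s hs.2]
  · intro t ht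
    apply intervalIntegral.integral_congr
    intro s hs
    apply hgf
    obtain ⟨h1, h2⟩ := abs_le.1 ht
    rw [uIcc, mem_Icc] at hs
    rw [abs_le]
    constructor
    · exact (le_min (by linarith) h1).trans hs.1
    · exact hs.2.trans (max_le hM h2)

end Truncation

/-! ### Cauchy–Schwarz inequalities for integrals. -/

section CauchySchwarz

variable {α : Type*} [MeasurableSpace α] {μ : Measure α}

lemma abs_integral_mul_le_eLpNorm {a b : α → ℝ} (ha : MemLp a 2 μ) (hb : MemLp b 2 μ) :
    |∫ x, a x * b x ∂μ| ≤ (eLpNorm a 2 μ).toReal * (eLpNorm b 2 μ).toReal := by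
  have := abs_real_inner_le_norm (ha.toLp a) (hb.toLp b)
  rw [integral_inner_toLp, Lp.norm_toLp, Lp.norm_toLp] at this
  simpa [mul_comm] using this

lemma integral_norm_le_eLpNorm [IsFiniteMeasure μ] {F : Type*} [NormedAddCommGroup F] {a : α → F}
    (ha : MemLp a 2 μ) :
    ∫ x, ‖a x‖ ∂μ ≤ (eLpNorm a 2 μ).toReal * (eLpNorm (fun _ : α => (1 : ℝ)) 2 μ).toReal := by
  have := abs_integral_mul_le_eLpNorm ha.norm (memLp_const (1 : ℝ) (μ := μ))
  simp only [mul_one, eLpNorm_norm] at this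
  exact (le_abs_self _).trans this

lemma integrable_inner_of_memLp_two {F : Type*} [NormedAddCommGroup F] [InnerProductSpace ℝ F]
    {a b : α → F} (ha : MemLp a 2 μ) (hb : MemLp b 2 μ) :
    Integrable (fun x => inner ℝ (a x) (b x)) μ := by
  refine (L2.integrable_inner (𝕜 := ℝ) (ha.toLp a) (hb.toLp b)).congr ?_
  filter_upwards [ha.coeFn_toLp, hb.coeFn_toLp] with x h1 h2
  rw [h1, h2]

end CauchySchwarz

/-! ### Estimates for increments along dilations. -/

section Pohozaev

variable {E : Type*} [NormedAddCommGroup E] [InnerProductSpace ℝ E] [FiniteDimensional ℝ E]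
  [MeasurableSpace E] [BorelSpace E]
  {Q : Set E} {B : E → E →L[ℝ] E} {J : E → ℝ} {η : ℝ} {ψ : E → ℝ}

/-- Difference quotients along dilations are bounded by the energy norm. -/
lemma DilationControl.exists_quotient_bound (h : DilationControl Q B J η) {g : E → ℝ} {Cg : ℝ}
    (hCg : 0 ≤ Cg) (hb : ∀ᵐ z ∂(densityMeasure Q J), |g z| ≤ Cg) :
    ∃ K : ℝ, 0 ≤ K ∧ ∀ ψ : E → ℝ, IsC1Test Q ψ → ∀ l : ℝ, 1 ≤ l →
      |∫ z, g z * (ψ (l • z) - ψ z) ∂(densityMeasure Q J)| ≤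
        (l - 1) * (K * (eLpNorm (fun z => B z (gradient ψ z)) 2 (densityMeasure Q J)).toReal) := by
  have hfin := h.isFiniteMeasure
  have hfin' := h.isFiniteMeasure_restrict
  obtain ⟨R, hR0, hR⟩ := h.exists_norm_le
  obtain ⟨CJ, hCJ⟩ := h.density_upper
  obtain ⟨cJ, hcJ0, hcJ⟩ := h.density_lower
  obtain ⟨cB, hcB0, hcB⟩ := h.coeff_lower
  set N := (eLpNorm (fun _ : E => (1 : ℝ)) 2 (densityMeasure Q J)).toReal
  -- `Cg` and `CJ` bound `g` and the density, `R` comes from the ray estimate, `cJ * cB` is the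
  -- coercivity passing from `∇ψ` to `J ‖B ∇ψ‖`, and `N` is the Cauchy–Schwarz factor of a finite
  -- measure. The constant depends neither on `ψ` nor on `l`, which lets the two limits be taken one
  -- after the other.
  refine ⟨Cg * |CJ| * (R * ((cJ * cB)⁻¹ * N)), by positivity, fun ψ hψ l hl => ?_⟩
  set e := (eLpNorm (fun z => B z (gradient ψ z)) 2 (densityMeasure Q J)).toReal
  have hψc := hψ.contDiff.continuous
  have hdc : Continuous fun z => ψ (l • z) - ψ z := by fun_prop
  have hdi : IntegrableOn (fun z => |ψ (l • z) - ψ z|) Q :=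
    ((((hψ.comp_smul h hl).sub hψ).memLp 1 (volume.restrict Q)).integrable le_rfl).abs
  have s1 : |∫ z, g z * (ψ (l • z) - ψ z) ∂(densityMeasure Q J)| ≤
      ∫ z, Cg * |ψ (l • z) - ψ z| ∂(densityMeasure Q J) := by
    rw [← Real.norm_eq_abs]
    refine norm_integral_le_of_norm_le ((h.integrable hdi).const_mul _) ?_
    filter_upwards [hb] with z hz
    rw [norm_mul]
    exact mul_le_mul_of_nonneg_right hz (norm_nonneg _)
  have s2 : ∫ z, |ψ (l • z) - ψ z| ∂(densityMeasure Q J) ≤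
      |CJ| * ∫ z in Q, |ψ (l • z) - ψ z| := by
    rw [h.integral_densityMeasure, ← integral_const_mul]
    apply integral_mono_of_nonneg
    · exact (ae_restrict_iff' h.measurableSet).2 (Eventually.of_forall fun z hz =>
        mul_nonneg (h.density_pos hz).le (abs_nonneg _))
    · exact hdi.const_mul _
    · exact (ae_restrict_iff' h.measurableSet).2 (Eventually.of_forall fun z hz =>
        mul_le_mul_of_nonneg_right ((hCJ z hz).trans (le_abs_self _)) (abs_nonneg _))
  have s3 := hψ.integral_abs_comp_smul_sub_le h hR hl
  have s4 : ∫ z in Q, ‖gradient ψ z‖ ≤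
      (cJ * cB)⁻¹ * ∫ z, ‖B z (gradient ψ z)‖ ∂(densityMeasure Q J) := by
    rw [h.integral_densityMeasure, ← integral_const_mul]
    obtain ⟨K, hK0, hK⟩ := hψ.exists_coeff_gradient_le h
    apply integral_mono_of_nonneg (Eventually.of_forall fun z => norm_nonneg _)
    · refine (h.integrableOn (C := |CJ| * K) (h.continuousOn_density.mul
        (hψ.continuousOn_coeff_gradient h).norm) fun z hz => ?_).const_mul _
      rw [Pi.mul_apply, abs_mul, abs_norm, abs_of_pos (h.density_pos hz)]
      exact mul_le_mul ((hCJ z hz).trans (le_abs_self _)) (hK z hz) (norm_nonneg _) (abs_nonneg _)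
    · refine (ae_restrict_iff' h.measurableSet).2 (Eventually.of_forall fun z hz => ?_)
      change ‖gradient ψ z‖ ≤ (cJ * cB)⁻¹ * (J z * ‖B z (gradient ψ z)‖)
      rw [inv_mul_eq_div, le_div_iff₀ (by positivity)]
      calc ‖gradient ψ z‖ * (cJ * cB) = cJ * (cB * ‖gradient ψ z‖) := by ring
        _ ≤ J z * ‖B z (gradient ψ z)‖ :=
          mul_le_mul (hcJ z hz) (hcB z hz _) (by positivity) (h.density_pos hz).le
  have s5 := integral_norm_le_eLpNorm (hψ.memLp_coeff_gradient h 2)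
  have hl0 : 0 ≤ l - 1 := by linarith
  calc |∫ z, g z * (ψ (l • z) - ψ z) ∂(densityMeasure Q J)|
      ≤ Cg * (|CJ| * ((l - 1) * (R * ((cJ * cB)⁻¹ * (e * N))))) := by
        refine s1.trans ?_
        rw [integral_const_mul]
        refine mul_le_mul_of_nonneg_left (s2.trans ?_) hCg
        refine mul_le_mul_of_nonneg_left (s3.trans ?_) (abs_nonneg _)
        refine mul_le_mul_of_nonneg_left ?_ hl0
        refine mul_le_mul_of_nonneg_left (s4.trans ?_) hR0.le
        exact mul_le_mul_of_nonneg_left s5 (by positivity)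
    _ = (l - 1) * (Cg * |CJ| * (R * ((cJ * cB)⁻¹ * N)) * e) := by ring

/-- Testing a weak equation with the increment of a test function under a dilation. -/
lemma DilationControl.integral_dilation_le (h : DilationControl Q B J η) {g : E → ℝ} {H : E → E}
    (hg : MemLp g 2 (densityMeasure Q J)) (hH : MemLp H 2 (densityMeasure Q J))
    (hweak : ∀ ψ : E → ℝ, IsC1Test Q ψ →
      ∫ z, inner ℝ (H z) (B z (gradient ψ z)) ∂(densityMeasure Q J) =
        ∫ z, g z * ψ z ∂(densityMeasure Q J))
    (hψ : IsC1Test Q ψ) {l : ℝ} (hl : l ∈ Ioc (1 : ℝ) 2) :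
    ∫ z, g z * (ψ (l • z) - ψ z) ∂(densityMeasure Q J) ≤
      1 / 2 * (∫ z, ‖H z‖ ^ 2 ∂(densityMeasure Q J)) +
      1 / 2 * ((l ^ Module.finrank ℝ E)⁻¹ * (l ^ 2 * (1 + η * (l - 1))) *
        ∫ z, ‖B z (gradient ψ z)‖ ^ 2 ∂(densityMeasure Q J)) -
      ∫ z, inner ℝ (H z) (B z (gradient ψ z)) ∂(densityMeasure Q J) := by
  have hfin := h.isFiniteMeasure
  have hψl := hψ.comp_smul h hl.1.le
  have e1 : ∫ z, g z * (ψ (l • z) - ψ z) ∂(densityMeasure Q J) =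
      (∫ z, g z * ψ (l • z) ∂(densityMeasure Q J)) - ∫ z, g z * ψ z ∂(densityMeasure Q J) := by
    have h1 : Integrable (fun z => g z * ψ (l • z)) (densityMeasure Q J) :=
      hg.integrable_mul (hψl.memLp 2 _)
    have h2 : Integrable (fun z => g z * ψ z) (densityMeasure Q J) :=
      hg.integrable_mul (hψ.memLp 2 _)
    rw [← integral_sub h1 h2]
    simp only [mul_sub]
  rw [e1, ← hweak _ hψl, ← hweak _ hψ]
  -- Young's inequality replaces the pairing of `H` with the dilated gradient by energies. Nothing
  -- is lost to first order as `l → 1`, since it is an equality when the two fields agree.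
  have e2 : ∫ z, inner ℝ (H z) (B z (gradient (fun z => ψ (l • z)) z)) ∂(densityMeasure Q J) ≤
      ∫ z, (1 / 2 * ‖H z‖ ^ 2 + 1 / 2 * ‖B z (gradient (fun z => ψ (l • z)) z)‖ ^ 2)
        ∂(densityMeasure Q J) := by
    have hDl := hψl.memLp_coeff_gradient h 2
    apply integral_mono
    · exact integrable_inner_of_memLp_two hH hDl
    · exact (hH.integrable_norm_pow (by norm_num)).const_mul _ |>.add
        ((hDl.integrable_norm_pow (by norm_num)).const_mul _)
    · intro z
      have h1 := real_inner_le_norm (H z) (B z (gradient (fun z => ψ (l • z)) z))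
      have h2 := two_mul_le_add_sq ‖H z‖ ‖B z (gradient (fun z => ψ (l • z)) z)‖
      dsimp only
      linarith
  rw [integral_add ((hH.integrable_norm_pow (by norm_num)).const_mul _)
    (((hψl.memLp_coeff_gradient h 2).integrable_norm_pow (by norm_num)).const_mul _),
    integral_const_mul, integral_const_mul] at e2
  have e3 := hψ.energy_comp_smul_le h hl
  linarith

lemma DilationControl.memLp_radial (h : DilationControl Q B J η) (hψ : IsC1Test Q ψ) :
    MemLp (fun z => fderiv ℝ ψ z z) 2 (densityMeasure Q J) := by
  have := h.isFiniteMeasure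
  apply Continuous.memLp_of_hasCompactSupport
  · have := hψ.contDiff.continuous_fderiv (by norm_num)
    fun_prop
  · exact (hψ.compact.fderiv ℝ).mono fun z hz h0 => hz (by simp [h0])

/-- On `Q` one has `|∇ψ · z| ≤ R ‖∇ψ‖` and `cB ‖∇ψ‖ ≤ ‖B ∇ψ‖`. -/
lemma DilationControl.exists_radial_bound (h : DilationControl Q B J η) :
    ∃ K : ℝ, 0 ≤ K ∧ ∀ ψ : E → ℝ, IsC1Test Q ψ →
      (eLpNorm (fun z => fderiv ℝ ψ z z) 2 (densityMeasure Q J)).toReal ≤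
        K * (eLpNorm (fun z => B z (gradient ψ z)) 2 (densityMeasure Q J)).toReal := by
  obtain ⟨R, hR0, hR⟩ := h.exists_norm_le
  obtain ⟨cB, hcB0, hcB⟩ := h.coeff_lower
  refine ⟨R / cB, by positivity, fun ψ hψ => ?_⟩
  have key : eLpNorm (fun z => fderiv ℝ ψ z z) 2 (densityMeasure Q J) ≤
      ENNReal.ofReal (R / cB) *
        eLpNorm (fun z => B z (gradient ψ z)) 2 (densityMeasure Q J) := by
    apply eLpNorm_le_mul_eLpNorm_of_ae_le_mul
    filter_upwards [h.ae_mem] with z hz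
    calc ‖fderiv ℝ ψ z z‖ ≤ ‖fderiv ℝ ψ z‖ * ‖z‖ := (fderiv ℝ ψ z).le_opNorm z
      _ ≤ ‖gradient ψ z‖ * R := by rw [norm_gradient]; gcongr; exact hR z hz
      _ ≤ (‖B z (gradient ψ z)‖ / cB) * R := by
        gcongr
        rw [le_div_iff₀ hcB0, mul_comm]
        exact hcB z hz _
      _ = R / cB * ‖B z (gradient ψ z)‖ := by ring
  have := ENNReal.toReal_mono (ENNReal.mul_ne_top ENNReal.ofReal_ne_top
    (hψ.memLp_coeff_gradient h 2).2.ne) key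
  rwa [ENNReal.toReal_mul, ENNReal.toReal_ofReal (by positivity)] at this

end Pohozaev

/-! ### The weak Pohozaev inequality and vanishing of the energy. -/

section Pohozaev

variable {E : Type*} [NormedAddCommGroup E] [InnerProductSpace ℝ E] [FiniteDimensional ℝ E]
  [MeasurableSpace E] [BorelSpace E]
  {Q : Set E} {B : E → E →L[ℝ] E} {J : E → ℝ} {η : ℝ}

/-- The weak Pohozaev inequality, for the limit of a sequence of test functions. -/
lemma DilationControl.radial_le (h : DilationControl Q B J η) {g : E → ℝ} {H : E → E}
    {Cg : ℝ} (hCg : 0 ≤ Cg) (hgm : AEStronglyMeasurable g (densityMeasure Q J))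
    (hb : ∀ᵐ z ∂(densityMeasure Q J), |g z| ≤ Cg) (hH : MemLp H 2 (densityMeasure Q J))
    (hweak : ∀ ψ : E → ℝ, IsC1Test Q ψ →
      ∫ z, inner ℝ (H z) (B z (gradient ψ z)) ∂(densityMeasure Q J) =
        ∫ z, g z * ψ z ∂(densityMeasure Q J))
    {ω : ℕ → E → ℝ} (hω : ∀ k, IsC1Test Q (ω k))
    (hlim : Tendsto (fun k => eLpNorm (fun z => B z (gradient (ω k) z) - H z) 2
      (densityMeasure Q J)) atTop (𝓝 0)) :
    ∃ K : ℝ, ∀ m, ∫ z, g z * fderiv ℝ (ω m) z z ∂(densityMeasure Q J) ≤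
      1 / 2 * (2 - (Module.finrank ℝ E : ℝ) + η) * (∫ z, ‖H z‖ ^ 2 ∂(densityMeasure Q J)) +
        K * (eLpNorm (fun z => B z (gradient (ω m) z) - H z) 2 (densityMeasure Q J)).toReal := by
  set μ := densityMeasure Q J with hμ
  set n := Module.finrank ℝ E with hn
  have hfin : IsFiniteMeasure μ := h.isFiniteMeasure
  have hg : MemLp g 2 μ := MemLp.of_bound hgm Cg hb
  set A := ∫ z, ‖H z‖ ^ 2 ∂μ with hA
  -- The dilation factor of the energy. Here `θ 1 = 1` and `θ' 1 = 2 - n + η`, the constant of the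
  -- Pohozaev inequality.
  set θ : ℝ → ℝ := fun l => (l ^ n)⁻¹ * (l ^ 2 * (1 + η * (l - 1))) with hθ
  set e : ℕ → ℝ := fun k => (eLpNorm (fun z => B z (gradient (ω k) z) - H z) 2 μ).toReal with he
  have hD : ∀ k, MemLp (fun z => B z (gradient (ω k) z)) 2 μ :=
    fun k => (hω k).memLp_coeff_gradient h 2
  obtain ⟨K, hK0, hK⟩ := h.exists_quotient_bound hCg hb
  refine ⟨K, fun m => ?_⟩
  have hdist : ∀ k, (eLpNorm (fun z => B z (gradient (fun y => ω m y - ω k y) z)) 2 μ).toReal ≤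
      e m + e k := by
    intro k
    have e1 : (fun z => B z (gradient (fun y => ω m y - ω k y) z)) =
        (fun z => B z (gradient (ω m) z) - H z) - (fun z => B z (gradient (ω k) z) - H z) := by
      ext z
      rw [gradient_sub' ((hω m).differentiable z) ((hω k).differentiable z)]
      simp
    have hm : MemLp (fun z => B z (gradient (ω m) z) - H z) 2 μ := (hD m).sub hH
    have hk : MemLp (fun z => B z (gradient (ω k) z) - H z) 2 μ := (hD k).sub hH
    rw [e1]
    simp only [he]
    rw [← ENNReal.toReal_add hm.2.ne hk.2.ne]
    exact ENNReal.toReal_mono (ENNReal.add_ne_top.2 ⟨hm.2.ne, hk.2.ne⟩)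
      (eLpNorm_sub_le hm.1 hk.1 (by norm_num))
  have hlimE : Tendsto (fun k => ∫ z, ‖B z (gradient (ω k) z)‖ ^ 2 ∂μ) atTop (𝓝 A) := by
    have := tendsto_integral_inner_of_tendsto_eLpNorm hD hD hH hH hlim hlim
    simpa only [real_inner_self_eq_norm_sq] using this
  have hlimH : Tendsto (fun k => ∫ z, inner ℝ (H z) (B z (gradient (ω k) z)) ∂μ) atTop
      (𝓝 A) := by
    have := tendsto_integral_inner_of_tendsto_eLpNorm (fun _ => hH) hD hH hH
      (tendsto_eLpNorm_const_zero H) hlim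
    simpa only [real_inner_self_eq_norm_sq] using this
  have hlime : Tendsto e atTop (𝓝 0) := by
    have := (ENNReal.tendsto_toReal ENNReal.zero_ne_top).comp hlim
    simpa [Function.comp_def] using this
  have step : ∀ j, (factor j - 1)⁻¹ * ∫ z, g z * (ω m (factor j • z) - ω m z) ∂μ ≤
      1 / 2 * ((factor j - 1)⁻¹ * (θ (factor j) - θ 1)) * A + K * e m := by
    intro j
    obtain ⟨hj1, hj2⟩ := factor_mem j
    set l := factor j with hl
    have hl0 : 0 < l - 1 := by linarith
    -- The dilation estimate is applied to `ω k` and transferred to the fixed `ω m`, at a cost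
    -- proportional to `l - 1`. As `k → ∞` with `l` fixed the energies collapse to `(θ l - 1) / 2 *
    -- A`; the result can then be divided by `l - 1`, and since `ω m` is `C¹` its difference
    -- quotient converges as `l → 1`.
    have hle : ∀ k, ∫ z, g z * (ω m (l • z) - ω m z) ∂μ ≤
        1 / 2 * A + 1 / 2 * (θ l * ∫ z, ‖B z (gradient (ω k) z)‖ ^ 2 ∂μ) -
          (∫ z, inner ℝ (H z) (B z (gradient (ω k) z)) ∂μ) + (l - 1) * (K * (e m + e k)) := by
      intro k
      have h1 := h.integral_dilation_le hg hH hweak (hω k) ⟨hj1, hj2⟩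
      have h2 := (le_abs_self _).trans (hK _ ((hω m).sub (hω k)) l hj1.le)
      have h3 : ∫ z, g z * (ω m (l • z) - ω k (l • z) - (ω m z - ω k z)) ∂μ =
          (∫ z, g z * (ω m (l • z) - ω m z) ∂μ) - ∫ z, g z * (ω k (l • z) - ω k z) ∂μ := by
        have i1 : ∀ k, Integrable (fun z => g z * (ω k (l • z) - ω k z)) μ := fun k =>
          hg.integrable_mul ((((hω k).comp_smul h hj1.le).sub (hω k)).memLp 2 μ)
        rw [← integral_sub (i1 m) (i1 k)]
        congr 1
        ext z
        ring
      rw [h3] at h2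
      have h4 : (l - 1) * (K * (eLpNorm (fun z => B z (gradient (fun y => ω m y - ω k y) z)) 2
          μ).toReal) ≤ (l - 1) * (K * (e m + e k)) := by
        have := hdist k
        gcongr
      linarith
    have hlimR : Tendsto (fun k => 1 / 2 * A +
        1 / 2 * (θ l * ∫ z, ‖B z (gradient (ω k) z)‖ ^ 2 ∂μ) -
          (∫ z, inner ℝ (H z) (B z (gradient (ω k) z)) ∂μ) + (l - 1) * (K * (e m + e k))) atTop
        (𝓝 (1 / 2 * A + 1 / 2 * (θ l * A) - A + (l - 1) * (K * (e m + 0)))) :=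
      ((((hlimE.const_mul _).const_mul _).const_add _).sub hlimH).add
        (((hlime.const_add _).const_mul _).const_mul _)
    have hfinal := ge_of_tendsto' hlimR hle
    have hθ1 : θ 1 = 1 := by simp [hθ]
    rw [hθ1, inv_mul_le_iff₀ hl0]
    have : (l - 1) * (1 / 2 * ((l - 1)⁻¹ * (θ l - 1)) * A + K * e m) =
        1 / 2 * (θ l - 1) * A + (l - 1) * (K * e m) := by
      field_simp
    rw [this]
    linarith
  have hgJ : IntegrableOn (fun z => J z * g z) Q := by
    obtain ⟨c, hc0, hc⟩ := h.density_lower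
    have := hg.integrable (by norm_num)
    rw [hμ, densityMeasure, integrable_withDensity_iff_integrable_smul'
      h.measurable_density.ennreal_ofReal (by simp)] at this
    refine this.congr ?_
    refine (ae_restrict_iff' h.measurableSet).2 (Eventually.of_forall fun z hz => ?_)
    simp [ENNReal.toReal_ofReal (h.density_pos hz).le]
  have hlimL := (hω m).tendsto_integral_dilation h hgJ
  have hθ' : HasDerivAt θ (2 - (n : ℝ) + η) 1 := by
    have h1 : HasDerivAt (fun l : ℝ => (l ^ n)⁻¹) (-(n : ℝ)) 1 := by
      have := (hasDerivAt_pow n (1 : ℝ)).fun_inv (by simp)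
      simpa using this
    have h2 : HasDerivAt (fun l : ℝ => 1 + η * (l - 1)) η 1 := by
      simpa using (((hasDerivAt_id (1 : ℝ)).sub_const 1).const_mul η).const_add 1
    have h3 : HasDerivAt (fun l : ℝ => l ^ 2) 2 1 := by
      simpa using hasDerivAt_pow 2 (1 : ℝ)
    have e : 2 - (n : ℝ) + η = -(n : ℝ) * (1 ^ 2 * (1 + η * (1 - 1))) +
        ((1 : ℝ) ^ n)⁻¹ * (2 * (1 + η * (1 - 1)) + 1 ^ 2 * η) := by
      simp; ring
    rw [e]
    exact h1.mul (h3.mul h2)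
  have hlimR : Tendsto (fun j => 1 / 2 * ((factor j - 1)⁻¹ * (θ (factor j) - θ 1)) * A + K * e m)
      atTop (𝓝 (1 / 2 * (2 - (n : ℝ) + η) * A + K * e m)) :=
    ((hθ'.tendsto_factor.const_mul _).mul_const _).add_const _
  rw [hμ, h.integral_densityMeasure]
  simp only [← mul_assoc]
  refine le_of_tendsto_of_tendsto hlimL hlimR (Eventually.of_forall fun j => ?_)
  refine le_trans (le_of_eq ?_) (step j)
  rw [hμ, h.integral_densityMeasure]
  simp only [mul_assoc]

/-- Nonexistence: the energy of a bounded weak solution vanishes. -/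
theorem DilationControl.ae_eq_zero (h : DilationControl Q B J η) {p : ℝ} (hp : 0 < p)
    (hη : 0 ≤ η)
    (hpη : ((Module.finrank ℝ E : ℝ) + η) / p < ((Module.finrank ℝ E : ℝ) - 2 - η) / 2)
    {f : ℝ → ℝ} (hf : Continuous f)
    (hfp : ∀ t : ℝ, p * (∫ τ in (0 : ℝ)..t, f τ) ≤ t * f t ∧ 0 ≤ p * ∫ τ in (0 : ℝ)..t, f τ)
    {w : E → ℝ} {H : E → E} (hw : AEStronglyMeasurable w (densityMeasure Q J)) {M : ℝ}
    (hM : 0 ≤ M) (hwM : ∀ᵐ z ∂(densityMeasure Q J), |w z| ≤ M)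
    (hH : MemLp H 2 (densityMeasure Q J))
    (hweak : ∀ ψ : E → ℝ, IsC1Test Q ψ →
      ∫ z, inner ℝ (H z) (B z (gradient ψ z)) ∂(densityMeasure Q J) =
        ∫ z, f (w z) * ψ z ∂(densityMeasure Q J))
    {ω : ℕ → E → ℝ} (hω : ∀ k, IsC1Test Q (ω k))
    (hlim0 : Tendsto (fun k => eLpNorm (fun z => ω k z - w z) 2 (densityMeasure Q J)) atTop (𝓝 0))
    (hlim : Tendsto (fun k => eLpNorm (fun z => B z (gradient (ω k) z) - H z) 2
      (densityMeasure Q J)) atTop (𝓝 0)) :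
    ∀ᵐ z ∂(densityMeasure Q J), H z = 0 := by
  set μ := densityMeasure Q J with hμ
  set n := Module.finrank ℝ E with hn
  have hfin : IsFiniteMeasure μ := h.isFiniteMeasure
  -- The truncated nonlinearity is only continuous, so `L²` convergence of `ω k` does not suffice
  -- for `g (ω k) → g w`. A subsequence converging almost everywhere gives it by bounded
  -- convergence.
  obtain ⟨ns, hns, hae⟩ := (tendstoInMeasure_of_tendsto_eLpNorm (by norm_num)
    (fun k => ((hω k).memLp 2 μ).1) hw hlim0).exists_seq_tendsto_ae
  replace hlim0 := hlim0.comp hns.tendsto_atTop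
  replace hlim := hlim.comp hns.tendsto_atTop
  replace hω := fun k => hω (ns k)
  generalize hω' : (fun k => ω (ns k)) = ω' at *
  have hωe : ∀ k, ω (ns k) = ω' k := fun k => by rw [← hω']
  simp only [Function.comp_def, hωe] at hlim0 hlim hω hae
  obtain ⟨g, F, hgc, ⟨C, hC0, hC⟩, hgf, hFd, hF0, hFn, hFf⟩ :=
    exists_bounded_truncation hf (fun t => (hfp t).2.trans (hfp t).1) hM
  have hgw : ∀ᵐ z ∂μ, g (w z) = f (w z) := by
    filter_upwards [hwM] with z hz using hgf _ hz
  have hw2 : MemLp w 2 μ := MemLp.of_bound hw M hwM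
  have hgwm : AEStronglyMeasurable (fun z => g (w z)) μ := hgc.comp_aestronglyMeasurable hw
  have hgw2 : MemLp (fun z => g (w z)) 2 μ :=
    MemLp.of_bound hgwm C (Eventually.of_forall fun z => hC _)
  have hweak' : ∀ ψ : E → ℝ, IsC1Test Q ψ →
      ∫ z, inner ℝ (H z) (B z (gradient ψ z)) ∂μ = ∫ z, g (w z) * ψ z ∂μ := by
    intro ψ hψ
    rw [hweak ψ hψ]
    apply integral_congr_ae
    filter_upwards [hgw] with z hz
    rw [hz]
  have hD : ∀ k, MemLp (fun z => B z (gradient (ω' k) z)) 2 μ :=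
    fun k => (hω k).memLp_coeff_gradient h 2
  have hω2 : ∀ k, MemLp (ω' k) 2 μ := fun k => (hω k).memLp 2 μ
  set A := ∫ z, ‖H z‖ ^ 2 ∂μ with hA
  -- In the limit this tests the equation with the solution itself.
  have hAw : A = ∫ z, g (w z) * w z ∂μ := by
    have h1 := tendsto_integral_inner_of_tendsto_eLpNorm (fun _ => hH) hD hH hH
      (tendsto_eLpNorm_const_zero H) hlim
    have h2 := tendsto_integral_mul_of_tendsto_eLpNorm (fun _ => hgw2) hω2 hgw2 hw2
      (tendsto_eLpNorm_const_zero _) hlim0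
    simp_rw [fun k => hweak' _ (hω k)] at h1
    simp only [real_inner_self_eq_norm_sq] at h1
    exact tendsto_nhds_unique h1 h2
  have hFlip : ∀ s t, |F s - F t| ≤ C * |s - t| := by
    intro s t
    have := Convex.norm_image_sub_le_of_norm_hasDerivWithin_le (s := univ)
      (fun x _ => (hFd x).hasDerivWithinAt) (fun x _ => hC x) convex_univ (mem_univ t) (mem_univ s)
    simpa using this
  have hFc : Continuous F := continuous_iff_continuousAt.2 fun t => (hFd t).continuousAt
  have hFC1 : ContDiff ℝ 1 F := by
    rw [contDiff_one_iff_deriv]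
    refine ⟨fun t => (hFd t).differentiableAt, ?_⟩
    rwa [show deriv F = g from funext fun t => (hFd t).deriv]
  have hFw2 : MemLp (fun z => F (w z)) 2 μ := by
    refine MemLp.of_bound (hFc.comp_aestronglyMeasurable hw) (C * M) ?_
    filter_upwards [hwM] with z hz
    have := hFlip (w z) 0
    rw [hF0, sub_zero, sub_zero] at this
    exact this.trans (by gcongr)
  have hFω : ∀ k, IsC1Test Q (fun z => F (ω' k z)) := fun k => by
    have hsupp : tsupport (fun z => F (ω' k z)) ⊆ tsupport (ω' k) := by
      apply closure_mono
      intro z hz h0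
      apply hz
      change F (ω' k z) = 0
      rw [h0, hF0]
    exact ⟨hFC1.comp (hω k).contDiff,
      (hω k).compact.isCompact.of_isClosed_subset isClosed_closure hsupp,
      hsupp.trans (hω k).support⟩
  have hFlim : Tendsto (fun k => ∫ z, F (ω' k z) ∂μ) atTop (𝓝 (∫ z, F (w z) ∂μ)) := by
    have hl : Tendsto (fun k => eLpNorm (fun z => F (ω' k z) - F (w z)) 2 μ) atTop (𝓝 0) := by
      have hb : ∀ k, eLpNorm (fun z => F (ω' k z) - F (w z)) 2 μ ≤
          ENNReal.ofReal C * eLpNorm (fun z => ω' k z - w z) 2 μ := fun k =>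
        eLpNorm_le_mul_eLpNorm_of_ae_le_mul (Eventually.of_forall fun z => hFlip _ _) 2
      refine tendsto_of_tendsto_of_tendsto_of_le_of_le tendsto_const_nhds ?_
        (fun k => zero_le) hb
      simpa using ENNReal.Tendsto.const_mul hlim0 (Or.inr ENNReal.ofReal_ne_top)
    have := tendsto_integral_mul_of_tendsto_eLpNorm (fun k => (hFω k).memLp 2 μ)
      (fun _ => memLp_const (1 : ℝ)) hFw2 (memLp_const (1 : ℝ)) hl
      (tendsto_eLpNorm_const_zero _)
    simpa using this
  obtain ⟨K, hK⟩ := h.radial_le hC0 hgwm (Eventually.of_forall fun z => hC _) hH hweak' hω hlim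
  obtain ⟨K', hK'0, hK'⟩ := h.exists_radial_bound
  set e : ℕ → ℝ := fun k => (eLpNorm (fun z => B z (gradient (ω' k) z) - H z) 2 μ).toReal with he
  set d : ℕ → ℝ := fun k => (eLpNorm (fun z => g (ω' k z) - g (w z)) 2 μ).toReal with hd
  have hlime : Tendsto e atTop (𝓝 0) := by
    have := (ENNReal.tendsto_toReal ENNReal.zero_ne_top).comp hlim
    simpa [Function.comp_def] using this
  have hgω : ∀ k, AEStronglyMeasurable (fun z => g (ω' k z)) μ := fun k =>
    (hgc.comp (hω k).contDiff.continuous).aestronglyMeasurable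
  have hgω2 : ∀ k, MemLp (fun z => g (ω' k z)) 2 μ := fun k =>
    MemLp.of_bound (hgω k) C (Eventually.of_forall fun z => hC _)
  have hlimd : Tendsto d atTop (𝓝 0) := by
    have h1 := tendsto_eLpNorm_two_of_bounded_ae hgω
      (fun k => Eventually.of_forall fun z => hC (ω' k z))
      (a₀ := fun z => g (w z)) (by
        filter_upwards [hae] with z hz
        exact (hgc.tendsto _).comp hz)
    have := (ENNReal.tendsto_toReal ENNReal.zero_ne_top).comp h1
    simpa [Function.comp_def] using this
  set N := (eLpNorm H 2 μ).toReal with hN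
  have hDN : ∀ k, (eLpNorm (fun z => B z (gradient (ω' k) z)) 2 μ).toReal ≤ e k + N := by
    intro k
    have hk : MemLp (fun z => B z (gradient (ω' k) z) - H z) 2 μ := (hD k).sub hH
    simp only [he, hN]
    rw [← ENNReal.toReal_add hk.2.ne hH.2.ne]
    refine ENNReal.toReal_mono (ENNReal.add_ne_top.2 ⟨hk.2.ne, hH.2.ne⟩) ?_
    have := eLpNorm_add_le hk.1 hH.1 (p := 2) (by norm_num)
    simpa [Pi.add_def] using this
  -- The chain rule `∂ᵣ F(ω) = g(ω) ∂ᵣ ω` allows the lower bound for radial derivatives of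
  -- nonnegative test functions to meet the upper bound of `radial_le`. The latter carries `g (w)`
  -- instead of `g (ω)`; the last term bounds this discrepancy, a product of a null sequence and the
  -- bounded norms of `∂ᵣ ω`.
  have hmain : ∀ k, -((n : ℝ) + η) * (∫ z, F (ω' k z) ∂μ) ≤
      1 / 2 * (2 - (n : ℝ) + η) * A + K * e k + d k * (K' * (e k + N)) := by
    intro k
    have h1 := (hFω k).integral_radial_ge h (fun z => hFn _)
    have h2 : ∀ z, fderiv ℝ (fun z => F (ω' k z)) z z = g (ω' k z) * fderiv ℝ (ω' k) z z := by
      intro z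
      have := (hFd (ω' k z)).comp_hasFDerivAt z ((hω k).differentiable z).hasFDerivAt
      rw [show fderiv ℝ (fun z => F (ω' k z)) z = g (ω' k z) • fderiv ℝ (ω' k) z from this.fderiv]
      simp
    simp only [h2] at h1
    have h3 := abs_integral_mul_le_eLpNorm ((hgω2 k).sub hgw2) (h.memLp_radial (hω k))
    have h4 : ∫ z, ((fun z => g (ω' k z)) - fun z => g (w z)) z * fderiv ℝ (ω' k) z z ∂μ =
        (∫ z, g (ω' k z) * fderiv ℝ (ω' k) z z ∂μ) - ∫ z, g (w z) * fderiv ℝ (ω' k) z z ∂μ := by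
      have i1 : Integrable (fun z => g (ω' k z) * fderiv ℝ (ω' k) z z) μ :=
        (hgω2 k).integrable_mul (h.memLp_radial (hω k))
      have i2 : Integrable (fun z => g (w z) * fderiv ℝ (ω' k) z z) μ :=
        hgw2.integrable_mul (h.memLp_radial (hω k))
      rw [← integral_sub i1 i2]
      simp only [Pi.sub_apply, sub_mul]
    rw [h4] at h3
    have h5 : (eLpNorm ((fun z => g (ω' k z)) - fun z => g (w z)) 2 μ).toReal *
        (eLpNorm (fun z => fderiv ℝ (ω' k) z z) 2 μ).toReal ≤ d k * (K' * (e k + N)) := by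
      refine mul_le_mul_of_nonneg_left ((hK' _ (hω k)).trans ?_) ENNReal.toReal_nonneg
      exact mul_le_mul_of_nonneg_left (hDN k) hK'0
    have h6 := (le_abs_self _).trans (h3.trans h5)
    have h7 := hK k
    linarith
  have hineq : -((n : ℝ) + η) * (∫ z, F (w z) ∂μ) ≤ 1 / 2 * (2 - (n : ℝ) + η) * A := by
    have hR : Tendsto (fun k => 1 / 2 * (2 - (n : ℝ) + η) * A + K * e k + d k * (K' * (e k + N)))
        atTop (𝓝 (1 / 2 * (2 - (n : ℝ) + η) * A + K * 0 + 0 * (K' * (0 + N)))) :=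
      ((hlime.const_mul _).const_add _).add (hlimd.mul ((hlime.add_const _).const_mul _))
    have := le_of_tendsto_of_tendsto' (hFlim.const_mul _) hR hmain
    linarith
  have hpF : p * ∫ z, F (w z) ∂μ ≤ A := by
    rw [hAw, ← integral_const_mul]
    apply integral_mono_ae ((hFw2.integrable (by norm_num)).const_mul _)
      (hgw2.integrable_mul hw2)
    filter_upwards [hwM, hgw] with z h1 h2
    simp only [Pi.mul_apply]
    rw [hFf _ h1, h2, mul_comm (f _)]
    exact (hfp _).1
  have hA0 : 0 ≤ A := integral_nonneg fun z => by positivity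
  have hA1 : A = 0 := by
    have h1 : ∫ z, F (w z) ∂μ ≤ A / p := by
      rw [le_div_iff₀ hp]; linarith
    have h2 : ((n : ℝ) + η) * (∫ z, F (w z) ∂μ) ≤ ((n : ℝ) + η) * (A / p) := by
      have : (0 : ℝ) ≤ (n : ℝ) := Nat.cast_nonneg n
      gcongr
    -- The Pohozaev inequality with `∫ F(w) ≤ A / p` inserted. By `hpη` the bracket is positive,
    -- which forces `A = 0`.
    have h3 : (((n : ℝ) - 2 - η) / 2 - ((n : ℝ) + η) / p) * A ≤ 0 := by
      have : ((n : ℝ) + η) * (A / p) = ((n : ℝ) + η) / p * A := by ring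
      linarith
    nlinarith
  rw [hA, integral_eq_zero_iff_of_nonneg (fun z => by positivity)
    (hH.integrable_norm_pow (by norm_num))] at hA1
  filter_upwards [hA1] with z hz
  simpa using hz

end Pohozaev

/-! ### Extension and arclength parametrisation of the curve. -/

section Curve

/-- A `C^k` function on a compact interval extends to a `C^k` function on the line. -/
lemma exists_contDiff_extension {F : Type*} [NormedAddCommGroup F] [NormedSpace ℝ F]
    [CompleteSpace F] {a b : ℝ} (hab : a < b) (k : ℕ) :
    ∀ g : ℝ → F, ContDiffOn ℝ k g (Icc a b) →
      ∃ g' : ℝ → F, ContDiff ℝ k g' ∧ EqOn g' g (Icc a b) := by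
  induction k with
  | zero =>
    intro g hg
    have hc : ContinuousOn g (Icc a b) := hg.continuousOn
    refine ⟨IccExtend hab.le ((Icc a b).domRestrict g), ?_, fun t ht => ?_⟩
    · exact contDiff_zero.2 (hc.domRestrict.Icc_extend')
    · rw [IccExtend_of_mem _ _ ht]; rfl
  | succ k ih =>
    intro g hg
    have hu := uniqueDiffOn_Icc hab
    push_cast at hg
    obtain ⟨hd, -, hd'⟩ := (contDiffOn_succ_iff_derivWithin hu).1 hg
    -- The derivative is extended by induction and then integrated from `a`; at level zero the
    -- function is continued by its end values.
    obtain ⟨h, hh, hhe⟩ := ih _ hd'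
    have hder : ∀ t, HasDerivAt (fun t => g a + ∫ s in a..t, h s) (h t) t := fun t =>
      (intervalIntegral.integral_hasDerivAt_right (hh.continuous.intervalIntegrable _ _)
        (hh.continuous.stronglyMeasurableAtFilter _ _) hh.continuous.continuousAt).const_add _
    refine ⟨fun t => g a + ∫ s in a..t, h s, ?_, ?_⟩
    · push_cast
      rw [contDiff_succ_iff_deriv]
      refine ⟨fun t => (hder t).differentiableAt, by simp, ?_⟩
      rwa [show deriv (fun t => g a + ∫ s in a..t, h s) = h from funext fun t => (hder t).deriv]
    · apply eq_of_derivWithin_eq (fun t _ => (hder t).differentiableAt.differentiableWithinAt) hd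
      · intro t ht
        have ht' := Ico_subset_Icc_self ht
        rw [(hder t).hasDerivWithinAt.derivWithin (hu t ht')]
        exact hhe ht'
      · simp

/-- A positive `C^k` function on a compact interval extends to a `C^k` function on the line with
a positive lower bound. -/
lemma exists_contDiff_extension_pos {a b : ℝ} (hab : a < b) {k : ℕ} {g : ℝ → ℝ}
    (hg : ContDiffOn ℝ k g (Icc a b)) (hpos : ∀ t ∈ Icc a b, 0 < g t) :
    ∃ g' : ℝ → ℝ, ContDiff ℝ k g' ∧ EqOn g' g (Icc a b) ∧ ∃ m : ℝ, 0 < m ∧ ∀ t, m ≤ g' t := by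
  obtain ⟨t₀, ht₀, hmin⟩ := isCompact_Icc.exists_isMinOn (nonempty_Icc.2 hab.le) hg.continuousOn
  have hm : 0 < g t₀ / 2 := by have := hpos t₀ ht₀; linarith
  have hsub : ∀ t ∈ Icc a b, 0 < g t - g t₀ / 2 := fun t ht => by
    have : g t₀ ≤ g t := hmin ht
    linarith
  -- Writing `g` as half its minimum plus a square makes positivity automatic for the extension:
  -- only the square root is extended.
  obtain ⟨q, hq, hqe⟩ := exists_contDiff_extension hab k (fun t => Real.sqrt (g t - g t₀ / 2))
    ((hg.sub contDiffOn_const).sqrt fun t ht => (hsub t ht).ne')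
  refine ⟨fun t => g t₀ / 2 + q t ^ 2, contDiff_const.add (hq.pow 2), fun t ht => ?_,
    g t₀ / 2, hm, fun t => by nlinarith [sq_nonneg (q t)]⟩
  simp only [hqe ht, Real.sq_sqrt (hsub t ht).le]
  ring

/-- A `C^(k+1)` primitive of a `C^k` function bounded below by a positive constant is a
homeomorphism of the line with `C^(k+1)` inverse. -/
lemma exists_primitive_homeomorph {k : ℕ} {σ : ℝ → ℝ} (hσ : ContDiff ℝ k σ) {m : ℝ} (hm : 0 < m)
    (hσm : ∀ t, m ≤ σ t) (a y : ℝ) :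
    ∃ S : ℝ ≃ₜ ℝ, (∀ t, HasDerivAt S (σ t) t) ∧ S a = y ∧ StrictMono S ∧
      ContDiff ℝ (k + 1 : ℕ) S.symm := by
  set T : ℝ → ℝ := fun t => y + ∫ s in a..t, σ s with hT
  have hder : ∀ t, HasDerivAt T (σ t) t := fun t =>
    (intervalIntegral.integral_hasDerivAt_right (hσ.continuous.intervalIntegrable _ _)
      (hσ.continuous.stronglyMeasurableAtFilter _ _) hσ.continuous.continuousAt).const_add _
  have hmono : StrictMono T := strictMono_of_deriv_pos fun t => by
    rw [(hder t).deriv]; exact hm.trans_le (hσm t)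
  have hcont : Continuous T := continuous_iff_continuousAt.2 fun t => (hder t).continuousAt
  -- Growth at least linear of slope `m` forces `T` to tend to both infinities, hence to be onto.
  have hmono2 : Monotone fun t => T t - m * t := by
    apply monotone_of_deriv_nonneg
    · exact fun t => ((hder t).differentiableAt).sub (by fun_prop)
    · intro t
      have : HasDerivAt (fun t => T t - m * t) (σ t - m) t := by
        simpa using (hder t).fun_sub ((hasDerivAt_id t).const_mul m)
      rw [this.deriv]
      linarith [hσm t]
  have htop : Tendsto T atTop atTop := by
    have h1 : Tendsto (fun t : ℝ => m * t + T 0) atTop atTop :=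
      tendsto_atTop_add_const_right _ _ (tendsto_id.const_mul_atTop hm)
    refine tendsto_atTop_mono' _ ?_ h1
    filter_upwards [eventually_ge_atTop 0] with t ht
    have := hmono2 ht
    simp only [mul_zero, sub_zero] at this
    linarith
  have hbot : Tendsto T atBot atBot := by
    have h1 : Tendsto (fun t : ℝ => m * t + T 0) atBot atBot :=
      tendsto_atBot_add_const_right _ _ (tendsto_id.const_mul_atBot hm)
    refine tendsto_atBot_mono' _ ?_ h1
    filter_upwards [eventually_le_atBot 0] with t ht
    have := hmono2 ht
    simp only [mul_zero, sub_zero] at this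
    linarith
  have hsurj : Function.Surjective T := hcont.surjective htop hbot
  let S : ℝ ≃ₜ ℝ := (hmono.orderIsoOfSurjective T hsurj).toHomeomorph
  have hS : ∀ t, S t = T t := fun t => rfl
  have hSder : ∀ t, HasDerivAt S (σ t) t := hder
  refine ⟨S, hSder, by rw [hS]; simp [hT], hmono, ?_⟩
  apply S.contDiff_symm_deriv (fun t => (hm.trans_le (hσm t)).ne') hSder
  push_cast
  rw [contDiff_succ_iff_deriv]
  refine ⟨fun t => (hSder t).differentiableAt, by simp, ?_⟩
  rwa [show deriv S = σ from funext fun t => (hSder t).deriv]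

/-- Arclength parametrisation, centred at the midpoint. -/
lemma exists_arclength {n : ℕ} {a b : ℝ} (hab : a < b) {γ : ℝ → EuclideanSpace ℝ (Fin n)}
    (hγ : ContDiffOn ℝ 3 γ (Icc a b))
    (hreg : ∀ t ∈ Icc a b, derivWithin γ (Icc a b) t ≠ 0) (hinj : InjOn γ (Icc a b)) :
    ∃ (L : ℝ) (c : ℝ → EuclideanSpace ℝ (Fin n)), 0 < L ∧ ContDiff ℝ 3 c ∧
      (∀ t ∈ Icc (-L) L, ‖deriv c t‖ = 1) ∧ InjOn c (Icc (-L) L) ∧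
      ∀ ε, tube γ a b ε = {x | ∃ t ∈ Ioo (-L) L, ∃ ξ : EuclideanSpace ℝ (Fin n),
        inner ℝ ξ (deriv c t) = 0 ∧ ‖ξ‖ < ε ∧ x = c t + ξ} := by
  have hu := uniqueDiffOn_Icc hab
  obtain ⟨g, hg, hge⟩ := exists_contDiff_extension hab 3 γ (by exact_mod_cast hγ)
  have hgd : Differentiable ℝ g := hg.differentiable (by norm_num)
  have hder : ∀ t ∈ Icc a b, deriv g t = derivWithin γ (Icc a b) t := by
    intro t ht
    rw [← (hgd t).derivWithin (hu t ht)]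
    exact derivWithin_congr hge (hge ht)
  have hg3 : ContDiff ℝ ((2 : ℕ) + 1) g := by
    norm_num at hg ⊢
    exact hg
  have hg' : ContDiff ℝ (2 : ℕ) (deriv g) := (contDiff_succ_iff_deriv.1 hg3).2.2
  -- The extended curve may have zero velocity outside `[a, b]`. Replacing its speed there by a
  -- positive `σ` makes the change of parameter a homeomorphism of the whole line with `C³` inverse.
  obtain ⟨σ, hσ, hσe, m, hm, hσm⟩ := exists_contDiff_extension_pos hab (k := 2)
    (g := fun t => ‖deriv g t‖)
    (hg'.contDiffOn.norm ℝ fun t ht => by rw [hder t ht]; exact hreg t ht)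
    (fun t ht => norm_pos_iff.2 (by rw [hder t ht]; exact hreg t ht))
  -- Half the length: the parameter runs over `[-L, L]`, so that the straight tube is star-shaped
  -- about the origin.
  set L : ℝ := (∫ s in a..b, σ s) / 2 with hL
  obtain ⟨S, hSd, hSa, hSm, hSs⟩ := exists_primitive_homeomorph hσ hm hσm a (-L)
  have hSb : S b = L := by
    have := intervalIntegral.integral_eq_sub_of_hasDerivAt (fun t _ => hSd t)
      (hσ.continuous.intervalIntegrable a b)
    rw [hSa] at this
    linarith
  have hLpos : 0 < L := by
    have := hSm hab
    rw [hSa, hSb] at this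
    linarith
  have hmemI : ∀ t, S t ∈ Icc (-L) L ↔ t ∈ Icc a b := fun t => by
    rw [← hSa, ← hSb, mem_Icc, mem_Icc, hSm.le_iff_le, hSm.le_iff_le]
  have hmemO : ∀ t, S t ∈ Ioo (-L) L ↔ t ∈ Ioo a b := fun t => by
    rw [← hSa, ← hSb, mem_Ioo, mem_Ioo, hSm.lt_iff_lt, hSm.lt_iff_lt]
  have hsd : ∀ t, HasDerivAt S.symm (σ t)⁻¹ (S t) := by
    intro t
    refine HasDerivAt.of_local_left_inverse S.symm.continuous.continuousAt ?_
      (hm.trans_le (hσm t)).ne' (Eventually.of_forall fun y => S.apply_symm_apply y)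
    rw [S.symm_apply_apply]
    exact hSd t
  have hcd : ∀ t, deriv (fun s => g (S.symm s)) (S t) = (σ t)⁻¹ • deriv g t := by
    intro t
    have h1 : HasDerivAt g (deriv g t) (S.symm (S t)) := by
      rw [S.symm_apply_apply]
      exact (hgd t).hasDerivAt
    exact (h1.scomp (S t) (hsd t)).deriv
  refine ⟨L, fun s => g (S.symm s), hLpos, ?_, ?_, ?_, ?_⟩
  · exact hg.comp hSs
  · intro s hs
    obtain ⟨t, rfl⟩ := S.surjective s
    have ht := (hmemI t).1 hs
    rw [hcd, norm_smul, norm_inv, Real.norm_eq_abs, abs_of_pos (hm.trans_le (hσm t)), hσe ht]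
    refine inv_mul_cancel₀ (norm_ne_zero_iff.2 ?_)
    rw [hder t ht]
    exact hreg t ht
  · intro s hs s' hs' heq
    obtain ⟨t, rfl⟩ := S.surjective s
    obtain ⟨t', rfl⟩ := S.surjective s'
    simp only [S.symm_apply_apply] at heq
    rw [hmemI] at hs hs'
    rw [hge hs, hge hs'] at heq
    rw [hinj hs hs' heq]
  · intro ε
    have hperp : ∀ t ∈ Ioo a b, ∀ ξ : EuclideanSpace ℝ (Fin n),
        inner ℝ ξ (deriv (fun s => g (S.symm s)) (S t)) = 0 ↔
          inner ℝ ξ (derivWithin γ (Icc a b) t) = 0 := by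
      intro t ht ξ
      rw [hcd, ← hder t (Ioo_subset_Icc_self ht), inner_smul_right, mul_eq_zero,
        or_iff_right (inv_ne_zero (hm.trans_le (hσm t)).ne')]
    ext x
    constructor
    · rintro ⟨t, ht, ξ, h1, h2, rfl⟩
      refine ⟨S t, (hmemO t).2 ht, ξ, (hperp t ht ξ).2 h1, h2, ?_⟩
      simp only [S.symm_apply_apply]
      rw [hge (Ioo_subset_Icc_self ht)]
    · rintro ⟨s, hs, ξ, h1, h2, rfl⟩
      obtain ⟨t, rfl⟩ := S.surjective s
      have ht := (hmemO t).1 hs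
      refine ⟨t, ht, ξ, (hperp t ht ξ).1 h1, h2, ?_⟩
      simp only [S.symm_apply_apply]
      rw [hge (Ioo_subset_Icc_self ht)]

/-- In dimension at least three some unit vector is not a velocity of a given `C²` curve. -/
lemma exists_unit_forall_ne {E : Type*} [NormedAddCommGroup E] [InnerProductSpace ℝ E]
    [FiniteDimensional ℝ E] (hn : 3 ≤ Module.finrank ℝ E) {v : ℝ → E} (hv : ContDiff ℝ 1 v) :
    ∃ e : E, ‖e‖ = 1 ∧ ∀ t, v t ≠ e := by
  -- The cone over the velocities is a `C¹` image of `ℝ²`, so it omits some vector in dimension at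
  -- least three. The normalised vector is not a velocity, since scaling back would put the original
  -- in the cone.
  have hd := ContDiff.dense_compl_range_of_finrank_lt_finrank
    (f := fun q : ℝ × ℝ => q.1 • v q.2) (by fun_prop)
    (by rw [Module.finrank_prod]; simp; omega)
  obtain ⟨x, hx⟩ := hd.nonempty
  have hx0 : x ≠ 0 := by
    rintro rfl
    exact hx ⟨(0, 0), by simp⟩
  refine ⟨‖x‖⁻¹ • x, by simpa using norm_smul_inv_norm (𝕜 := ℝ) hx0, fun t ht => hx ⟨(‖x‖, t), ?_⟩⟩
  simp only [ht]
  rw [smul_inv_smul₀ (norm_ne_zero_iff.2 hx0)]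

end Curve

/-! ### Slow radial variation near a set of constancy. -/

section RadialVariation

variable {E W : Type*} [NormedAddCommGroup E] [NormedSpace ℝ E] [NormedAddCommGroup W]
  [NormedSpace ℝ W]

/-- If `S` is constant on a set star-shaped about the origin, its radial derivative vanishes
there. -/
lemma fderiv_apply_self_eq_zero {K U : Set E} {S : E → W} (hU : IsOpen U) (hKU : K ⊆ U)
    (hS : ContDiffOn ℝ 1 S U) (hK : ∀ z ∈ K, ∀ s ∈ Icc (0 : ℝ) 1, s • z ∈ K) {S₀ : W}
    (hconst : ∀ z ∈ K, S z = S₀) {z : E} (hz : z ∈ K) : fderiv ℝ S z z = 0 := by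
  have hd : DifferentiableAt ℝ S ((1 : ℝ) • z) := by
    rw [one_smul]
    exact (hS.differentiableOn (by norm_num)).differentiableAt (hU.mem_nhds (hKU hz))
  have h1 : HasDerivAt (fun s : ℝ => s • z) z 1 := by
    simpa using (hasDerivAt_id (1 : ℝ)).smul_const z
  -- Only the part `s ≤ 1` of the ray is known to lie in `K`, so derivatives within `[0, 1]` are
  -- compared at the end point `1`.
  have h2 : HasDerivWithinAt (fun s : ℝ => S (s • z)) (fderiv ℝ S z z) (Icc 0 1) 1 := by
    have := hd.hasFDerivAt.comp_hasDerivAt 1 h1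
    rw [one_smul] at this
    exact this.hasDerivWithinAt
  have h3 : HasDerivWithinAt (fun s : ℝ => S (s • z)) 0 (Icc 0 1) 1 :=
    (hasDerivWithinAt_const (1 : ℝ) (Icc 0 1) S₀).congr (fun s hs => hconst _ (hK z hz s hs))
      (hconst _ (hK z hz 1 (by simp)))
  exact (uniqueDiffOn_Icc zero_lt_one 1 (by simp)).eq_deriv _ h2 h3

/-- Near a compact set on which it is constant, a `C¹` function varies slowly in the radial
direction. -/
lemma exists_open_radial_variation {K U : Set E} {S : E → W} (hU : IsOpen U) (hKU : K ⊆ U)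
    (hS : ContDiffOn ℝ 1 S U) (hK : ∀ z ∈ K, ∀ s ∈ Icc (0 : ℝ) 1, s • z ∈ K) {S₀ : W}
    (hconst : ∀ z ∈ K, S z = S₀) {δ : ℝ} (hδ : 0 < δ) :
    ∃ U' : Set E, IsOpen U' ∧ K ⊆ U' ∧ U' ⊆ U ∧ (∀ z ∈ U', ‖S z - S₀‖ < δ) ∧
      ∀ z, (∀ s ∈ Icc (0 : ℝ) 1, s • z ∈ U') → ∀ l ∈ Ioc (1 : ℝ) 2,
        ‖S (l⁻¹ • z) - S z‖ ≤ δ * (l - 1) := by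
  have hc1 : ContinuousOn (fun z => ‖fderiv ℝ S z z‖) U :=
    ((hS.continuousOn_fderiv_of_isOpen hU (by norm_num)).clm_apply continuousOn_id).norm
  have hc2 : ContinuousOn (fun z => ‖S z - S₀‖) U := (hS.continuousOn.sub continuousOn_const).norm
  -- The threshold `δ / 2` anticipates division by `s ≥ l⁻¹ ≥ 1 / 2`: it gives `‖dS(s • z) z‖ ≤ δ`
  -- along the segment, whose parameter length satisfies `1 - l⁻¹ ≤ l - 1`.
  refine ⟨U ∩ (fun z => ‖fderiv ℝ S z z‖) ⁻¹' Iio (δ / 2) ∩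
    (U ∩ (fun z => ‖S z - S₀‖) ⁻¹' Iio δ), ?_, ?_, ?_, ?_, ?_⟩
  · exact (hc1.isOpen_inter_preimage hU isOpen_Iio).inter (hc2.isOpen_inter_preimage hU isOpen_Iio)
  · intro z hz
    refine ⟨⟨hKU hz, ?_⟩, hKU hz, ?_⟩
    · simp [fderiv_apply_self_eq_zero hU hKU hS hK hconst hz, hδ]
    · simp [hconst z hz, hδ]
  · exact fun z hz => hz.1.1
  · exact fun z hz => hz.2.2
  · intro z hz l hl
    have hl0 : (0 : ℝ) < l := by linarith [hl.1]
    have hinv1 : l⁻¹ ≤ 1 := inv_le_one_of_one_le₀ hl.1.le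
    have hinv2 : (1 / 2 : ℝ) ≤ l⁻¹ := by
      rw [one_div]; exact inv_anti₀ hl0 hl.2
    have hd : ∀ s ∈ Icc (l⁻¹) 1, HasDerivWithinAt (fun s : ℝ => S (s • z))
        (fderiv ℝ S (s • z) z) (Icc (l⁻¹) 1) s := by
      intro s hs
      have hm := (hz s ⟨by linarith [hs.1], hs.2⟩).1.1
      have hd : DifferentiableAt ℝ S (s • z) :=
        (hS.differentiableOn (by norm_num)).differentiableAt (hU.mem_nhds hm)
      have h1 : HasDerivAt (fun s : ℝ => s • z) z s := by
        simpa using (hasDerivAt_id s).smul_const z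
      exact (hd.hasFDerivAt.comp_hasDerivAt s h1).hasDerivWithinAt
    have hb : ∀ s ∈ Icc (l⁻¹) 1, ‖fderiv ℝ S (s • z) z‖ ≤ δ := by
      intro s hs
      have hs0 : 1 / 2 ≤ s := hinv2.trans hs.1
      have hm : ‖fderiv ℝ S (s • z) (s • z)‖ < δ / 2 := (hz s ⟨by linarith, hs.2⟩).1.2
      rw [map_smul, norm_smul, Real.norm_eq_abs, abs_of_pos (by linarith)] at hm
      nlinarith [norm_nonneg (fderiv ℝ S (s • z) z)]
    have := (convex_Icc (l⁻¹) 1).norm_image_sub_le_of_norm_hasDerivWithin_le hd hb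
      (right_mem_Icc.2 hinv1) (left_mem_Icc.2 hinv1)
    rw [one_smul] at this
    refine this.trans ?_
    rw [Real.norm_eq_abs, abs_of_nonpos (by linarith)]
    refine mul_le_mul_of_nonneg_left ?_ hδ.le
    have : l * l⁻¹ = 1 := mul_inv_cancel₀ hl0.ne'
    nlinarith [hl.1]

end RadialVariation

/-! ### Smooth dependence of the pulled-back metric on the derivative. -/

section Determinant

variable {E : Type*} [NormedAddCommGroup E] [InnerProductSpace ℝ E] [FiniteDimensional ℝ E]

/-- In a basis the determinant is a polynomial in the matrix entries. -/
lemma contDiff_continuousLinearMap_det {k : WithTop ℕ∞} :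
    ContDiff ℝ k fun A : E →L[ℝ] E => A.det := by
  let b := Module.finBasis ℝ E
  have e : (fun A : E →L[ℝ] E => A.det) = fun A : E →L[ℝ] E =>
      ∑ σ : Equiv.Perm (Fin (Module.finrank ℝ E)),
        ((Equiv.Perm.sign σ : ℤ) : ℝ) * ∏ i, b.repr (A (b i)) (σ i) := by
    ext A
    rw [ContinuousLinearMap.det, ← LinearMap.det_toMatrix b, Matrix.det_apply']
    simp [LinearMap.toMatrix_apply]
  rw [e]
  have hent : ∀ i j, ContDiff ℝ k fun A : E →L[ℝ] E => b.repr (A (b i)) j := by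
    intro i j
    have h1 : ContDiff ℝ k fun A : E →L[ℝ] E => A (b i) := contDiff_id.clm_apply contDiff_const
    exact ((LinearMap.toContinuousLinearMap (b.coord j)).contDiff).comp h1
  exact ContDiff.sum fun σ _ => contDiff_const.mul (contDiff_prod fun i _ => hent i _)

/-- The gradient of `φ ∘ X` is the transposed derivative of `X` applied to the gradient of `φ`;
this is the inverse transformation. -/
noncomputable def inverseAdjoint (A : E →L[ℝ] E) : E →L[ℝ] E :=
  ContinuousLinearMap.adjoint A.inverse

/-- The metric density `|det A| (Aᵀ A)⁻¹`. -/
noncomputable def metricDensity (A : E →L[ℝ] E) : E →L[ℝ] E :=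
  |A.det| • ((ContinuousLinearMap.adjoint (inverseAdjoint A)).comp (inverseAdjoint A))

/-- Identifies the energy integrand `J ‖B v‖²` with a quadratic form, so that operator norm bounds
for `metricDensity` control the energy. -/
lemma inner_metricDensity (A : E →L[ℝ] E) (v : E) :
    inner ℝ (metricDensity A v) v = |A.det| * ‖inverseAdjoint A v‖ ^ 2 := by
  simp only [metricDensity, smul_apply, ContinuousLinearMap.comp_apply]
  rw [real_inner_smul_left, ContinuousLinearMap.adjoint_inner_left, real_inner_self_eq_norm_sq]

lemma contDiffAt_inverse {A : E →L[ℝ] E} (hA : A.det ≠ 0) {k : WithTop ℕ∞} :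
    ContDiffAt ℝ k ContinuousLinearMap.inverse A := by
  have := contDiffAt_map_inverse (n := k) (A.toContinuousLinearEquivOfDetNeZero hA)
  rwa [ContinuousLinearMap.coe_toContinuousLinearEquivOfDetNeZero] at this

lemma contDiffAt_inverseAdjoint {A : E →L[ℝ] E} (hA : A.det ≠ 0) {k : WithTop ℕ∞} :
    ContDiffAt ℝ k inverseAdjoint A :=
  (LinearIsometryEquiv.contDiff
    (ContinuousLinearMap.adjoint (𝕜 := ℝ) (E := E) (F := E)) (n := k)).contDiffAt.comp A
    (contDiffAt_inverse hA)

lemma contDiffAt_abs_det {A : E →L[ℝ] E} (hA : A.det ≠ 0) :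
    ContDiffAt ℝ 1 (fun A : E →L[ℝ] E => |A.det|) A :=
  ContDiffAt.comp A (by exact_mod_cast contDiffAt_abs (n := 1) hA)
    contDiff_continuousLinearMap_det.contDiffAt

lemma contDiffAt_metricDensity {A : E →L[ℝ] E} (hA : A.det ≠ 0) :
    ContDiffAt ℝ 1 metricDensity A := by
  have h1 := contDiffAt_inverseAdjoint hA (k := 1)
  have h2 : ContDiffAt ℝ 1
      (fun A : E →L[ℝ] E => ContinuousLinearMap.adjoint (inverseAdjoint A)) A :=
    (LinearIsometryEquiv.contDiff
      (ContinuousLinearMap.adjoint (𝕜 := ℝ) (E := E) (F := E)) (n := 1)).contDiffAt.comp A h1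
  exact (contDiffAt_abs_det hA).smul (h2.clm_comp h1)

lemma abs_det_linearIsometryEquiv (ρ : E ≃ₗᵢ[ℝ] E) :
    |((ρ : E ≃L[ℝ] E) : E →L[ℝ] E).det| = 1 := by
  have h := ρ.toLinearIsometry.normDet_eq_one
  rw [LinearMap.normDet_eq_abs_det] at h
  exact h

lemma inverseAdjoint_linearIsometryEquiv (ρ : E ≃ₗᵢ[ℝ] E) :
    inverseAdjoint ((ρ : E ≃L[ℝ] E) : E →L[ℝ] E) = ((ρ : E ≃L[ℝ] E) : E →L[ℝ] E) := by
  rw [inverseAdjoint, ContinuousLinearMap.inverse_equiv]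
  exact LinearIsometryEquiv.adjoint_eq_symm ρ.symm

/-- The metric is Euclidean wherever the derivative is an isometry. On the axis this supplies the
constant value needed for slow radial variation. -/
lemma metricDensity_linearIsometryEquiv (ρ : E ≃ₗᵢ[ℝ] E) :
    metricDensity ((ρ : E ≃L[ℝ] E) : E →L[ℝ] E) = ContinuousLinearMap.id ℝ E := by
  rw [metricDensity, abs_det_linearIsometryEquiv, inverseAdjoint_linearIsometryEquiv, one_smul]
  exact (ContinuousLinearMap.norm_map_iff_adjoint_comp_self _).1 ρ.norm_map

end Determinant

/-! ### Coordinates along the curve from a moving reflection. -/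

section TubeMap

variable {E : Type*} [NormedAddCommGroup E] [InnerProductSpace ℝ E] [FiniteDimensional ℝ E]

/-- The reflection exchanging `v` and `e` when these are unit vectors. -/
noncomputable def exchange (e v : E) : E →L[ℝ] E :=
  ContinuousLinearMap.id ℝ E -
    (2 / ‖v - e‖ ^ 2) • (innerSL ℝ (v - e)).smulRight (v - e)

/-- The explicit formula shows smooth dependence on `v`; the reflection supplies isometry and
involutivity. They agree even for `v = e`, where division by zero leaves the identity. -/
lemma exchange_eq_reflection (e v : E) :
    exchange e v = (((ℝ ∙ (v - e))ᗮ.reflection : E ≃L[ℝ] E) : E →L[ℝ] E) := by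
  ext y
  change exchange e v y = (ℝ ∙ (v - e))ᗮ.reflection y
  rw [Submodule.reflection_orthogonal_apply, Submodule.reflection_singleton_apply]
  simp only [exchange, sub_apply, ContinuousLinearMap.id_apply, smul_apply,
    ContinuousLinearMap.smulRight_apply, innerSL_apply_apply, smul_smul, neg_sub]
  rw [two_smul, ← add_smul]
  congr 2
  simp only [RCLike.ofReal_real_eq_id, id_eq]
  ring

lemma exchange_self {e v : E} (he : ‖e‖ = 1) (hv : ‖v‖ = 1) : exchange e v e = v := by
  rw [exchange_eq_reflection]
  change (ℝ ∙ (v - e))ᗮ.reflection e = v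
  have := Submodule.reflection_sub (F := E) (v := v) (w := e) (by rw [he, hv])
  have h2 := Submodule.reflection_reflection (ℝ ∙ (v - e))ᗮ v
  rwa [this] at h2

/-- The formula is singular only at `v = e`, which is why the axis direction is chosen among the
vectors that are not velocities. No Frenet frame, hence no curvature condition, is needed. -/
lemma ContDiff.exchange {v : ℝ → E} {k : WithTop ℕ∞} (hv : ContDiff ℝ k v) {e : E}
    (hne : ∀ t, v t ≠ e) : ContDiff ℝ k fun t => exchange e (v t) := by
  have h1 : ContDiff ℝ k fun t => v t - e := hv.sub contDiff_const
  have h2 : ContDiff ℝ k fun t => 2 / ‖v t - e‖ ^ 2 := by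
    refine contDiff_const.div (h1.norm_sq ℝ) fun t => ?_
    have := norm_pos_iff.2 (sub_ne_zero.2 (hne t))
    positivity
  have h3 : ContDiff ℝ k fun t => innerSL ℝ (v t - e) := (innerSL ℝ).contDiff.comp h1
  exact contDiff_const.sub (h2.smul (h3.smulRight h1))

/-- Fermi-type coordinates along the curve `c` with axis direction `e`. -/
noncomputable def tubeMap (c : ℝ → E) (e : E) (z : E) : E :=
  c (inner ℝ e z) + exchange e (deriv c (inner ℝ e z)) (z - (inner ℝ e z : ℝ) • e)

/-- The straight tube of half-length `L` and radius `ε`. -/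
def straightTube (e : E) (L ε : ℝ) : Set E :=
  {z | |inner ℝ e z| < L ∧ ‖z - (inner ℝ e z : ℝ) • e‖ < ε}

/-- The axis of the straight tube. -/
def tubeAxis (e : E) (L : ℝ) : Set E := (fun t : ℝ => t • e) '' Icc (-L) L

lemma contDiff_tubeMap {c : ℝ → E} (hc : ContDiff ℝ 3 c) {e : E} (hne : ∀ t, deriv c t ≠ e) :
    ContDiff ℝ 2 (tubeMap c e) := by
  have hc' : ContDiff ℝ 2 (deriv c) := by
    have h3 : ContDiff ℝ (2 + 1) c := by
      norm_num at hc ⊢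
      exact hc
    exact (contDiff_succ_iff_deriv.1 h3).2.2
  have hi : ContDiff ℝ 2 fun z : E => (inner ℝ e z : ℝ) := contDiff_const.inner ℝ contDiff_id
  refine ((hc.of_le (by norm_num)).comp hi).add ?_
  exact ((hc'.exchange hne).comp hi).clm_apply (contDiff_id.sub (hi.smul contDiff_const))

/-- On the axis the vector `z - ⟪e, z⟫ e` vanishes, so the derivative of the moving reflection
contributes nothing. What remains acts as the reflection on the complement of `e` and sends `e` to
`c'(t)`, which is also its image under the reflection. -/
lemma fderiv_tubeMap_axis {c : ℝ → E} (hc : ContDiff ℝ 3 c) {e : E} (he : ‖e‖ = 1)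
    (hne : ∀ t, deriv c t ≠ e) {t : ℝ} (ht : ‖deriv c t‖ = 1) :
    fderiv ℝ (tubeMap c e) (t • e) = exchange e (deriv c t) := by
  have hc' : ContDiff ℝ 2 (deriv c) := by
    have h3 : ContDiff ℝ (2 + 1) c := by
      norm_num at hc ⊢
      exact hc
    exact (contDiff_succ_iff_deriv.1 h3).2.2
  have hin : inner ℝ e (t • e) = t := by
    rw [real_inner_smul_right, real_inner_self_eq_norm_sq, he]; ring
  have hi : HasFDerivAt (fun z : E => (inner ℝ e z : ℝ)) (innerSL ℝ e) (t • e) :=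
    (innerSL ℝ e).hasFDerivAt
  have h1 : HasFDerivAt (fun z : E => c (inner ℝ e z))
      ((innerSL ℝ e).smulRight (deriv c t)) (t • e) := by
    have := (hc.differentiable (by norm_num) (inner ℝ e (t • e))).hasDerivAt.hasFDerivAt.comp
      (t • e) hi
    rw [hin] at this
    have e1 : (innerSL ℝ e).smulRight (deriv c t) =
        (ContinuousLinearMap.toSpanSingleton ℝ (deriv c t)).comp (innerSL ℝ e) := by
      ext v
      simp
    rw [e1]
    exact this
  have h2 : DifferentiableAt ℝ (fun z : E => exchange e (deriv c (inner ℝ e z))) (t • e) := by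
    have h := (hc'.exchange hne).differentiable (by norm_num) (inner ℝ e (t • e))
    exact h.comp (t • e) hi.differentiableAt
  have h3 : HasFDerivAt (fun z : E => z - (inner ℝ e z : ℝ) • e)
      (ContinuousLinearMap.id ℝ E - (innerSL ℝ e).smulRight e) (t • e) :=
    (hasFDerivAt_id _).fun_sub (hi.smul_const e)
  have h4 := h1.add (h2.hasFDerivAt.clm_apply h3)
  have h5 : HasFDerivAt (tubeMap c e) _ (t • e) := h4
  rw [h5.fderiv]
  ext v
  simp [hin, exchange_self he ht]

lemma tubeMap_smul (c : ℝ → E) {e : E} (he : ‖e‖ = 1) (t : ℝ) : tubeMap c e (t • e) = c t := by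
  have hin : inner ℝ e (t • e) = t := by
    rw [real_inner_smul_right, real_inner_self_eq_norm_sq, he]; ring
  simp [tubeMap, hin]

lemma isCompact_tubeAxis (e : E) (L : ℝ) : IsCompact (tubeAxis e L) :=
  isCompact_Icc.image (by fun_prop)

lemma isOpen_straightTube (e : E) (L ε : ℝ) : IsOpen (straightTube e L ε) := by
  have h1 : Continuous fun z : E => (inner ℝ e z : ℝ) := by fun_prop
  exact (isOpen_lt h1.abs continuous_const).inter
    (isOpen_lt (continuous_id.sub (h1.smul continuous_const)).norm continuous_const)

lemma isBounded_straightTube {e : E} (he : ‖e‖ = 1) (L ε : ℝ) :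
    Bornology.IsBounded (straightTube e L ε) := by
  rw [isBounded_iff_forall_norm_le]
  refine ⟨ε + L, fun z hz => ?_⟩
  have h1 : z = (z - (inner ℝ e z : ℝ) • e) + (inner ℝ e z : ℝ) • e := by abel
  rw [h1]
  refine (norm_add_le _ _).trans (add_le_add hz.2.le ?_)
  rw [norm_smul, he, mul_one, Real.norm_eq_abs]
  exact hz.1.le

lemma smul_mem_straightTube {e : E} {L ε : ℝ} {z : E} (hz : z ∈ straightTube e L ε) {s : ℝ}
    (hs : s ∈ Icc (0 : ℝ) 1) : s • z ∈ straightTube e L ε := by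
  constructor
  · rw [real_inner_smul_right, abs_mul, abs_of_nonneg hs.1]
    exact (mul_le_of_le_one_left (abs_nonneg _) hs.2).trans_lt hz.1
  · rw [real_inner_smul_right, mul_smul, ← smul_sub, norm_smul, Real.norm_eq_abs,
      abs_of_nonneg hs.1]
    exact (mul_le_of_le_one_left (norm_nonneg _) hs.2).trans_lt hz.2

lemma smul_mem_tubeAxis {e : E} {L : ℝ} {z : E} (hz : z ∈ tubeAxis e L) {s : ℝ}
    (hs : s ∈ Icc (0 : ℝ) 1) : s • z ∈ tubeAxis e L := by
  obtain ⟨t, ht, rfl⟩ := hz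
  refine ⟨s * t, ?_, mul_smul s t e⟩
  rw [mem_Icc, ← abs_le] at ht ⊢
  rw [abs_mul, abs_of_nonneg hs.1]
  exact (mul_le_of_le_one_left (abs_nonneg _) hs.2).trans ht

lemma exists_straightTube_subset {e : E} {L : ℝ} {U : Set E} (hU : IsOpen U)
    (h : tubeAxis e L ⊆ U) : ∃ ε₀ : ℝ, 0 < ε₀ ∧ ∀ ε ≤ ε₀, straightTube e L ε ⊆ U := by
  obtain ⟨δ, hδ, hsub⟩ := (isCompact_tubeAxis e L).exists_thickening_subset_open hU h
  refine ⟨δ, hδ, fun ε hε z hz => hsub ?_⟩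
  rw [Metric.mem_thickening_iff]
  refine ⟨(inner ℝ e z : ℝ) • e, ⟨_, ?_, rfl⟩, ?_⟩
  · rw [mem_Icc, ← abs_le]; exact hz.1.le
  · rw [dist_eq_norm]; exact hz.2.trans_le hε

/-- The reflection is an isometry exchanging `e` and `c'(t)`, so it carries the disc normal to `e`
onto the disc normal to the curve. -/
lemma image_tubeMap_straightTube {c : ℝ → E} {e : E} (he : ‖e‖ = 1) {L : ℝ}
    (hc : ∀ t ∈ Icc (-L) L, ‖deriv c t‖ = 1) (ε : ℝ) :
    tubeMap c e '' straightTube e L ε = {x | ∃ t ∈ Ioo (-L) L, ∃ ξ : E,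
      inner ℝ ξ (deriv c t) = 0 ∧ ‖ξ‖ < ε ∧ x = c t + ξ} := by
  have hnorm : ∀ v y : E, ‖exchange e v y‖ = ‖y‖ := fun v y => by
    rw [exchange_eq_reflection]
    exact LinearIsometryEquiv.norm_map _ y
  have hinv : ∀ v y : E, exchange e v (exchange e v y) = y := fun v y => by
    rw [exchange_eq_reflection]
    exact Submodule.reflection_reflection _ y
  have hinner : ∀ v x y : E, inner ℝ (exchange e v x) (exchange e v y) = inner ℝ x y :=
    fun v x y => by
      rw [exchange_eq_reflection]
      exact LinearIsometryEquiv.inner_map_map _ x y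
  have hee : inner ℝ e e = 1 := by rw [real_inner_self_eq_norm_sq, he]; norm_num
  ext x
  constructor
  · rintro ⟨z, hz, rfl⟩
    have ht : inner ℝ e z ∈ Ioo (-L) L := abs_lt.1 hz.1
    refine ⟨inner ℝ e z, ht, _, ?_, ?_, rfl⟩
    · have := hinner (deriv c (inner ℝ e z)) (z - (inner ℝ e z : ℝ) • e) e
      rw [exchange_self he (hc _ (Ioo_subset_Icc_self ht))] at this
      rw [this, inner_sub_left,
        real_inner_smul_left, hee, real_inner_comm, mul_one, sub_self]
    · rw [hnorm]; exact hz.2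
  · rintro ⟨t, ht, ξ, h1, h2, rfl⟩
    have hct := hc t (Ioo_subset_Icc_self ht)
    set y := exchange e (deriv c t) ξ with hy
    have hey : inner ℝ e y = 0 := by
      rw [← hinv (deriv c t) e, exchange_self he hct, hy, hinner, real_inner_comm, h1]
    have hz : inner ℝ e (t • e + y) = t := by
      rw [inner_add_right, hey, real_inner_smul_right, hee]; ring
    refine ⟨t • e + y, ⟨?_, ?_⟩, ?_⟩
    · rw [hz]; exact abs_lt.2 ht
    · rw [hz, add_sub_cancel_left, hy, hnorm]; exact h2
    · simp only [tubeMap]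
      rw [hz, add_sub_cancel_left, hy, hinv]

end TubeMap

/-! ### Thin tubes are controlled under dilations. -/

section TubeControl

variable {E : Type*} [NormedAddCommGroup E] [InnerProductSpace ℝ E] [FiniteDimensional ℝ E]
  [MeasurableSpace E] [BorelSpace E]

/-- Near the axis the metric of the tube coordinates is controlled under dilations. -/
lemma exists_dilationControl {e : E} (he : ‖e‖ = 1) {L : ℝ} {X : E → E}
    (hX : ContDiff ℝ 2 X)
    (haxis : ∀ z ∈ tubeAxis e L, ∃ ρ : E ≃ₗᵢ[ℝ] E, fderiv ℝ X z = ((ρ : E ≃L[ℝ] E) : E →L[ℝ] E))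
    (hinj : InjOn X (tubeAxis e L)) {η : ℝ} (hη : 0 < η) :
    ∃ ε₀ : ℝ, 0 < ε₀ ∧ ∀ ε ≤ ε₀, InjOn X (straightTube e L ε) ∧
      (∀ z ∈ straightTube e L ε, (fderiv ℝ X z).det ≠ 0) ∧
      DilationControl (straightTube e L ε) (fun z => inverseAdjoint (fderiv ℝ X z))
        (fun z => |(fderiv ℝ X z).det|) η := by
  have hXc : Continuous (fderiv ℝ X) := hX.continuous_fderiv (by norm_num)
  have hX' : ContDiff ℝ 1 (fderiv ℝ X) := hX.fderiv_right (by norm_num)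
  have hdetc : Continuous fun z => (fderiv ℝ X z).det :=
    ContinuousLinearMap.continuous_det.comp hXc
  set U : Set E := {z | (fderiv ℝ X z).det ≠ 0} with hUdef
  have hU : IsOpen U := isOpen_ne_fun hdetc continuous_const
  have hKU : tubeAxis e L ⊆ U := fun z hz => by
    obtain ⟨ρ, hρ⟩ := haxis z hz
    have := abs_det_linearIsometryEquiv ρ
    change (fderiv ℝ X z).det ≠ 0
    rw [hρ]
    intro h0
    rw [h0, abs_zero] at this
    exact zero_ne_one this
  have hK : ∀ z ∈ tubeAxis e L, ∀ s ∈ Icc (0 : ℝ) 1, s • z ∈ tubeAxis e L :=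
    fun z hz s hs => smul_mem_tubeAxis hz hs
  -- The bound `1 / 2` keeps the density and the metric form between `1 / 2` and `3 / 2` of their
  -- Euclidean values. The bound `η / 2` then turns absolute variation `δ (l - 1)` into relative
  -- variation `η (l - 1)`.
  set δ : ℝ := min (1 / 2) (η / 2) with hδ
  have hδ0 : 0 < δ := by positivity
  have hδ1 : δ ≤ 1 / 2 := min_le_left _ _
  have hδ2 : δ ≤ η / 2 := min_le_right _ _
  have hJ1 : ContDiffOn ℝ 1 (fun z => |(fderiv ℝ X z).det|) U := fun z hz =>
    ((contDiffAt_abs_det hz).comp z hX'.contDiffAt).contDiffWithinAt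
  have hS1 : ContDiffOn ℝ 1 (fun z => metricDensity (fderiv ℝ X z)) U := fun z hz =>
    ((contDiffAt_metricDensity hz).comp z hX'.contDiffAt).contDiffWithinAt
  obtain ⟨U₁, hU₁, hKU₁, hU₁U, hJn, hJv⟩ := exists_open_radial_variation hU hKU hJ1 hK
    (S₀ := 1) (fun z hz => by
      obtain ⟨ρ, hρ⟩ := haxis z hz
      rw [hρ]; exact abs_det_linearIsometryEquiv ρ) hδ0
  obtain ⟨U₂, hU₂, hKU₂, hU₂U, hSn, hSv⟩ := exists_open_radial_variation hU hKU hS1 hK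
    (S₀ := ContinuousLinearMap.id ℝ E) (fun z hz => by
      obtain ⟨ρ, hρ⟩ := haxis z hz
      rw [hρ]; exact metricDensity_linearIsometryEquiv ρ) hδ0
  -- Local injectivity comes from the inverse function theorem. With injectivity on the compact axis
  -- it yields injectivity on a neighbourhood of the whole axis.
  have hloc : ∀ z ∈ tubeAxis e L, ∃ u ∈ 𝓝 z, InjOn X u := by
    intro z hz
    have hs : HasStrictFDerivAt X
        (((fderiv ℝ X z).toContinuousLinearEquivOfDetNeZero (hKU hz) : E ≃L[ℝ] E) : E →L[ℝ] E)
        z := by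
      rw [ContinuousLinearMap.coe_toContinuousLinearEquivOfDetNeZero]
      exact hX.contDiffAt.hasStrictFDerivAt (by norm_num)
    refine ⟨(hs.toOpenPartialHomeomorph X).source, ?_, ?_⟩
    · exact (hs.toOpenPartialHomeomorph X).open_source.mem_nhds
        hs.mem_toOpenPartialHomeomorph_source
    · exact (hs.toOpenPartialHomeomorph X).injOn
  obtain ⟨N, hN, hNinj⟩ := hinj.exists_mem_nhdsSet (isCompact_tubeAxis e L)
    (fun z _ => hX.continuous.continuousAt) hloc
  obtain ⟨U₃, hU₃, hKU₃, hU₃N⟩ := mem_nhdsSet_iff_exists.1 hN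
  obtain ⟨ε₀, hε₀, hsub⟩ := exists_straightTube_subset ((hU₁.inter hU₂).inter hU₃)
    (subset_inter (subset_inter hKU₁ hKU₂) hKU₃)
  refine ⟨ε₀, hε₀, fun ε hε => ?_⟩
  set Q := straightTube e L ε with hQ
  have hQ1 : Q ⊆ U₁ := fun z hz => (hsub ε hε hz).1.1
  have hQ2 : Q ⊆ U₂ := fun z hz => (hsub ε hε hz).1.2
  have hQ3 : Q ⊆ N := fun z hz => hU₃N (hsub ε hε hz).2
  have hQU : Q ⊆ U := hQ1.trans hU₁U
  have hstar : ∀ z ∈ Q, ∀ s ∈ Icc (0 : ℝ) 1, s • z ∈ Q := fun z hz s hs =>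
    smul_mem_straightTube hz hs
  have hJb : ∀ z ∈ Q, 1 / 2 ≤ |(fderiv ℝ X z).det| ∧ |(fderiv ℝ X z).det| ≤ 3 / 2 := by
    intro z hz
    have := hJn z (hQ1 hz)
    rw [Real.norm_eq_abs, abs_lt] at this
    constructor <;> linarith [this.1, this.2]
  have hquad : ∀ z ∈ Q, ∀ v, |inner ℝ (metricDensity (fderiv ℝ X z) v) v - ‖v‖ ^ 2| ≤
      1 / 2 * ‖v‖ ^ 2 := by
    intro z hz v
    have h1 : inner ℝ (metricDensity (fderiv ℝ X z) v) v - ‖v‖ ^ 2 =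
        inner ℝ ((metricDensity (fderiv ℝ X z) - ContinuousLinearMap.id ℝ E) v) v := by
      rw [sub_apply, inner_sub_left, ContinuousLinearMap.id_apply, real_inner_self_eq_norm_sq]
    rw [h1]
    calc _ ≤ ‖(metricDensity (fderiv ℝ X z) - ContinuousLinearMap.id ℝ E) v‖ * ‖v‖ :=
          abs_real_inner_le_norm _ _
      _ ≤ (‖metricDensity (fderiv ℝ X z) - ContinuousLinearMap.id ℝ E‖ * ‖v‖) * ‖v‖ := by
          gcongr
          exact ContinuousLinearMap.le_opNorm _ _
      _ ≤ (1 / 2 * ‖v‖) * ‖v‖ := by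
          gcongr
          exact (hSn z (hQ2 hz)).le.trans hδ1
      _ = 1 / 2 * ‖v‖ ^ 2 := by ring
  have hB : ∀ z ∈ Q, ∀ v, 1 / 2 * ‖v‖ ^ 2 ≤
      |(fderiv ℝ X z).det| * ‖inverseAdjoint (fderiv ℝ X z) v‖ ^ 2 ∧
      |(fderiv ℝ X z).det| * ‖inverseAdjoint (fderiv ℝ X z) v‖ ^ 2 ≤ 3 / 2 * ‖v‖ ^ 2 := by
    intro z hz v
    have := abs_le.1 (hquad z hz v)
    rw [inner_metricDensity] at this
    constructor <;> linarith [this.1, this.2]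
  refine ⟨hNinj.mono hQ3, fun z hz => hQU hz, ?_⟩
  refine ⟨isOpen_straightTube e L ε, isBounded_straightTube he L ε, ?_, ?_, ?_, ?_, ?_, ?_, ?_,
    ?_, ?_, ?_⟩
  · intro z hz l hl
    exact hstar z hz _ ⟨inv_nonneg.2 (by linarith), inv_le_one_of_one_le₀ hl⟩
  · intro z hz
    have h1 : ContinuousAt inverseAdjoint (fderiv ℝ X z) :=
      (contDiffAt_inverseAdjoint (hQU hz) (k := 0)).continuousAt
    exact (h1.comp hXc.continuousAt).continuousWithinAt
  · exact hdetc.abs.continuousOn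
  · exact hdetc.abs.measurable
  · exact ⟨1 / 2, by norm_num, fun z hz => (hJb z hz).1⟩
  · exact ⟨3 / 2, fun z hz => (hJb z hz).2⟩
  -- The bounds on `J ‖B v‖²` and on `J` give `‖v‖² / 3 ≤ ‖B v‖² ≤ 3 ‖v‖²`; the constants `1 / 2`
  -- here and `2` below are rounded from these.
  · refine ⟨1 / 2, by norm_num, fun z hz v => ?_⟩
    have h1 := (hB z hz v).1
    have h2 := (hJb z hz).2
    refine abs_le_of_sq_le_sq' ?_ (norm_nonneg _) |>.2
    nlinarith [sq_nonneg ‖inverseAdjoint (fderiv ℝ X z) v‖, sq_nonneg ‖v‖]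
  · refine ⟨2, fun z hz => ContinuousLinearMap.opNorm_le_bound _ (by norm_num) fun v => ?_⟩
    have h1 := (hB z hz v).2
    have h2 := (hJb z hz).1
    refine abs_le_of_sq_le_sq' ?_ (by positivity) |>.2
    nlinarith [sq_nonneg ‖inverseAdjoint (fderiv ℝ X z) v‖, sq_nonneg ‖v‖]
  · intro z hz l hl
    have hl0 : 0 < l - 1 := by linarith [hl.1]
    intro v
    have h1 := hSv z (fun s hs => hQ2 (hstar z hz s hs)) l hl
    have h2 : inner ℝ (metricDensity (fderiv ℝ X (l⁻¹ • z)) v) v -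
        inner ℝ (metricDensity (fderiv ℝ X z) v) v ≤ δ * (l - 1) * ‖v‖ ^ 2 := by
      rw [← inner_sub_left, ← sub_apply]
      calc _ ≤ ‖(metricDensity (fderiv ℝ X (l⁻¹ • z)) - metricDensity (fderiv ℝ X z)) v‖ * ‖v‖ :=
            real_inner_le_norm _ _
        _ ≤ (‖metricDensity (fderiv ℝ X (l⁻¹ • z)) - metricDensity (fderiv ℝ X z)‖ * ‖v‖) *
            ‖v‖ := by
            gcongr
            exact ContinuousLinearMap.le_opNorm _ _
        _ ≤ (δ * (l - 1) * ‖v‖) * ‖v‖ := by gcongr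
        _ = _ := by ring
    rw [inner_metricDensity, inner_metricDensity] at h2
    have h3 := (hB z hz v).1
    have h4 : δ * (l - 1) * ‖v‖ ^ 2 ≤ η * (l - 1) * (1 / 2 * ‖v‖ ^ 2) := by
      have : δ * ((l - 1) * ‖v‖ ^ 2) ≤ η / 2 * ((l - 1) * ‖v‖ ^ 2) :=
        mul_le_mul_of_nonneg_right hδ2 (by positivity)
      linarith
    have h5 : η * (l - 1) * (1 / 2 * ‖v‖ ^ 2) ≤ η * (l - 1) *
        (|(fderiv ℝ X z).det| * ‖inverseAdjoint (fderiv ℝ X z) v‖ ^ 2) :=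
      mul_le_mul_of_nonneg_left h3 (by positivity)
    linarith
  · intro z hz l hl
    have hl0 : 0 < l - 1 := by linarith [hl.1]
    have h1 := hJv z (fun s hs => hQ1 (hstar z hz s hs)) l hl
    rw [Real.norm_eq_abs] at h1
    have h2 := (abs_le.1 h1).1
    have h3 := (hJb z hz).1
    have h4 : δ * (l - 1) ≤ η / 2 * (l - 1) := mul_le_mul_of_nonneg_right hδ2 hl0.le
    have h5 : η * (l - 1) * (1 / 2) ≤ η * (l - 1) * |(fderiv ℝ X z).det| :=
      mul_le_mul_of_nonneg_left h3 (by positivity)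
    linarith

end TubeControl

/-! ### Transfer of the weak equation through the coordinates. -/

section Transfer

variable {E : Type*} [NormedAddCommGroup E] [InnerProductSpace ℝ E] [FiniteDimensional ℝ E]

lemma IsC1Test.of_isCompact {Ω K : Set E} {φ : E → ℝ} (hΩ : IsOpen Ω) (hK : IsCompact K)
    (hKΩ : K ⊆ Ω) (hφ : ContDiffOn ℝ 1 φ Ω) (h0 : ∀ x, x ∉ K → φ x = 0) : IsC1Test Ω φ := by
  have hsupp : tsupport φ ⊆ K := by
    apply closure_minimal _ hK.isClosed
    intro x hx
    by_contra hx'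
    exact hx (h0 x hx')
  refine ⟨contDiff_iff_contDiffAt.2 fun x => ?_, hK.of_isClosed_subset isClosed_closure hsupp,
    hsupp.trans hKΩ⟩
  by_cases hx : x ∈ K
  · exact hφ.contDiffAt (hΩ.mem_nhds (hKΩ hx))
  · have : φ =ᶠ[𝓝 x] fun _ => 0 := by
      filter_upwards [hK.isClosed.isOpen_compl.mem_nhds hx] with y hy using h0 y hy
    exact contDiffAt_const.congr_of_eventuallyEq this

/-- The support becomes the image of a compact set under the inverse homeomorphism, hence a compact
subset of the source, so extension by zero remains `C¹`. -/
lemma IsC1Test.indicator_comp {φ : E → ℝ} (e : OpenPartialHomeomorph E E)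
    (he : ContDiffOn ℝ 1 e e.source) (hφ : IsC1Test e.target φ) :
    IsC1Test e.source (e.source.indicator fun z => φ (e z)) := by
  have hK : IsCompact (e.symm '' tsupport φ) :=
    hφ.compact.isCompact.image_of_continuousOn (e.continuousOn_symm.mono hφ.support)
  refine IsC1Test.of_isCompact e.open_source hK ?_ ?_ ?_
  · rintro _ ⟨x, hx, rfl⟩
    exact e.map_target (hφ.support hx)
  · exact (hφ.contDiff.comp_contDiffOn he).congr fun z hz => by
      rw [indicator_of_mem hz]; rfl
  · intro z hz
    by_cases hzs : z ∈ e.source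
    · rw [indicator_of_mem hzs]
      apply image_eq_zero_of_notMem_tsupport
      intro h
      exact hz ⟨e z, h, e.left_inv hzs⟩
    · rw [indicator_of_notMem hzs]

/-- By the chain rule `∇(φ ∘ X) = dXᵀ (∇φ ∘ X)`, and `inverseAdjoint` undoes the transpose. -/
lemma inverseAdjoint_gradient_comp {X : E → E} {φ : E → ℝ} {z : E}
    (hX : DifferentiableAt ℝ X z) (hdet : (fderiv ℝ X z).det ≠ 0)
    (hφ : DifferentiableAt ℝ φ (X z)) :
    inverseAdjoint (fderiv ℝ X z) (gradient (fun y => φ (X y)) z) = gradient φ (X z) := by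
  have h1 : fderiv ℝ (fun y => φ (X y)) z = (fderiv ℝ φ (X z)).comp (fderiv ℝ X z) :=
    fderiv_comp z hφ hX
  have hinv : (fderiv ℝ X z).IsInvertible :=
    ⟨(fderiv ℝ X z).toContinuousLinearEquivOfDetNeZero hdet,
      ContinuousLinearMap.coe_toContinuousLinearEquivOfDetNeZero _ hdet⟩
  refine ext_inner_right ℝ fun v => ?_
  rw [inverseAdjoint, ContinuousLinearMap.adjoint_inner_left, inner_gradient_left,
    inner_gradient_left, h1, ContinuousLinearMap.comp_apply]
  have := congrArg (fun A : E →L[ℝ] E => A v) hinv.self_comp_inverse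
  simp only [ContinuousLinearMap.comp_apply, ContinuousLinearMap.id_apply] at this
  rw [this]

/-- A `C¹` map which is injective on an open set with invertible derivative, as a partial
homeomorphism with `C¹` inverse. -/
lemma exists_openPartialHomeomorph {X : E → E} (hX : ContDiff ℝ 1 X) {Q : Set E} (hQ : IsOpen Q)
    (hinj : InjOn X Q) (hdet : ∀ z ∈ Q, (fderiv ℝ X z).det ≠ 0) :
    ∃ e : OpenPartialHomeomorph E E, (e : E → E) = X ∧ e.source = Q ∧ e.target = X '' Q ∧
      ContDiffOn ℝ 1 e.symm e.target := by
  have hs : ∀ z (hz : z ∈ Q), HasStrictFDerivAt X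
      (((fderiv ℝ X z).toContinuousLinearEquivOfDetNeZero (hdet z hz) : E ≃L[ℝ] E) : E →L[ℝ] E)
      z := by
    intro z hz
    rw [ContinuousLinearMap.coe_toContinuousLinearEquivOfDetNeZero]
    exact hX.contDiffAt.hasStrictFDerivAt (by norm_num)
  let p : PartialEquiv E E := hinj.toPartialEquiv
  have hopen : IsOpenMap (Q.domRestrict X) := by
    rw [isOpenMap_iff_nhds_le]
    rintro ⟨z, hz⟩
    have h1 := (hs z hz).map_nhds_eq_of_equiv
    change 𝓝 (X z) ≤ map (fun y : Q => X y) (𝓝 ⟨z, hz⟩)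
    rw [← h1, ← hQ.nhdsWithin_eq hz, nhdsWithin_eq_map_subtype_coe hz, Filter.map_map]
    rfl
  let e := OpenPartialHomeomorph.ofContinuousOpenRestrict p hX.continuous.continuousOn hopen hQ
  refine ⟨e, rfl, rfl, rfl, ?_⟩
  intro x hx
  have hz : e.symm x ∈ Q := e.map_target hx
  exact (e.contDiffAt_symm hx (hs _ hz).hasFDerivAt hX.contDiffAt).contDiffWithinAt

variable [MeasurableSpace E] [BorelSpace E]

/-- The energy of a bounded weak solution in the image of a controlled domain vanishes. -/
theorem ae_gradient_eq_zero_of_dilationControl {X : E → E} (hX : ContDiff ℝ 1 X) {Q : Set E}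
    {η : ℝ} (hinj : InjOn X Q) (hdet : ∀ z ∈ Q, (fderiv ℝ X z).det ≠ 0)
    (h : DilationControl Q (fun z => inverseAdjoint (fderiv ℝ X z))
      (fun z => |(fderiv ℝ X z).det|) η) {p : ℝ} (hp : 0 < p) (hη : 0 ≤ η)
    (hpη : ((Module.finrank ℝ E : ℝ) + η) / p < ((Module.finrank ℝ E : ℝ) - 2 - η) / 2)
    {f : ℝ → ℝ} (hf : Continuous f)
    (hfp : ∀ t : ℝ, p * (∫ τ in (0 : ℝ)..t, f τ) ≤ t * f t ∧ 0 ≤ p * ∫ τ in (0 : ℝ)..t, f τ)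
    {u : E → ℝ} {G : E → E} {M : ℝ} (hM : 0 ≤ M)
    (hu : AEStronglyMeasurable u (volume.restrict (X '' Q)))
    (huM : ∀ᵐ x ∂(volume.restrict (X '' Q)), |u x| ≤ M)
    (hG : MemLp G 2 (volume.restrict (X '' Q)))
    (hweak : ∀ φ : E → ℝ, IsC1Test (X '' Q) φ →
      ∫ x in X '' Q, inner ℝ (G x) (gradient φ x) = ∫ x in X '' Q, f (u x) * φ x)
    {φ : ℕ → E → ℝ} (hφ : ∀ k, IsC1Test (X '' Q) (φ k))
    (hlim0 : Tendsto (fun k => eLpNorm (fun x => φ k x - u x) 2 (volume.restrict (X '' Q)))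
      atTop (𝓝 0))
    (hlim : Tendsto (fun k => eLpNorm (fun x => gradient (φ k) x - G x) 2
      (volume.restrict (X '' Q))) atTop (𝓝 0)) :
    ∀ᵐ x ∂(volume.restrict (X '' Q)), G x = 0 := by
  set J : E → ℝ := fun z => |(fderiv ℝ X z).det| with hJ
  set B : E → E →L[ℝ] E := fun z => inverseAdjoint (fderiv ℝ X z) with hB
  set Ω := X '' Q with hΩ
  have hXd : Differentiable ℝ X := hX.differentiable (by norm_num)
  obtain ⟨e, heX, hes, het, hesymm⟩ := exists_openPartialHomeomorph hX h.isOpen hinj hdet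
  -- The change of variables formula in measure form: `L²` norms and integrals then transfer without
  -- further Jacobians.
  have hmp : MeasurePreserving X (densityMeasure Q J) (volume.restrict Ω) := by
    refine ⟨hX.continuous.measurable, ?_⟩
    exact map_withDensity_abs_det_fderiv_eq_addHaar volume
      h.measurableSet.nullMeasurableSet (fun z _ => (hXd z).hasFDerivAt.hasFDerivWithinAt) hinj
  have hmapInt : ∀ g : E → ℝ, AEStronglyMeasurable g (volume.restrict Ω) →
      ∫ x in Ω, g x = ∫ z, g (X z) ∂(densityMeasure Q J) := by
    intro g hg
    rw [← hmp.map_eq] at hg ⊢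
    exact integral_map hX.continuous.aemeasurable hg
  have hgradQ : ∀ {ψ : E → ℝ} {ω : E → ℝ}, Differentiable ℝ ψ → (∀ z ∈ Q, ω z = ψ (X z)) →
      ∀ z ∈ Q, B z (gradient ω z) = gradient ψ (X z) := by
    intro ψ ω hψ hω z hz
    rw [← inverseAdjoint_gradient_comp (hXd z) (hdet z hz) (hψ _)]
    have : ω =ᶠ[𝓝 z] fun y => ψ (X y) := by
      filter_upwards [h.isOpen.mem_nhds hz] with y hy using hω y hy
    rw [hB, gradient, gradient, this.fderiv_eq]
  set ω : ℕ → E → ℝ := fun k => Q.indicator fun z => φ k (X z) with hω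
  have hωt : ∀ k, IsC1Test Q (ω k) := by
    intro k
    have := IsC1Test.indicator_comp (φ := φ k) e (by rw [heX]; exact hX.contDiffOn)
      (by rw [het]; exact hφ k)
    rwa [hes, heX] at this
  have hωQ : ∀ k, ∀ z ∈ Q, ω k z = φ k (X z) := fun k z hz => by
    simp only [hω, indicator_of_mem hz]
  have hweak' : ∀ ψ : E → ℝ, IsC1Test Q ψ →
      ∫ z, inner ℝ (G (X z)) (B z (gradient ψ z)) ∂(densityMeasure Q J) =
        ∫ z, f (u (X z)) * ψ z ∂(densityMeasure Q J) := by
    intro ψ hψ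
    -- A test function on `Q` is carried to `Ω` by the inverse map. That map is only known here to
    -- be `C¹`, hence the use of `C¹` test functions throughout.
    have hχ : IsC1Test Ω (Ω.indicator fun x => ψ (e.symm x)) := by
      have := IsC1Test.indicator_comp (φ := ψ) e.symm hesymm (by
        rw [OpenPartialHomeomorph.symm_target, hes]; exact hψ)
      rwa [OpenPartialHomeomorph.symm_source, het] at this
    set χ := Ω.indicator fun x => ψ (e.symm x) with hχd
    have hχX : ∀ z ∈ Q, ψ z = χ (X z) := fun z hz => by
      rw [hχd, indicator_of_mem (mem_image_of_mem X hz), ← heX, e.left_inv (by rwa [hes])]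
    have h1 := hweak χ hχ
    rw [hmapInt _ (hG.1.inner hχ.continuous_gradient.aestronglyMeasurable),
      hmapInt (fun x => f (u x) * χ x) ((hf.comp_aestronglyMeasurable hu).mul
        hχ.contDiff.continuous.aestronglyMeasurable)] at h1
    refine Eq.trans (integral_congr_ae ?_) (h1.trans (integral_congr_ae ?_))
    · filter_upwards [h.ae_mem] with z hz
      rw [hgradQ hχ.differentiable hχX z hz]
    · filter_upwards [h.ae_mem] with z hz
      rw [hχX z hz]
  have hfinal := h.ae_eq_zero hp hη hpη hf hfp (w := fun z => u (X z)) (H := fun z => G (X z))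
    (hu.comp_measurePreserving hmp) hM (hmp.quasiMeasurePreserving.ae huM)
    (hG.comp_measurePreserving hmp) hweak' hωt ?_ ?_
  · have hz : (fun z => G (X z)) =ᵐ[densityMeasure Q J] 0 := hfinal
    have h1 : eLpNorm (G ∘ X) 2 (densityMeasure Q J) = 0 := by
      rw [eLpNorm_eq_zero_iff (hG.comp_measurePreserving hmp).1 (by norm_num)]
      exact hz
    rw [eLpNorm_comp_measurePreserving hG.1 hmp, eLpNorm_eq_zero_iff hG.1 (by norm_num)] at h1
    exact h1
  · refine hlim0.congr fun k => ?_
    rw [← eLpNorm_comp_measurePreserving (g := fun x => φ k x - u x)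
      (((hφ k).contDiff.continuous.aestronglyMeasurable).sub hu)
      hmp]
    apply eLpNorm_congr_ae
    filter_upwards [h.ae_mem] with z hz
    simp [hωQ k z hz]
  · refine hlim.congr fun k => ?_
    rw [← eLpNorm_comp_measurePreserving (g := fun x => gradient (φ k) x - G x)
      ((hφ k).continuous_gradient.aestronglyMeasurable.sub hG.1)
      hmp]
    apply eLpNorm_congr_ae
    filter_upwards [h.ae_mem] with z hz
    change gradient (φ k) (X z) - G (X z) = _
    rw [← hgradQ (hφ k).differentiable (hωQ k) z hz]

end Transfer

/-! ### Truncations of the identity near zero. -/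

section SmoothCutoff

/-- The derivative of the truncation `cutoff k`. -/
noncomputable def cutoffDeriv (k : ℕ) (t : ℝ) : ℝ := min 1 (max 0 (((k : ℝ) + 1) * |t| - 1))

/-- A `C¹` truncation vanishing for `|t| ≤ 1 / (k + 1)`, converging to the identity. -/
noncomputable def cutoff (k : ℕ) (t : ℝ) : ℝ := ∫ s in (0 : ℝ)..t, cutoffDeriv k s

lemma continuous_cutoffDeriv (k : ℕ) : Continuous (cutoffDeriv k) := by
  unfold cutoffDeriv; fun_prop

lemma cutoffDeriv_nonneg (k : ℕ) (t : ℝ) : 0 ≤ cutoffDeriv k t :=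
  le_min zero_le_one (le_max_left _ _)

lemma cutoffDeriv_le_one (k : ℕ) (t : ℝ) : cutoffDeriv k t ≤ 1 := min_le_left _ _

lemma cutoffDeriv_eq_zero {k : ℕ} {t : ℝ} (ht : |t| ≤ 1 / ((k : ℝ) + 1)) :
    cutoffDeriv k t = 0 := by
  have : ((k : ℝ) + 1) * |t| ≤ 1 := by
    rw [le_div_iff₀ (by positivity)] at ht; linarith
  rw [cutoffDeriv, max_eq_left (by linarith), min_eq_right zero_le_one]

lemma tendsto_cutoffDeriv {t : ℝ} (ht : t ≠ 0) :
    Tendsto (fun k => cutoffDeriv k t) atTop (𝓝 1) := by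
  have h1 : Tendsto (fun k : ℕ => ((k : ℝ) + 1) * |t|) atTop atTop :=
    (tendsto_natCast_atTop_atTop.atTop_add tendsto_const_nhds).atTop_mul_const (abs_pos.2 ht)
  refine tendsto_const_nhds.congr' ?_
  filter_upwards [h1.eventually_ge_atTop 2] with k hk
  rw [cutoffDeriv, max_eq_right (by linarith), min_eq_left (by linarith)]

lemma hasDerivAt_cutoff (k : ℕ) (t : ℝ) : HasDerivAt (cutoff k) (cutoffDeriv k t) t :=
  intervalIntegral.integral_hasDerivAt_right ((continuous_cutoffDeriv k).intervalIntegrable _ _)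
    ((continuous_cutoffDeriv k).stronglyMeasurableAtFilter _ _)
    (continuous_cutoffDeriv k).continuousAt

lemma contDiff_cutoff (k : ℕ) : ContDiff ℝ 1 (cutoff k) := by
  rw [contDiff_one_iff_deriv]
  refine ⟨fun t => (hasDerivAt_cutoff k t).differentiableAt, ?_⟩
  rw [show deriv (cutoff k) = cutoffDeriv k from funext fun t => (hasDerivAt_cutoff k t).deriv]
  exact continuous_cutoffDeriv k

lemma cutoff_eq_zero {k : ℕ} {t : ℝ} (ht : |t| ≤ 1 / ((k : ℝ) + 1)) : cutoff k t = 0 := by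
  rw [cutoff, intervalIntegral.integral_congr (g := fun _ => 0)]
  · simp
  · intro s hs
    apply cutoffDeriv_eq_zero
    refine le_trans ?_ ht
    simpa using abs_sub_left_of_mem_uIcc hs

lemma abs_cutoff_le (k : ℕ) (t : ℝ) : |cutoff k t| ≤ |t| := by
  have := intervalIntegral.norm_integral_le_of_norm_le_const (a := 0) (b := t) (C := 1)
    (f := cutoffDeriv k) fun s _ => by
      rw [Real.norm_eq_abs, abs_of_nonneg (cutoffDeriv_nonneg k s)]
      exact cutoffDeriv_le_one k s
  simpa [cutoff] using this

lemma tendsto_cutoff (t : ℝ) : Tendsto (fun k => cutoff k t) atTop (𝓝 t) := by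
  have h := intervalIntegral.tendsto_integral_filter_of_dominated_convergence (μ := volume)
    (a := 0) (b := t) (F := cutoffDeriv) (f := fun _ => 1) (l := atTop) (fun _ => 1)
    (Eventually.of_forall fun k => (continuous_cutoffDeriv k).aestronglyMeasurable)
    (Eventually.of_forall fun k => Eventually.of_forall fun s _ => by
      rw [Real.norm_eq_abs, abs_of_nonneg (cutoffDeriv_nonneg k s)]
      exact cutoffDeriv_le_one k s) (by simp) (by
      have : ∀ᵐ s : ℝ, s ≠ 0 := by simp [ae_iff, measure_singleton]
      filter_upwards [this] with s hs _ using tendsto_cutoffDeriv hs)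
  simpa [cutoff] using h

end SmoothCutoff

/-! ### Integration by parts with compact support. -/

section Green

variable {E : Type*} [NormedAddCommGroup E] [InnerProductSpace ℝ E] [FiniteDimensional ℝ E]
  [MeasurableSpace E] [BorelSpace E] {Ω K : Set E}

lemma integrableOn_of_compact_of_eq_zero {g : E → ℝ} (hΩ : IsOpen Ω) (hK : IsCompact K) (hKΩ : K ⊆ Ω)
    (hg : ContinuousOn g Ω) (h0 : ∀ x ∈ Ω, x ∉ K → g x = 0) : IntegrableOn g Ω :=
  ((hg.mono hKΩ).integrableOn_compact hK).of_forall_sdiff_eq_zero hΩ.measurableSet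
    fun x hx => h0 x hx.1 hx.2

lemma IsC1Test.integral_fderiv_eq_zero {φ : E → ℝ} (h : IsC1Test Ω φ) (v : E) :
    ∫ x, fderiv ℝ φ x v = 0 := by
  have hc : Continuous fun x => fderiv ℝ φ x v :=
    (h.contDiff.continuous_fderiv (by norm_num)).clm_apply continuous_const
  have hi : Integrable fun x => fderiv ℝ φ x v :=
    hc.integrable_of_hasCompactSupport
      ((h.compact.fderiv ℝ).mono fun x hx h0 => hx (by simp [h0]))
  have := integral_mul_fderiv_eq_neg_fderiv_mul_of_integrable (μ := (volume : Measure E))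
    (f := fun _ : E => (1 : ℝ)) (g := φ) (v := v) (by simp) (by simpa using hi)
    (by simpa using h.contDiff.continuous.integrable_of_hasCompactSupport h.compact)
    (by fun_prop) (fun x _ => h.differentiable x)
  simpa using this

lemma laplacian_eq_sum_fderiv {v : E → ℝ} {ι : Type*} [Fintype ι] (b : OrthonormalBasis ι ℝ E)
    (x : E) : Laplacian.laplacian v x = ∑ i, fderiv ℝ (fderiv ℝ v) x (b i) (b i) := by
  rw [InnerProductSpace.laplacian_eq_iteratedFDeriv_orthonormalBasis v b]
  simp [iteratedFDeriv_two_apply]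

lemma ContDiffOn.continuousOn_laplacian {v : E → ℝ} (hΩ : IsOpen Ω) (hv : ContDiffOn ℝ 2 v Ω) :
    ContinuousOn (Laplacian.laplacian v) Ω := by
  have h1 : ContDiffOn ℝ 1 (fderiv ℝ v) Ω := hv.fderiv_of_isOpen hΩ (by norm_num)
  have h2 : ContinuousOn (fderiv ℝ (fderiv ℝ v)) Ω :=
    h1.continuousOn_fderiv_of_isOpen hΩ (by norm_num)
  refine ContinuousOn.congr (f := fun x => ∑ i, fderiv ℝ (fderiv ℝ v) x
    (stdOrthonormalBasis ℝ E i) (stdOrthonormalBasis ℝ E i)) ?_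
    fun x _ => laplacian_eq_sum_fderiv (stdOrthonormalBasis ℝ E) x
  exact continuousOn_finsetSum _ fun i _ =>
    (h2.clm_apply continuousOn_const).clm_apply continuousOn_const

lemma ContDiffOn.continuousOn_gradient {v : E → ℝ} (hΩ : IsOpen Ω) (hv : ContDiffOn ℝ 1 v Ω) :
    ContinuousOn (gradient v) Ω :=
  (InnerProductSpace.toDual ℝ E).symm.continuous.comp_continuousOn
    (hv.continuousOn_fderiv_of_isOpen hΩ (by norm_num))

/-- Green's identity without boundary terms. -/
lemma setIntegral_green {v ψ : E → ℝ} (hΩ : IsOpen Ω) (hK : IsCompact K) (hKΩ : K ⊆ Ω)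
    (hv : ContDiffOn ℝ 2 v Ω) (hψ : ContDiffOn ℝ 1 ψ Ω)
    (h0 : ∀ x ∈ Ω, x ∉ K → ∀ w, ψ x * fderiv ℝ v x w = 0) :
    ∫ x in Ω, (inner ℝ (gradient v x) (gradient ψ x) + ψ x * Laplacian.laplacian v x) = 0 := by
  set b := stdOrthonormalBasis ℝ E
  have hv' : ContDiffOn ℝ 1 (fderiv ℝ v) Ω := hv.fderiv_of_isOpen hΩ (by norm_num)
  -- The components of `ψ ∇v`, extended by zero. Each is a `C¹` test function even if `ψ` alone is
  -- not compactly supported, and the divergence is the integrand.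
  set V : Fin (Module.finrank ℝ E) → E → ℝ := fun i => Ω.indicator fun x =>
    ψ x * fderiv ℝ v x (b i) with hV
  have hVt : ∀ i, IsC1Test Ω (V i) := fun i => by
    refine IsC1Test.of_isCompact hΩ hK hKΩ ?_ fun x hx => ?_
    · exact (hψ.mul (hv'.clm_apply contDiffOn_const)).congr fun x hx => indicator_of_mem hx _
    · by_cases hxΩ : x ∈ Ω
      · rw [hV]
        simp only [indicator_of_mem hxΩ]
        exact h0 x hxΩ hx _
      · exact indicator_of_notMem hxΩ _
  have hVd : ∀ i, ∀ x ∈ Ω, fderiv ℝ (V i) x (b i) =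
      fderiv ℝ v x (b i) * fderiv ℝ ψ x (b i) +
        ψ x * fderiv ℝ (fderiv ℝ v) x (b i) (b i) := by
    intro i x hx
    have hψd : HasFDerivAt ψ (fderiv ℝ ψ x) x :=
      ((hψ.differentiableOn (by norm_num)).differentiableAt (hΩ.mem_nhds hx)).hasFDerivAt
    have hvd : HasFDerivAt (fderiv ℝ v) (fderiv ℝ (fderiv ℝ v) x) x :=
      ((hv'.differentiableOn (by norm_num)).differentiableAt (hΩ.mem_nhds hx)).hasFDerivAt
    have hd := hψd.mul (hvd.clm_apply (hasFDerivAt_const (b i) x))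
    have he : V i =ᶠ[𝓝 x] (ψ * fun x => fderiv ℝ v x (b i)) := by
      filter_upwards [hΩ.mem_nhds hx] with y hy
      rw [hV]
      simp only [indicator_of_mem hy, Pi.mul_apply]
    rw [he.fderiv_eq, hd.fderiv]
    simp
    ring
  have hsum : ∀ x ∈ Ω, inner ℝ (gradient v x) (gradient ψ x) + ψ x * Laplacian.laplacian v x =
      ∑ i, fderiv ℝ (V i) x (b i) := by
    intro x hx
    rw [Finset.sum_congr rfl fun i _ => hVd i x hx, Finset.sum_add_distrib, ← Finset.mul_sum,
      laplacian_eq_sum_fderiv b, ← b.sum_inner_mul_inner]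
    congr 1
    refine Finset.sum_congr rfl fun i _ => ?_
    rw [inner_gradient_left, real_inner_comm, inner_gradient_left]
  rw [setIntegral_congr_fun hΩ.measurableSet hsum, integral_finsetSum]
  · refine Finset.sum_eq_zero fun i _ => ?_
    rw [setIntegral_eq_integral_of_forall_compl_eq_zero, (hVt i).integral_fderiv_eq_zero]
    intro x hx
    rw [← inner_gradient_left, (hVt i).gradient_eq_zero hx, inner_zero_left]
  · intro i _
    have hc : Continuous fun x => fderiv ℝ (V i) x (b i) :=
      ((hVt i).contDiff.continuous_fderiv (by norm_num)).clm_apply continuous_const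
    exact (hc.integrable_of_hasCompactSupport
      (((hVt i).compact.fderiv ℝ).mono fun x hx h0 => hx (by simp [h0]))).integrableOn

end Green

/-! ### Classical solutions have finite energy. -/

section Classical

variable {E : Type*} [NormedAddCommGroup E] [InnerProductSpace ℝ E] [FiniteDimensional ℝ E]
  [MeasurableSpace E] [BorelSpace E] {Ω : Set E}

lemma sq_toReal_eLpNorm_two {α F : Type*} [MeasurableSpace α] {μ : Measure α}
    [NormedAddCommGroup F] [InnerProductSpace ℝ F] {a : α → F} (ha : MemLp a 2 μ) :
    (eLpNorm a 2 μ).toReal ^ 2 = ∫ x, ‖a x‖ ^ 2 ∂μ := by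
  rw [← Lp.norm_toLp a ha, ← real_inner_self_eq_norm_sq, integral_inner_toLp]
  simp only [real_inner_self_eq_norm_sq]

/-- Truncations of a function vanishing on the boundary are test functions. -/
lemma isC1Test_cutoff {u : E → ℝ} (hΩ : IsOpen Ω) (hb : Bornology.IsBounded Ω)
    (hu : ContDiffOn ℝ 1 u Ω) (huc : ContinuousOn u (closure Ω)) (hu0 : ∀ x ∈ frontier Ω, u x = 0)
    (k : ℕ) : ∃ K : Set E, IsCompact K ∧ K ⊆ Ω ∧ (∀ x ∈ Ω, x ∉ K → cutoff k (u x) = 0) ∧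
      IsC1Test Ω (Ω.indicator fun x => cutoff k (u x)) := by
  set K : Set E := closure Ω ∩ u ⁻¹' {t | 1 / ((k : ℝ) + 1) ≤ |t|} with hKdef
  have hK : IsCompact K := by
    refine hb.isCompact_closure.of_isClosed_subset ?_ inter_subset_left
    exact huc.preimage_isClosed_of_isClosed isClosed_closure
      (isClosed_le continuous_const continuous_abs)
  have hKΩ : K ⊆ Ω := by
    intro x hx
    by_contra hxΩ
    have hxf : x ∈ frontier Ω := by
      rw [hΩ.frontier_eq]
      exact ⟨hx.1, hxΩ⟩
    have h1 : 1 / ((k : ℝ) + 1) ≤ |u x| := hx.2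
    rw [hu0 x hxf, abs_zero] at h1
    have : (0 : ℝ) < 1 / ((k : ℝ) + 1) := by positivity
    linarith
  have h0 : ∀ x ∈ Ω, x ∉ K → cutoff k (u x) = 0 := by
    intro x hx hxK
    apply cutoff_eq_zero
    by_contra hlt
    exact hxK ⟨subset_closure hx, (not_le.1 hlt).le⟩
  refine ⟨K, hK, hKΩ, h0, IsC1Test.of_isCompact hΩ hK hKΩ ?_ ?_⟩
  · exact ((contDiff_cutoff k).comp_contDiffOn hu).congr fun x hx => indicator_of_mem hx _
  · intro x hx
    by_cases hxΩ : x ∈ Ω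
    · rw [indicator_of_mem hxΩ, h0 x hxΩ hx]
    · exact indicator_of_notMem hxΩ _

/-- A classical solution is a bounded weak solution. -/
theorem exists_weak_of_classical (hΩ : IsOpen Ω) (hbd : Bornology.IsBounded Ω) {f : ℝ → ℝ}
    (hf : Continuous f) {u : E → ℝ} (hu : ContDiffOn ℝ 2 u Ω) (huc : ContinuousOn u (closure Ω))
    (heq : ∀ x ∈ Ω, Laplacian.laplacian u x + f (u x) = 0) (hu0 : ∀ x ∈ frontier Ω, u x = 0) :
    ∃ M : ℝ, 0 ≤ M ∧ (∀ x ∈ Ω, |u x| ≤ M) ∧ AEStronglyMeasurable u (volume.restrict Ω) ∧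
      ∃ G : E → E, MemLp G 2 (volume.restrict Ω) ∧
        (∀ φ : E → ℝ, IsC1Test Ω φ →
          ∫ x in Ω, inner ℝ (G x) (gradient φ x) = ∫ x in Ω, f (u x) * φ x) ∧
        ∃ φ : ℕ → E → ℝ, (∀ k, IsC1Test Ω (φ k)) ∧
          Tendsto (fun k => eLpNorm (fun x => φ k x - u x) 2 (volume.restrict Ω)) atTop (𝓝 0) ∧
          Tendsto (fun k => eLpNorm (fun x => gradient (φ k) x - G x) 2 (volume.restrict Ω))
            atTop (𝓝 0) := by
  have hfin : volume Ω < ⊤ := hbd.measure_lt_top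
  have hfm : IsFiniteMeasure (volume.restrict Ω) := ⟨by simpa using hfin⟩
  set μ : Measure E := volume.restrict Ω with hμ
  have hu1 : ContDiffOn ℝ 1 u Ω := hu.of_le (by norm_num)
  have hae : ∀ {P : E → Prop}, (∀ x ∈ Ω, P x) → ∀ᵐ x ∂μ, P x := fun h =>
    (ae_restrict_iff' hΩ.measurableSet).2 (Eventually.of_forall h)
  have hum : AEStronglyMeasurable u μ := hu.continuousOn.aestronglyMeasurable hΩ.measurableSet
  obtain ⟨M, hM⟩ := hbd.isCompact_closure.exists_bound_of_continuousOn huc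
  have hMu : ∀ x ∈ Ω, |u x| ≤ |M| := fun x hx => (hM x (subset_closure hx)).trans (le_abs_self M)
  have hu2 : MemLp u 2 μ := MemLp.of_bound hum |M| (hae hMu)
  have hfum : AEStronglyMeasurable (fun x => f (u x)) μ := hf.comp_aestronglyMeasurable hum
  obtain ⟨C, hC⟩ := (isCompact_Icc (a := -|M|) (b := |M|)).exists_bound_of_continuousOn
    hf.continuousOn
  have hCu : ∀ x ∈ Ω, |f (u x)| ≤ C := fun x hx => hC _ (abs_le.1 (hMu x hx))
  have hfu2 : MemLp (fun x => f (u x)) 2 μ := MemLp.of_bound hfum C (hae hCu)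
  choose K hK hKΩ hK0 hv using isC1Test_cutoff hΩ hbd hu1 huc hu0
  set v : ℕ → E → ℝ := fun k => Ω.indicator fun x => cutoff k (u x) with hvdef
  have hvΩ : ∀ k, ∀ x ∈ Ω, v k x = cutoff k (u x) := fun k x hx => by
    simp only [hvdef, indicator_of_mem hx]
  have hv1 : ∀ k, IsC1Test Ω (v k) := hv
  have hvgrad : ∀ k, ∀ x ∈ Ω, gradient (v k) x = cutoffDeriv k (u x) • gradient u x := by
    intro k x hx
    have hud : HasFDerivAt u (fderiv ℝ u x) x :=
      ((hu.differentiableOn (by norm_num)).differentiableAt (hΩ.mem_nhds hx)).hasFDerivAt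
    have h1 := (hasDerivAt_cutoff k (u x)).comp_hasFDerivAt x hud
    have h2 : v k =ᶠ[𝓝 x] (cutoff k ∘ u) := by
      filter_upwards [hΩ.mem_nhds hx] with y hy using hvΩ k y hy
    rw [gradient, h2.fderiv_eq, h1.fderiv, gradient, map_smul]
  have hv2 : ∀ k, MemLp (v k) 2 μ := fun k => (hv1 k).memLp 2 μ
  have hvg2 : ∀ k, MemLp (gradient (v k)) 2 μ := fun k => (hv1 k).memLp_gradient 2 μ
  have hgu : ContinuousOn (gradient u) Ω := hu1.continuousOn_gradient hΩ
  -- Green's identity with the truncation as test function. The cutoff derivative lies in `[0, 1]`,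
  -- so its square is at most itself and `‖∇v k‖² ≤ ⟪∇u, ∇v k⟫`.
  have henergy : ∀ k, ∫ x, ‖gradient (v k) x‖ ^ 2 ∂μ ≤ ∫ x, f (u x) * v k x ∂μ := by
    intro k
    have hgv0 : ∀ x ∉ K k, gradient (v k) x = 0 := by
      intro x hx
      have : v k =ᶠ[𝓝 x] fun _ => 0 := by
        filter_upwards [(hK k).isClosed.isOpen_compl.mem_nhds hx] with y hy
        by_cases hyΩ : y ∈ Ω
        · rw [hvΩ k y hyΩ, hK0 k y hyΩ hy]
        · exact (hv1 k).eq_zero hyΩ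
      rw [gradient, this.fderiv_eq]
      simp
    have hgreen := setIntegral_green hΩ (hK k) (hKΩ k) hu (hv1 k).contDiff.contDiffOn
      (fun x hx hxK w => by rw [hvΩ k x hx, hK0 k x hx hxK, zero_mul])
    have i1 : Integrable (fun x => inner ℝ (gradient u x) (gradient (v k) x)) μ :=
      integrableOn_of_compact_of_eq_zero hΩ (hK k) (hKΩ k)
        (hgu.inner (hv1 k).continuous_gradient.continuousOn)
        (fun x _ hx => by rw [hgv0 x hx, inner_zero_right])
    have i2 : Integrable (fun x => f (u x) * v k x) μ := hfu2.integrable_mul (hv2 k)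
    have e1 : ∫ x in Ω, (inner ℝ (gradient u x) (gradient (v k) x) +
        v k x * Laplacian.laplacian u x) =
        ∫ x in Ω, (inner ℝ (gradient u x) (gradient (v k) x) - f (u x) * v k x) := by
      refine setIntegral_congr_fun hΩ.measurableSet fun x hx => ?_
      have : Laplacian.laplacian u x = -f (u x) := by linarith [heq x hx]
      simp only [this]
      ring
    rw [e1, integral_sub i1 i2, sub_eq_zero] at hgreen
    rw [← hgreen]
    apply integral_mono_ae ((hvg2 k).integrable_norm_pow (by norm_num)) i1
    refine hae fun x hx => ?_
    simp only [hvgrad k x hx, norm_smul, real_inner_smul_right, real_inner_self_eq_norm_sq,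
      mul_pow, Real.norm_eq_abs, sq_abs]
    have h0 := cutoffDeriv_nonneg k (u x)
    have h1 := cutoffDeriv_le_one k (u x)
    have : cutoffDeriv k (u x) ^ 2 ≤ cutoffDeriv k (u x) := by nlinarith
    exact mul_le_mul_of_nonneg_right this (by positivity)
  have hbound : ∃ D : ℝ, 0 ≤ D ∧ ∀ k, eLpNorm (gradient (v k)) 2 μ ≤ ENNReal.ofReal D := by
    refine ⟨Real.sqrt ((eLpNorm (fun x => f (u x)) 2 μ).toReal * (eLpNorm u 2 μ).toReal),
      Real.sqrt_nonneg _, fun k => ?_⟩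
    rw [← ENNReal.ofReal_toReal (hvg2 k).2.ne]
    refine ENNReal.ofReal_le_ofReal (Real.le_sqrt_of_sq_le ?_)
    rw [sq_toReal_eLpNorm_two (hvg2 k)]
    refine (henergy k).trans ((le_abs_self _).trans
      ((abs_integral_mul_le_eLpNorm hfu2 (hv2 k)).trans ?_))
    refine mul_le_mul_of_nonneg_left ?_ ENNReal.toReal_nonneg
    refine ENNReal.toReal_mono hu2.2.ne (eLpNorm_mono_ae (hae fun x hx => ?_))
    rw [hvΩ k x hx]
    exact abs_cutoff_le k _
  obtain ⟨D, hD0, hD⟩ := hbound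
  -- The cutoff derivative is always zero at `0` and tends to `1` elsewhere, so this is the
  -- pointwise limit of `∇v k` on all of `Ω`. No statement about `∇u` on the zero set is needed.
  set G : E → E := fun x => if u x = 0 then 0 else gradient u x with hGdef
  have hlimG : ∀ x ∈ Ω, Tendsto (fun k => gradient (v k) x) atTop (𝓝 (G x)) := by
    intro x hx
    simp only [hvgrad _ x hx, hGdef]
    split_ifs with h0
    · have : ∀ k, cutoffDeriv k (u x) = 0 := fun k => cutoffDeriv_eq_zero (by
        rw [h0, abs_zero]; positivity)
      simp [this]
    · simpa using (tendsto_cutoffDeriv h0).smul_const (gradient u x)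
  have hGm : AEStronglyMeasurable G μ :=
    aestronglyMeasurable_of_tendsto_ae _ (fun k => (hvg2 k).1) (hae hlimG)
  -- Fatou's lemma with the uniform energy bound. Once `G` is in `L²` it dominates `∇v k - G`, which
  -- gives strong convergence.
  have hG2 : MemLp G 2 μ := by
    refine ⟨hGm, lt_of_le_of_lt (Lp.eLpNorm_lim_le_liminf_eLpNorm (fun k => (hvg2 k).1) G
      (hae hlimG)) ?_⟩
    refine lt_of_le_of_lt (b := ENNReal.ofReal D) ?_ ENNReal.ofReal_lt_top
    exact liminf_le_of_le (by isBoundedDefault) fun b hb => by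
      obtain ⟨k, hk⟩ := hb.exists
      exact hk.trans (hD k)
  have hconvG : Tendsto (fun k => eLpNorm (fun x => gradient (v k) x - G x) 2 μ) atTop (𝓝 0) := by
    refine tendsto_eLpNorm_two_of_dominated hG2.norm (fun k => (hvg2 k).1) (fun k => ?_)
      (hae hlimG)
    refine hae fun x hx => ?_
    rw [hvgrad k x hx, hGdef]
    dsimp only
    split_ifs with h0
    · rw [cutoffDeriv_eq_zero (by rw [h0, abs_zero]; positivity)]
      simp
    · rw [show cutoffDeriv k (u x) • gradient u x - gradient u x =
        (cutoffDeriv k (u x) - 1) • gradient u x by rw [sub_smul, one_smul], norm_smul]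
      apply mul_le_of_le_one_left (norm_nonneg _)
      rw [Real.norm_eq_abs, abs_le]
      constructor <;> linarith [cutoffDeriv_nonneg k (u x), cutoffDeriv_le_one k (u x)]
  have hconvu : Tendsto (fun k => eLpNorm (fun x => v k x - u x) 2 μ) atTop (𝓝 0) := by
    refine tendsto_eLpNorm_two_of_bounded_ae (C := |M|) (fun k => (hv2 k).1) (fun k => ?_) ?_
    · refine hae fun x hx => ?_
      rw [hvΩ k x hx]
      exact (abs_cutoff_le k _).trans (hMu x hx)
    · refine hae fun x hx => ?_
      simp only [hvΩ _ x hx]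
      exact tendsto_cutoff _
  refine ⟨|M|, abs_nonneg M, hMu, hum, G, hG2, fun φ hφ => ?_, v, hv1, hconvu, hconvG⟩
  refine weak_identity_of_smooth hΩ hfin hG2 hfu2 (fun ψ hψs hψc hψΩ => ?_) hφ
  have hψ2 : ContDiff ℝ 2 ψ := hψs.of_le (by norm_cast)
  have hψ : IsC1Test Ω ψ := ⟨hψs.of_le (by norm_cast), hψc, hψΩ⟩
  have hψ0 : ∀ x, x ∉ tsupport ψ → gradient ψ x = 0 := fun x hx =>
    image_eq_zero_of_notMem_tsupport fun h => hx (tsupport_gradient_subset h)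
  have hψd0 : ∀ x, x ∉ tsupport ψ → fderiv ℝ ψ x = 0 := fun x hx =>
    image_eq_zero_of_notMem_tsupport fun h => hx (tsupport_fderiv_subset ℝ h)
  have hlapc : Continuous (Laplacian.laplacian ψ) := by
    have := hψ2.contDiffOn.continuousOn_laplacian isOpen_univ
    rwa [← continuousOn_univ]
  have hlap0 : ∀ x, x ∉ tsupport ψ → Laplacian.laplacian ψ x = 0 := by
    intro x hx
    have : fderiv ℝ (fderiv ℝ ψ) x = 0 := by
      have he : fderiv ℝ ψ =ᶠ[𝓝 x] fun _ => 0 := by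
        filter_upwards [(isClosed_tsupport ψ).isOpen_compl.mem_nhds hx] with y hy using hψd0 y hy
      rw [he.fderiv_eq]
      simp
    rw [laplacian_eq_sum_fderiv (stdOrthonormalBasis ℝ E), this]
    simp
  have hlap2 : MemLp (Laplacian.laplacian ψ) 2 μ :=
    hlapc.memLp_of_hasCompactSupport (hψc.isCompact.of_isClosed_subset isClosed_closure
      (closure_minimal (fun x hx => by
        by_contra h
        exact hx (hlap0 x h)) (isClosed_tsupport ψ)))
  have hψK : IsCompact (tsupport ψ) := hψc
  have hgreen : ∀ w : E → ℝ, ContDiffOn ℝ 1 w Ω →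
      ∫ x in Ω, inner ℝ (gradient w x) (gradient ψ x) =
        -∫ x in Ω, w x * Laplacian.laplacian ψ x := by
    intro w hw
    have h1 := setIntegral_green hΩ hψK hψΩ hψ2.contDiffOn hw
      (fun x _ hx y => by rw [hψd0 x hx]; simp)
    have i1 : IntegrableOn (fun x => inner ℝ (gradient ψ x) (gradient w x)) Ω :=
      integrableOn_of_compact_of_eq_zero hΩ hψK hψΩ
        (hψ.continuous_gradient.continuousOn.inner (hw.continuousOn_gradient hΩ))
        (fun x _ hx => by rw [hψ0 x hx, inner_zero_left])
    have i2 : IntegrableOn (fun x => w x * Laplacian.laplacian ψ x) Ω :=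
      integrableOn_of_compact_of_eq_zero hΩ hψK hψΩ (hw.continuousOn.mul hlapc.continuousOn)
        (fun x _ hx => by rw [hlap0 x hx, mul_zero])
    rw [integral_add i1 i2] at h1
    simp only [real_inner_comm (gradient ψ _)]
    linarith
  have hgreenu : ∫ x in Ω, inner ℝ (gradient u x) (gradient ψ x) = ∫ x in Ω, f (u x) * ψ x := by
    have h1 := setIntegral_green hΩ hψK hψΩ hu hψ.contDiff.contDiffOn
      (fun x _ hx y => by rw [image_eq_zero_of_notMem_tsupport hx, zero_mul])
    have i1 : IntegrableOn (fun x => inner ℝ (gradient u x) (gradient ψ x)) Ω :=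
      integrableOn_of_compact_of_eq_zero hΩ hψK hψΩ
        (hgu.inner hψ.continuous_gradient.continuousOn)
        (fun x _ hx => by rw [hψ0 x hx, inner_zero_right])
    have i2 : IntegrableOn (fun x => f (u x) * ψ x) Ω :=
      hfu2.integrable_mul (hψ.memLp 2 μ)
    have e1 : ∫ x in Ω, (inner ℝ (gradient u x) (gradient ψ x) +
        ψ x * Laplacian.laplacian u x) =
        ∫ x in Ω, (inner ℝ (gradient u x) (gradient ψ x) - f (u x) * ψ x) := by
      refine setIntegral_congr_fun hΩ.measurableSet fun x hx => ?_
      have : Laplacian.laplacian u x = -f (u x) := by linarith [heq x hx]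
      simp only [this]
      ring
    rw [e1, integral_sub i1 i2, sub_eq_zero] at h1
    exact h1
  have hl1 := tendsto_integral_inner_of_tendsto_eLpNorm hvg2 (fun _ => hψ.memLp_gradient 2 μ) hG2
    (hψ.memLp_gradient 2 μ) hconvG (tendsto_eLpNorm_const_zero _)
  have hl2 := tendsto_integral_mul_of_tendsto_eLpNorm hv2 (fun _ => hlap2) hu2 hlap2 hconvu
    (tendsto_eLpNorm_const_zero _)
  simp_rw [hμ, fun k => hgreen (v k) (hv1 k).contDiff.contDiffOn] at hl1
  -- The identity is obtained through `∫ ⟪G, ∇ψ⟫ = -∫ u Δψ = ∫ ⟪∇u, ∇ψ⟫`, which avoids comparing `G`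
  -- with `∇u` where `u = 0`. This route needs two derivatives of `ψ`, hence the smooth test
  -- functions.
  have h3 := tendsto_nhds_unique hl1 hl2.neg
  rw [h3, ← hgreen u hu1, hgreenu]

end Classical

/-! ### Assembly for the tube. -/

section Final

variable {n : ℕ}

lemma IsTestFunction.isC1Test {Ω : Set (EuclideanSpace ℝ (Fin n))}
    {φ : EuclideanSpace ℝ (Fin n) → ℝ} (h : IsTestFunction Ω φ) :
    IsC1Test Ω φ :=
  ⟨h.smooth.of_le (by norm_cast), h.compact, h.support⟩

/-- Sufficiently thin tubes are images of controlled domains. -/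
lemma exists_tube_eq_image (hn : 3 ≤ n) {a b : ℝ} (hab : a < b) {γ : ℝ → EuclideanSpace ℝ (Fin n)}
    (hγ : ContDiffOn ℝ 3 γ (Icc a b)) (hreg : ∀ t ∈ Icc a b, derivWithin γ (Icc a b) t ≠ 0)
    (hinj : InjOn γ (Icc a b)) {η : ℝ} (hη : 0 < η) :
    ∃ (X : EuclideanSpace ℝ (Fin n) → EuclideanSpace ℝ (Fin n)) (ε₀ : ℝ),
      ContDiff ℝ 1 X ∧ 0 < ε₀ ∧ ∀ ε < ε₀, ∃ Q : Set (EuclideanSpace ℝ (Fin n)),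
      tube γ a b ε = X '' Q ∧ InjOn X Q ∧ (∀ z ∈ Q, (fderiv ℝ X z).det ≠ 0) ∧
      DilationControl Q (fun z => inverseAdjoint (fderiv ℝ X z))
        (fun z => |(fderiv ℝ X z).det|) η := by
  obtain ⟨L, c, -, hc, hc1, hcinj, htube⟩ := exists_arclength hab hγ hreg hinj
  have hc' : ContDiff ℝ 1 (deriv c) := by
    have h3 : ContDiff ℝ (2 + 1) c := by
      norm_num at hc ⊢
      exact hc
    exact (contDiff_succ_iff_deriv.1 h3).2.2.of_le (by norm_num)
  obtain ⟨e, he, hne⟩ := exists_unit_forall_ne (E := EuclideanSpace ℝ (Fin n)) (by simpa using hn) hc'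
  have hX := contDiff_tubeMap hc hne
  obtain ⟨ε₀, hε₀, hctrl⟩ := exists_dilationControl he (L := L) hX (by
    rintro _ ⟨t, ht, rfl⟩
    exact ⟨_, (fderiv_tubeMap_axis hc he hne (hc1 t ht)).trans (exchange_eq_reflection _ _)⟩) (by
    rintro _ ⟨t, ht, rfl⟩ _ ⟨s, hs, rfl⟩ h
    dsimp only at h ⊢
    rw [tubeMap_smul c he, tubeMap_smul c he] at h
    rw [hcinj ht hs h]) hη
  refine ⟨tubeMap c e, ε₀, hX.of_le (by norm_num), hε₀, fun ε hε => ⟨straightTube e L ε, ?_,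
    hctrl ε hε.le⟩⟩
  rw [htube, image_tubeMap_straightTube he hc1]

/-- The nonnegative primitive has a minimum at `0`. The equality is what makes the zero function a
solution. -/
lemma nonlinearity_zero {f : ℝ → ℝ} (hf : Continuous f) (hs : ∀ t, 0 ≤ t * f t) : f 0 = 0 := by
  obtain ⟨g, F, -, -, hgf, hFd, hF0, hFn, -⟩ := exists_bounded_truncation hf hs zero_le_one
  have hmin : IsLocalMin F 0 := Eventually.of_forall fun t => by rw [hF0]; exact hFn t
  rw [← hgf 0 (by simp)]
  exact hmin.hasDerivAt_eq_zero (hFd 0)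

end Final

theorem theorem2p1 (n : ℕ) (hn : 3 ≤ n) (a b : ℝ) (hab : a < b)
    (γ : ℝ → EuclideanSpace ℝ (Fin n))
    (hγ : ContDiffOn ℝ 3 γ (Icc a b))
    (hγ_reg : ∀ t ∈ Icc a b, derivWithin γ (Icc a b) t ≠ 0)
    (hγ_inj : InjOn γ (Icc a b))
    (f : ℝ → ℝ) (hf : Continuous f)
    (p : ℝ) (hp : 2 * (n : ℝ) / ((n : ℝ) - 2) < p)
    (hfp : ∀ t : ℝ, p * (∫ τ in (0 : ℝ)..t, f τ) ≤ t * f t ∧ 0 ≤ p * ∫ τ in (0 : ℝ)..t, f τ) :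
    ∃ ε₀ : ℝ, 0 < ε₀ ∧ ∀ ε : ℝ, 0 < ε → ε < ε₀ →
      ∀ u : EuclideanSpace ℝ (Fin n) → ℝ,
        (IsClassicalSolution f (tube γ a b ε) u ↔ ∀ x ∈ closure (tube γ a b ε), u x = 0) ∧
        (IsBoundedWeakSolution f (tube γ a b ε) u ↔
          ∀ᵐ x ∂(volume.restrict (tube γ a b ε)), u x = 0) := by
  have hn3 : (3 : ℝ) ≤ n := by exact_mod_cast hn
  have hn2 : (0 : ℝ) < (n : ℝ) - 2 := by linarith
  have hp0 : 0 < p := lt_of_le_of_lt (by positivity) hp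
  have hpn : 2 * (n : ℝ) < p * ((n : ℝ) - 2) := by rwa [div_lt_iff₀ hn2] at hp
  -- Equality in `hpη` below would hold at `(p (n - 2) - 2n) / (p + 2)`; half of this value is
  -- taken, positive by supercriticality.
  set η : ℝ := (p * ((n : ℝ) - 2) - 2 * n) / (2 * (p + 2)) with hηdef
  have hη : 0 < η := div_pos (by linarith) (by linarith)
  have hηe : η * (2 * (p + 2)) = p * ((n : ℝ) - 2) - 2 * n :=
    div_mul_cancel₀ _ (by linarith)
  have hpη : ((n : ℝ) + η) / p < ((n : ℝ) - 2 - η) / 2 := by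
    rw [div_lt_div_iff₀ hp0 two_pos]
    nlinarith
  have hs : ∀ t, 0 ≤ t * f t := fun t => (hfp t).2.trans (hfp t).1
  have hf0 : f 0 = 0 := nonlinearity_zero hf hs
  obtain ⟨X, ε₀, hX, hε₀, hctrl⟩ := exists_tube_eq_image hn hab hγ hγ_reg hγ_inj hη
  refine ⟨ε₀, hε₀, fun ε _ hε u => ?_⟩
  obtain ⟨Q, hQ, hXinj, hdet, hDC⟩ := hctrl ε hε
  have hΩo : IsOpen (tube γ a b ε) := by
    obtain ⟨e, -, -, het, -⟩ := exists_openPartialHomeomorph hX hDC.isOpen hXinj hdet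
    rw [hQ, ← het]
    exact e.open_target
  have hΩb : Bornology.IsBounded (tube γ a b ε) := by
    rw [hQ]
    exact (hDC.isBounded.isCompact_closure.image hX.continuous).isBounded.subset
      (image_mono subset_closure)
  have hΩfin : volume (tube γ a b ε) < ⊤ := hΩb.measure_lt_top
  have hfm : IsFiniteMeasure (volume.restrict (tube γ a b ε)) := ⟨by simpa using hΩfin⟩
  -- Both notions of solution reduce to this one: bounded, with an `L²` gradient approximated by
  -- `C¹` test functions. The Pohozaev argument gives `G = 0`, and Poincaré's inequality then gives
  -- `u = 0`.
  have main : ∀ (M : ℝ) (G : EuclideanSpace ℝ (Fin n) → EuclideanSpace ℝ (Fin n))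
      (φ : ℕ → EuclideanSpace ℝ (Fin n) → ℝ), 0 ≤ M →
      AEStronglyMeasurable u (volume.restrict (tube γ a b ε)) →
      (∀ᵐ x ∂(volume.restrict (tube γ a b ε)), |u x| ≤ M) →
      MemLp G 2 (volume.restrict (tube γ a b ε)) →
      (∀ ψ : EuclideanSpace ℝ (Fin n) → ℝ, IsC1Test (tube γ a b ε) ψ →
        ∫ x in tube γ a b ε, inner ℝ (G x) (gradient ψ x) =
          ∫ x in tube γ a b ε, f (u x) * ψ x) →
      (∀ k, IsC1Test (tube γ a b ε) (φ k)) →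
      Tendsto (fun k => eLpNorm (fun x => φ k x - u x) 2 (volume.restrict (tube γ a b ε)))
        atTop (𝓝 0) →
      Tendsto (fun k => eLpNorm (fun x => gradient (φ k) x - G x) 2
        (volume.restrict (tube γ a b ε))) atTop (𝓝 0) →
      ∀ᵐ x ∂(volume.restrict (tube γ a b ε)), u x = 0 := by
    intro M G φ hM hum huM hG hweak hφ hl0 hl1
    have hG0 : ∀ᵐ x ∂(volume.restrict (tube γ a b ε)), G x = 0 := by
      rw [hQ] at hum huM hG hweak hφ hl0 hl1 ⊢
      exact ae_gradient_eq_zero_of_dilationControl hX hXinj hdet hDC hp0 hη.le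
        (by simpa using hpη) hf hfp hM hum huM hG hweak hφ hl0 hl1
    refine ae_eq_zero_of_tendsto_gradient_zero (by simpa using hn) hΩb
      (MemLp.of_bound hum M huM) hφ hl0 (hl1.congr fun k => eLpNorm_congr_ae ?_)
    filter_upwards [hG0] with x hx
    rw [hx, sub_zero]
  refine ⟨⟨fun hu => ?_, fun hu => ?_⟩, ⟨?_, fun hu => ?_⟩⟩
  · obtain ⟨M, hM, huM, hum, G, hG, hweak, φ, hφ, hl0, hl1⟩ :=
      exists_weak_of_classical hΩo hΩb hf hu.contDiffOn hu.continuousOn hu.equation hu.boundary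
    have hae := main M G φ hM hum
      ((ae_restrict_iff' hΩo.measurableSet).2 (Eventually.of_forall huM)) hG hweak hφ hl0 hl1
    -- Continuity upgrades vanishing almost everywhere to the open tube and then to its closure.
    have heq : EqOn u (fun _ => 0) (tube γ a b ε) :=
      Measure.eqOn_open_of_ae_eq hae hΩo hu.contDiffOn.continuousOn continuousOn_const
    exact heq.of_subset_closure hu.continuousOn continuousOn_const subset_closure subset_rfl
  · have huΩ : ∀ x ∈ tube γ a b ε, u x = 0 := fun x hx => hu x (subset_closure hx)
    refine ⟨contDiffOn_const.congr huΩ, continuousOn_const.congr hu, fun x hx => ?_,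
      fun x hx => hu x (frontier_subset_closure hx)⟩
    have h1 : ∀ᶠ y in 𝓝 x, fderiv ℝ u y = 0 := by
      filter_upwards [hΩo.mem_nhds hx] with y hy
      have : u =ᶠ[𝓝 y] fun _ => 0 := by
        filter_upwards [hΩo.mem_nhds hy] with z hz using huΩ z hz
      rw [this.fderiv_eq]
      simp
    have h2 : fderiv ℝ u =ᶠ[𝓝 x] fun _ => 0 := h1
    rw [laplacian_eq_sum_fderiv (stdOrthonormalBasis ℝ _), h2.fderiv_eq, huΩ x hx, hf0]
    simp
  · rintro ⟨hutop, G, ⟨hu2, hG2, φ, hφ, hl0, hl1⟩, hweak⟩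
    have huM : ∀ᵐ x ∂(volume.restrict (tube γ a b ε)),
        |u x| ≤ (eLpNorm u ⊤ (volume.restrict (tube γ a b ε))).toReal := by
      have := ae_le_eLpNormEssSup (f := u) (μ := volume.restrict (tube γ a b ε))
      filter_upwards [this] with x hx
      have h1 : ‖u x‖ₑ.toReal ≤ (eLpNorm u ⊤ (volume.restrict (tube γ a b ε))).toReal :=
        ENNReal.toReal_mono hutop.2.ne (by simpa only [eLpNorm_exponent_top] using hx)
      rwa [toReal_enorm, Real.norm_eq_abs] at h1
    obtain ⟨C, hC⟩ := (isCompact_Icc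
      (a := -(eLpNorm u ⊤ (volume.restrict (tube γ a b ε))).toReal)
      (b := (eLpNorm u ⊤ (volume.restrict (tube γ a b ε))).toReal)).exists_bound_of_continuousOn
      hf.continuousOn
    have hfu : MemLp (fun x => f (u x)) 2 (volume.restrict (tube γ a b ε)) := by
      refine MemLp.of_bound (hf.comp_aestronglyMeasurable hu2.1) C ?_
      filter_upwards [huM] with x hx using hC _ (abs_le.1 hx)
    exact main _ G φ ENNReal.toReal_nonneg hu2.1 huM hG2
      (fun ψ hψ => weak_identity_of_smooth hΩo hΩfin hG2 hfu
        (fun χ h1 h2 h3 => hweak χ ⟨h1, h2, h3⟩) hψ)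
      (fun k => (hφ k).isC1Test) hl0 hl1
  · have hu' : u =ᵐ[volume.restrict (tube γ a b ε)] fun _ => 0 := hu
    have hgrad : gradient (fun _ : EuclideanSpace ℝ (Fin n) => (0 : ℝ)) = fun _ => 0 := by
      ext1 x
      simp [gradient]
    refine ⟨(memLp_congr_ae hu').2 (memLp_const 0), fun _ => 0,
      ⟨(memLp_congr_ae hu').2 (memLp_const 0), memLp_const 0, fun _ _ => 0, fun _ => ?_, ?_, ?_⟩,
      fun φ _ => ?_⟩
    · exact ⟨contDiff_const, HasCompactSupport.zero, by simp [tsupport]⟩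
    · have : eLpNorm (fun x => 0 - u x) 2 (volume.restrict (tube γ a b ε)) = 0 := by
        rw [eLpNorm_congr_ae (g := fun _ => 0)]
        · simp
        · filter_upwards [hu] with x hx
          rw [hx, sub_zero]
      simp only [this]
      exact tendsto_const_nhds
    · simp [hgrad]
    · have : ∫ x in tube γ a b ε, f (u x) * φ x = 0 := by
        apply integral_eq_zero_of_ae
        filter_upwards [hu] with x hx
        rw [hx, hf0]
        simp
      rw [this]
      simp
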